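/- Let $\lg=\log_2$. For a finite set $S=\{x_1<\dots<x_n\}\subseteq[0..u)$, $u\ge 1$, write each element as an $\ell$-bit string, $\ell=\lceil\lg u\rceil$, most significant bit first, and let $\mathrm{trie}(S)=|x_1|+\sum_{i=2}^{n}|x_i\ominus x_{i-1}|$, where $x\ominus y$ is $x$ without the longest common prefix of $x$ and $y$ (so $\mathrm{trie}(S)$ is the number of edges of the binary trie of these strings; $\mathrm{trie}(\varnothing)=0$). The level-wise trie bit vector $B(S)$ lists the internal nodes of this trie level by level, from left to right, with two bits per node that tell whether it has a left and a right child. Let $\mathrm{rank}(S,x)=|\{y\in S: y\le x\}|$. For a query $\mathcal Q=\{i_1,\dots,i_k\}\subseteq[1..N]$, $k\ge1$, on sets $S_1,\dots,S_N\subseteq[0..u)$ let $\mathcal I(\mathcal Q)=\bigcap_{i\in\mathcal Q}S_i$. The alternation measure $\delta$ of $\mathcal Q$ is the smallest size of a partition of $[0..u)$ into intervals in which $\{x\}$ is a part for every $x\in\mathcal I(\mathcal Q)$ and every $x\notin\mathcal I(\mathcal Q)$ lies in a part that is disjoint from $S_i$ for some $i\in\mathcal Q$. **Theorem.** Each set $S\subseteq[0..u)$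 with $n$ elements can be represented by $B(S)$ together with auxiliary bits, using $2(\mathrm{trie}(S)-n+1)+o(\mathrm{trie}(S))$ bits in total, where the $o(\cdot)$ term is a function of $\mathrm{trie}(S)$ only, such that the following holds. Let $S_1,\dots,S_N\subseteq[0..u)$ be sets with $|S_i|=n_i$. Store their representations one after the other, with a directory of their starting positions, in the memory of a word RAM with word size $w\ge\lg(u+1)+\lg(N+1)+O(1)$ in which arithmetic, logical and bitwise operations, shifts and memory accesses take unit time. Then: 1. The number of $1$s among the first $p$ bits of $B(S_i)$ can be computed in $O(1)$ time, for every $i\in[1..N]$ and $0\le p\le|B(S_i)|$. 2. For every query $\mathcal Q=\{i_1,\dots,i_k\}\subseteq[1..N]$ with $k\ge1$, the intersection $\mathcal I(\mathcal Q)$, in increasing order, together with the sequence $\langle\mathrm{rank}(S_{i_1},x),\dots,\mathrm{rank}(S_{i_k},x)\rangle$ for every $x\in\mathcal I(\mathcal Q)$, can be computed in $O\bigl(k\,\delta\,(1+\lg(u/\delta))\bigr)$ time. The two programs do not depend on the input, they leave the stored data unchanged, and the implied constants are absolute (independent of $u$, $N$, $w$, $k$ and the sets). -/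

import Mathlib

namespace TrieIntersection

/-! ### Sets of integers, binary tries and their size -/

/-- `rank(S, x) = |{y ∈ S : y ≤ x}|`. -/
def rank (S : Finset ℕ) (x : ℕ) : ℕ := (S.filter (fun y => y ≤ x)).card

/-- `ℓ = ⌈lg u⌉`, the length of the binary codes of the elements of `[0..u)`. -/
def codeLength (u : ℕ) : ℕ := Nat.clog 2 u

/-- The `ℓ`-bit binary code of `x`, most significant bit first. -/
def binCode (ℓ x : ℕ) : List Bool := (List.range ℓ).map (fun j => x.testBit (ℓ - 1 - j))

/-- `x ⊖ y`: the bit string `x` without the longest common prefix of `x` and `y`. -/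
def ominus : List Bool → List Bool → List Bool
  | [], _ => []
  | x, [] => x
  | a :: x, b :: y => if a = b then ominus x y else a :: x

/-- `trie(S) = |x₁| + ∑_{i ≥ 2} |xᵢ ⊖ xᵢ₋₁|`, where `x₁ < ⋯ < xₙ` are the elements of `S`
written with `⌈lg u⌉` bits each (and `trie(∅) = 0`). -/
def trieMeasure (u : ℕ) (S : Finset ℕ) : ℕ :=
  let L := (S.sort (fun a b => a ≤ b)).map (binCode (codeLength u))
  (L.headD []).length + ((List.zipWith ominus L.tail L).map List.length).sum

/-- The nodes of the binary trie at depth `d ≤ ℓ`: the length-`d` prefixes of the codes of the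
elements of `S`, each read as a number. -/
def nodesAt (ℓ : ℕ) (S : Finset ℕ) (d : ℕ) : Finset ℕ := S.image (fun x => x / 2 ^ (ℓ - d))

/-- The bit vector of the internal nodes at depth `d < ℓ`, from left to right, two bits per node:
is there a left child, is there a right child. -/
def levelBits (ℓ : ℕ) (S : Finset ℕ) (d : ℕ) : List Bool :=
  ((nodesAt ℓ S d).sort (fun a b => a ≤ b)).flatMap (fun v =>
    [decide (2 * v ∈ nodesAt ℓ S (d + 1)), decide (2 * v + 1 ∈ nodesAt ℓ S (d + 1))])

/-- The level-wise representation of the binary trie of `S ⊆ [0..u)`: the bit vectors of all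
levels, from the root downwards, one after the other. -/
def trieBits (u : ℕ) (S : Finset ℕ) : List Bool :=
  (List.range (codeLength u)).flatMap (levelBits (codeLength u) S)

/-! ### Intersection queries and the alternation measure -/

/-- `⋂ⱼ Tⱼ`, for sets `T₁, …, T_k ⊆ [0..u)`. -/
def interSet (u : ℕ) {k : ℕ} (T : Fin k → Finset ℕ) : Finset ℕ :=
  (Finset.range u).filter (fun x => ∀ j, x ∈ T j)

/-- A partition certificate: a partition of `[0..u)` into intervals in which every element of the
intersection forms an interval of its own and every other element lies in an interval that is
disjoint from one of the sets. -/
def IsPartitionCertificate (u : ℕ) {k : ℕ} (T : Fin k → Finset ℕ)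
    (P : Finpartition (Finset.range u)) : Prop :=
  (∀ I ∈ P.parts, ∃ a b, I = Finset.Icc a b) ∧
  (∀ x ∈ interSet u T, ({x} : Finset ℕ) ∈ P.parts) ∧
  (∀ x ∈ Finset.range u, x ∉ interSet u T → ∃ I ∈ P.parts, x ∈ I ∧ ∃ j, Disjoint (T j) I)

/-- The alternation measure `δ`: the size of a smallest partition certificate. -/
noncomputable def alternation (u : ℕ) {k : ℕ} (T : Fin k → Finset ℕ) : ℕ :=
  sInf {m | ∃ P : Finpartition (Finset.range u), IsPartitionCertificate u T P ∧ P.parts.card = m}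

/-! ### The word RAM -/

/-- Unit-cost operations on words (unsigned, modulo `2 ^ w`). -/
inductive Op where
  | add | sub | mul | div | mod | and | or | xor | shl | shr | lt | eq

/-- Comparisons give `1` or `0`. -/
def Op.eval {w : ℕ} : Op → BitVec w → BitVec w → BitVec w
  | .add, a, b => a + b
  | .sub, a, b => a - b
  | .mul, a, b => a * b
  | .div, a, b => a / b
  | .mod, a, b => a % b
  | .and, a, b => a &&& b
  | .or, a, b => a ||| b
  | .xor, a, b => a ^^^ b
  | .shl, a, b => a <<< b.toNat
  | .shr, a, b => a >>> b.toNat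
  | .lt, a, b => if a.toNat < b.toNat then BitVec.ofNat w 1 else BitVec.ofNat w 0
  | .eq, a, b => if a = b then BitVec.ofNat w 1 else BitVec.ofNat w 0

/-- Programs. Registers are named by natural numbers; a program mentions finitely many of them. -/
inductive Prog where
  /-- Do nothing. -/
  | skip
  /-- `R[d] := c`. -/
  | const (d c : ℕ)
  /-- `R[d] := R[a] o R[b]`. -/
  | op (o : Op) (d a b : ℕ)
  /-- `R[d] := M[R[a]]`. -/
  | load (d a : ℕ)
  /-- `M[R[a]] := R[b]`. -/
  | store (a b : ℕ)
  /-- Sequential composition. -/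
  | seq (p q : Prog)
  /-- If `R[r] ≠ 0` then `p` else `q`. -/
  | cond (r : ℕ) (p q : Prog)
  /-- While `R[r] ≠ 0` do `p`. -/
  | loop (r : ℕ) (p : Prog)

/-- Registers, and a memory of `2 ^ w` cells of `w` bits. -/
structure State (w : ℕ) where
  reg : ℕ → BitVec w
  mem : BitVec w → BitVec w

def State.setReg {w : ℕ} (s : State w) (d : ℕ) (v : BitVec w) : State w :=
  { s with reg := Function.update s.reg d v }

def State.setMem {w : ℕ} (s : State w) (a v : BitVec w) : State w :=
  { s with mem := Function.update s.mem a v }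

/-- `Exec p s t s'`: started in `s`, the program `p` halts in `s'` after exactly `t` steps. Each
assignment, operation, memory access and each evaluation of a branch or loop test is one step. -/
inductive Exec {w : ℕ} : Prog → State w → ℕ → State w → Prop where
  | skip (s) : Exec .skip s 0 s
  | const (s d c) : Exec (.const d c) s 1 (s.setReg d (BitVec.ofNat w c))
  | op (s o d a b) : Exec (.op o d a b) s 1 (s.setReg d (o.eval (s.reg a) (s.reg b)))
  | load (s d a) : Exec (.load d a) s 1 (s.setReg d (s.mem (s.reg a)))
  | store (s a b) : Exec (.store a b) s 1 (s.setMem (s.reg a) (s.reg b))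
  | seq {p q s₁ s₂ s₃ t₁ t₂} :
      Exec p s₁ t₁ s₂ → Exec q s₂ t₂ s₃ → Exec (.seq p q) s₁ (t₁ + t₂) s₃
  | cond_true {r p q s s' t} :
      s.reg r ≠ 0#w → Exec p s t s' → Exec (.cond r p q) s (t + 1) s'
  | cond_false {r p q s s' t} :
      s.reg r = 0#w → Exec q s t s' → Exec (.cond r p q) s (t + 1) s'
  | loop_stop {r p s} : s.reg r = 0#w → Exec (.loop r p) s 1 s
  | loop_step {r p s₁ s₂ s₃ t₁ t₂} :
      s₁.reg r ≠ 0#w → Exec p s₁ t₁ s₂ → Exec (.loop r p) s₂ t₂ s₃ →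
      Exec (.loop r p) s₁ (t₁ + t₂ + 1) s₃

/-- The cell with address `a`. -/
def State.cell {w : ℕ} (s : State w) (a : ℕ) : BitVec w := s.mem (BitVec.ofNat w a)

/-! ### Memory layout

The cells `0, …, N` are a directory: cell `i` holds the position of the first bit of the `i`-th
representation within the concatenation of all `N` representations, cell `N` the total length.
The concatenation follows, densely packed into words; then the arguments of the query, one per
cell; the remaining cells are free. -/

/-- Position of the first bit of the `i`-th representation in the concatenation. -/
def startBit {N : ℕ} (E : Fin N → List Bool) (i : ℕ) : ℕ :=
  ∑ j : Fin N with j.val < i, (E j).length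

/-- First cell of the arguments. -/
def argBase (w : ℕ) {N : ℕ} (E : Fin N → List Bool) : ℕ :=
  N + 1 + (startBit E N + w - 1) / w

/-- First free cell. -/
def freeBase (w : ℕ) {N : ℕ} (E : Fin N → List Bool) (args : List ℕ) : ℕ :=
  argBase w E + args.length

/-- The input fits into the `2 ^ w` cells, and its numbers fit into words. -/
def Fits (w u : ℕ) {N : ℕ} (E : Fin N → List Bool) (args : List ℕ) : Prop :=
  u < 2 ^ w ∧ startBit E N < 2 ^ w ∧ freeBase w E args ≤ 2 ^ w ∧ ∀ x ∈ args, x < 2 ^ w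

/-- `s` is an initial state for the representations `E` and the given arguments. The free cells
and the registers from `7` on have arbitrary contents. -/
structure Loaded (w u : ℕ) {N : ℕ} (E : Fin N → List Bool) (args : List ℕ) (s : State w) :
    Prop where
  reg_wordSize : s.reg 0 = BitVec.ofNat w w
  reg_universe : s.reg 1 = BitVec.ofNat w u
  reg_family : s.reg 2 = BitVec.ofNat w N
  reg_argCount : s.reg 3 = BitVec.ofNat w args.length
  reg_bits : s.reg 4 = BitVec.ofNat w (N + 1)
  reg_args : s.reg 5 = BitVec.ofNat w (argBase w E)
  reg_free : s.reg 6 = BitVec.ofNat w (freeBase w E args)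
  directory : ∀ i ≤ N, s.cell i = BitVec.ofNat w (startBit E i)
  bits : ∀ (i : Fin N) (p : ℕ) (hp : p < (E i).length),
    (s.cell (N + 1 + (startBit E i + p) / w)).getLsbD ((startBit E i + p) % w) = (E i)[p]
  arguments : ∀ (j : ℕ) (hj : j < args.length),
    s.cell (argBase w E + j) = BitVec.ofNat w args[j]

/-- Output of an intersection query: register `0` holds `|⋂ⱼ Tⱼ|`, register `1` the address of an
array with the elements `x` of the intersection in increasing order, and register `2` the address
of an array with the sequences `rank(T₁, x), …, rank(T_k, x)`, for these `x` in the same order. -/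
structure IntersectionOutput (u : ℕ) {w k : ℕ} (T : Fin k → Finset ℕ) (s : State w) : Prop where
  count : (s.reg 0).toNat = (interSet u T).card
  elements : ∀ (j : ℕ) (hj : j < ((interSet u T).sort (fun a b => a ≤ b)).length),
    (s.mem (s.reg 1 + BitVec.ofNat w j)).toNat = ((interSet u T).sort (fun a b => a ≤ b))[j]
  ranks : ∀ (j : ℕ) (hj : j < ((interSet u T).sort (fun a b => a ≤ b)).length) (c : Fin k),
    (s.mem (s.reg 2 + BitVec.ofNat w (j * k + c))).toNat =
      rank (T c) ((interSet u T).sort (fun a b => a ≤ b))[j]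

end TrieIntersection

open TrieIntersection

/-!
The level-wise bit vector of a trie is navigated by rank alone: if nodes are numbered in level
order, the bits of the children of the inner node number `g` stand at positions `2 * g` and
`2 * g + 1`, and the child whose bit, a one, stands at position `p` has the number `rank p + 1`
(`trieBits_child`). The leaves follow the inner nodes, so the number of a leaf determines the rank
of its element (`rank_eq_nodeIndex`).

*Space.* Every node below the root is charged to the string that first leads to it
(`sum_card_nodesAt_le`), so the trie bits take at most `2 * (trie(S) - n + 1)` bits. They are
preceded by a two-level rank directory: with blocks of `β = 2 ^ c = Θ(lg m)` bits and superblocks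
of `β` blocks, for `m` trie bits, it stores the number of ones before each superblock, before each
block relative to its superblock, and the number of ones of each word of `β` bits, in
`O(m * lg lg m / lg m)` bits in total (`auxLen_mul_le`). The parameter `c` is found in constant
time from the header: its lowest one is `β`, and the bits above it hold `c` (`decode_header`). The
table has only `2 ^ β = O(√m)` entries.

*Time.* An intersection query computes, level by level, the nodes that all `k` tries share,
together with their `k` numbers; each of them costs `O(k)` time. If such a node lies at depth `d`,
the part of an optimal certificate that contains the left end of its interval contains no left end
of another shared node of this depth (`card_commonNodes_le_alternation`). So there are at most
`min (2 ^ d) δ` of them, and the sum over all depths is `O(δ * (1 + lg (u / δ)))`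
(`nodeBound_le`).

*Programs.* Expressions are compiled to code for an evaluation stack in the registers from `64` on,
and loop tests go to register `63`. `Runs` is total correctness with a time bound, up to the
contents of these registers; its rules for straight-line code (`Runs.block`) and for loops
(`Runs.whileLoop`) reduce the correctness of the two programs to values of expressions (`Ev`) and
loop invariants.
-/

namespace TrieIntersection

/-! ### Expressions and straight-line code -/

/-- Expressions over registers and memory, to be evaluated by straight-line code. -/
inductive Expr where
  | var (r : ℕ)
  | const (c : ℕ)
  | bin (o : Op) (a b : Expr)
  | load (a : Expr)

namespace Expr

instance : Add Expr := ⟨bin .add⟩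
instance : Sub Expr := ⟨bin .sub⟩
instance : Mul Expr := ⟨bin .mul⟩
instance : Div Expr := ⟨bin .div⟩
instance : Mod Expr := ⟨bin .mod⟩
instance (n : ℕ) : OfNat Expr n := ⟨const n⟩

def eval {w : ℕ} (s : State w) : Expr → BitVec w
  | var r => s.reg r
  | const c => BitVec.ofNat w c
  | bin o a b => o.eval (a.eval s) (b.eval s)
  | load a => s.mem (a.eval s)

/-- Code that leaves the value of the expression in register `d`; the registers from `d` on are
used as an evaluation stack. -/
def compile : Expr → ℕ → Prog
  | var r, d => .op .or d r r
  | const c, d => .const d c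
  | bin o a b, d => .seq (a.compile d) (.seq (b.compile (d + 1)) (.op o d d (d + 1)))
  | load a, d => .seq (a.compile d) (.load d d)

/-- The running time of the compiled code. -/
def cost : Expr → ℕ
  | var _ => 1
  | const _ => 1
  | bin _ a b => a.cost + (b.cost + 1)
  | load a => a.cost + 1

/-- All registers that the expression reads are below `n`. -/
def readsBelow (n : ℕ) : Expr → Bool
  | var r => decide (r < n)
  | const _ => true
  | bin _ a b => a.readsBelow n && b.readsBelow n
  | load a => a.readsBelow n

theorem eval_congr {w : ℕ} {s s' : State w} {n : ℕ} (e : Expr) (he : e.readsBelow n = true)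
    (hr : ∀ r < n, s'.reg r = s.reg r) (hm : s'.mem = s.mem) : e.eval s' = e.eval s := by
  induction e with
  | var r => exact hr r (by simpa [readsBelow] using he)
  | const c => rfl
  | bin o a b iha ihb =>
    simp only [readsBelow, Bool.and_eq_true] at he
    simp only [eval, iha he.1, ihb he.2]
  | load a iha =>
    simp only [readsBelow] at he
    simp only [eval, iha he, hm]

theorem exec_compile {w : ℕ} (n : ℕ) (e : Expr) (he : e.readsBelow n = true) (d : ℕ) (hd : n ≤ d)
    (s : State w) : ∃ s', Exec (e.compile d) s e.cost s' ∧ s'.reg d = e.eval s ∧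
      (∀ r < d, s'.reg r = s.reg r) ∧ s'.mem = s.mem := by
  induction e generalizing d s with
  | var r =>
    refine ⟨_, .op s .or d r r, ?_, ?_, rfl⟩
    · simp [State.setReg, Op.eval, eval]
    · intro r' hr'
      simp [State.setReg, Function.update_of_ne hr'.ne]
  | const c =>
    refine ⟨_, .const s d c, ?_, ?_, rfl⟩
    · simp [State.setReg, eval]
    · intro r' hr'
      simp [State.setReg, Function.update_of_ne hr'.ne]
  | bin o a b iha ihb =>
    simp only [readsBelow, Bool.and_eq_true] at he
    obtain ⟨s₁, h₁, v₁, r₁, m₁⟩ := iha he.1 d hd s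
    obtain ⟨s₂, h₂, v₂, r₂, m₂⟩ := ihb he.2 (d + 1) (by omega) s₁
    refine ⟨_, .seq h₁ (.seq h₂ (.op s₂ o d d (d + 1))), ?_, ?_, ?_⟩
    · have hb : b.eval s₁ = b.eval s := eval_congr b he.2 (fun r hr => r₁ r (by omega)) m₁
      simp [State.setReg, eval, v₂, r₂ d (by omega), v₁, hb]
    · intro r' hr'
      simp [State.setReg, Function.update_of_ne hr'.ne, r₂ r' (by omega), r₁ r' hr']
    · simp [State.setReg, m₂, m₁]
  | load a iha =>
    simp only [readsBelow] at he
    obtain ⟨s₁, h₁, v₁, r₁, m₁⟩ := iha he d hd s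
    refine ⟨_, .seq h₁ (.load s₁ d d), ?_, ?_, ?_⟩
    · simp [State.setReg, eval, v₁, m₁]
    · intro r' hr'
      simp [State.setReg, Function.update_of_ne hr'.ne, r₁ r' hr']
    · simp [State.setReg, m₁]

end Expr

/-- The states agree in the memory and in the registers below `63`; the other registers are
scratch space for loop tests and for the evaluation of expressions. -/
def Sim {w : ℕ} (s s' : State w) : Prop := (∀ r < 63, s'.reg r = s.reg r) ∧ s'.mem = s.mem

theorem Sim.refl {w : ℕ} (s : State w) : Sim s s := ⟨fun _ _ => rfl, rfl⟩

theorem Sim.trans {w : ℕ} {s s' s'' : State w} (h : Sim s s') (h' : Sim s' s'') : Sim s s'' :=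
  ⟨fun r hr => (h'.1 r hr).trans (h.1 r hr), h'.2.trans h.2⟩

/-- Total correctness with a time bound, up to the contents of the scratch registers: from every
state that agrees with `s`, the program halts within `T` steps in a state that agrees with one that
satisfies `Q`. -/
def Runs {w : ℕ} (p : Prog) (s : State w) (T : ℕ) (Q : State w → Prop) : Prop :=
  ∀ s₀, Sim s s₀ → ∃ t s₁, Exec p s₀ t s₁ ∧ t ≤ T ∧ ∃ s₂, Sim s₂ s₁ ∧ Q s₂

section Rules

variable {w : ℕ} {s : State w} {p q : Prog} {T T₁ T₂ : ℕ} {Q R : State w → Prop}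

theorem Runs.mono (h : Runs p s T R) (hT : T ≤ T₁) (hQ : ∀ s', R s' → Q s') : Runs p s T₁ Q := by
  intro s₀ hs
  obtain ⟨t, s₁, he, ht, s₂, h₂, hR⟩ := h s₀ hs
  exact ⟨t, s₁, he, ht.trans hT, s₂, h₂, hQ _ hR⟩

theorem Runs.skip (h : Q s) : Runs .skip s 0 Q := fun s₀ hs => ⟨0, s₀, .skip s₀, le_rfl, s, hs, h⟩

theorem Runs.seq (hp : Runs p s T₁ R) (hq : ∀ s', R s' → Runs q s' T₂ Q) :
    Runs (.seq p q) s (T₁ + T₂) Q := by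
  intro s₀ hs
  obtain ⟨t, s₁, he, ht, s₂, h₂, hR⟩ := hp s₀ hs
  obtain ⟨t', s₁', he', ht', s₂', h₂', hQ⟩ := hq s₂ hR s₁ h₂
  exact ⟨_, s₁', .seq he he', by omega, s₂', h₂', hQ⟩

/-- `R[x] := e`. -/
def assign (x : ℕ) (e : Expr) : Prog := .seq (e.compile 64) (.op .or x 64 64)

theorem Runs.assign {x : ℕ} {e : Expr} (hx : x < 63) (he : e.readsBelow 63 = true)
    (h : Q (s.setReg x (e.eval s))) : Runs (assign x e) s (e.cost + 1) Q := by
  intro s₀ hs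
  obtain ⟨s₁, h₁, v₁, r₁, m₁⟩ := Expr.exec_compile 63 e he 64 (by omega) s₀
  refine ⟨_, _, .seq h₁ (.op s₁ .or x 64 64), le_rfl, _, ⟨?_, ?_⟩, h⟩
  · intro r hr
    rcases eq_or_ne r x with rfl | hrx
    · simp [State.setReg, Op.eval, v₁, Expr.eval_congr e he hs.1 hs.2]
    · simp [State.setReg, hrx, r₁ r (by omega), hs.1 r hr]
  · simp [State.setReg, m₁, hs.2]

/-- `M[a] := b`. -/
def put (a b : Expr) : Prog := .seq (a.compile 64) (.seq (b.compile 65) (.store 64 65))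

theorem Runs.put {a b : Expr} (ha : a.readsBelow 63 = true) (hb : b.readsBelow 63 = true)
    (h : Q (s.setMem (a.eval s) (b.eval s))) : Runs (put a b) s (a.cost + (b.cost + 1)) Q := by
  intro s₀ hs
  obtain ⟨s₁, h₁, v₁, r₁, m₁⟩ := Expr.exec_compile 63 a ha 64 (by omega) s₀
  obtain ⟨s₂, h₂, v₂, r₂, m₂⟩ := Expr.exec_compile 63 b hb 65 (by omega) s₁
  have hb' : b.eval s₁ = b.eval s :=
    (Expr.eval_congr b hb (fun r hr => r₁ r (by omega)) m₁).trans (Expr.eval_congr b hb hs.1 hs.2)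
  refine ⟨_, _, .seq h₁ (.seq h₂ (.store s₂ 64 65)), le_rfl, _, ⟨?_, ?_⟩, h⟩
  · intro r hr
    simp [State.setMem, r₂ r (by omega), r₁ r (by omega), hs.1 r hr]
  · simp [State.setMem, r₂ 64 (by omega), v₁, v₂, hb', m₂, m₁, hs.2,
      Expr.eval_congr a ha hs.1 hs.2]

/-- While `e ≠ 0` do `p`. -/
def whileLoop (e : Expr) (p : Prog) : Prog :=
  .seq (e.compile 63) (.loop 63 (.seq p (e.compile 63)))

/-- A loop with `n` iterations and the invariant `I i` after the `i`-th one. -/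
theorem Runs.whileLoop {e : Expr} (he : e.readsBelow 63 = true) (n : ℕ) (I : ℕ → State w → Prop)
    (T : ℕ → ℕ)
    (hstep : ∀ i < n, ∀ s', I i s' → e.eval s' ≠ 0#w ∧ Runs p s' (T i) (I (i + 1)))
    (hend : ∀ s', I n s' → e.eval s' = 0#w) (h0 : I 0 s) :
    Runs (whileLoop e p) s ((∑ i ∈ Finset.range n, (T i + (e.cost + 1))) + (e.cost + 1)) (I n) := by
  have key : ∀ m i, i + m = n → ∀ s', I i s' → ∀ s₀, Sim s' s₀ → s₀.reg 63 = e.eval s' →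
      ∃ t s₁, Exec (.loop 63 (.seq p (e.compile 63))) s₀ t s₁ ∧
        t ≤ (∑ j ∈ Finset.range m, (T (i + j) + (e.cost + 1))) + 1 ∧
        ∃ s₂, Sim s₂ s₁ ∧ I n s₂ := by
    intro m
    induction m with
    | zero =>
      intro i hi s' hI s₀ hs hv
      obtain rfl : i = n := by omega
      exact ⟨1, s₀, Exec.loop_stop (hv.trans (hend s' hI)), by simp, s', hs, hI⟩
    | succ m ih =>
      intro i hi s' hI s₀ hs hv
      obtain ⟨hne, hr⟩ := hstep i (by omega) s' hI
      obtain ⟨t, s₁, hx, ht, s₂, h₂, hI'⟩ := hr s₀ hs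
      obtain ⟨s₃, h₃, v₃, r₃, m₃⟩ := Expr.exec_compile 63 e he 63 le_rfl s₁
      have hs₃ : Sim s₂ s₃ := h₂.trans ⟨r₃, m₃⟩
      obtain ⟨t', s₄, hx', ht', s₅, h₅, hI''⟩ := ih (i + 1) (by omega) s₂ hI' s₃ hs₃
        (v₃.trans (Expr.eval_congr e he h₂.1 h₂.2))
      refine ⟨_, s₄, .loop_step (hv ▸ hne) (.seq hx h₃) hx', ?_, s₅, h₅, hI''⟩
      rw [Finset.sum_range_succ']
      have : ∀ j, T (i + (j + 1)) = T (i + 1 + j) := fun j => by congr 1; omega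
      simp only [this, Nat.add_zero]
      omega
  intro s₀ hs
  obtain ⟨s₁, h₁, v₁, r₁, m₁⟩ := Expr.exec_compile 63 e he 63 le_rfl s₀
  obtain ⟨t, s₂, hx, ht, hs₂⟩ := key n 0 (by omega) s h0 s₁ (hs.trans ⟨r₁, m₁⟩)
    (v₁.trans (Expr.eval_congr e he hs.1 hs.2))
  refine ⟨_, s₂, .seq h₁ hx, ?_, hs₂⟩
  simp only [Nat.zero_add] at ht
  omega

end Rules

/-- Simple statements: assignments to registers and to memory cells. -/
inductive Stmt where
  | set (x : ℕ) (e : Expr)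
  | put (a b : Expr)

namespace Stmt

def prog : Stmt → Prog
  | set x e => assign x e
  | put a b => TrieIntersection.put a b

def cost : Stmt → ℕ
  | set _ e => e.cost + 1
  | put a b => a.cost + (b.cost + 1)

/-- The statement does not mention scratch registers. -/
def ok : Stmt → Bool
  | set x e => decide (x < 63) && e.readsBelow 63
  | put a b => a.readsBelow 63 && b.readsBelow 63

def run {w : ℕ} (s : State w) : Stmt → State w
  | set x e => s.setReg x (e.eval s)
  | put a b => s.setMem (a.eval s) (b.eval s)

end Stmt

/-- Straight-line code. -/
def block : List Stmt → Prog
  | [] => .skip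
  | c :: l => .seq c.prog (block l)

/-- The running time of straight-line code. -/
def blockCost : List Stmt → ℕ
  | [] => 0
  | c :: l => c.cost + blockCost l

/-- `Q` holds after the execution of the statements in the state `s`. -/
def After {w : ℕ} : List Stmt → State w → (State w → Prop) → Prop
  | [], s, Q => Q s
  | c :: l, s, Q => After l (c.run s) Q

theorem Runs.block {w : ℕ} {l : List Stmt} {s : State w} {Q : State w → Prop}
    (hok : l.all Stmt.ok = true) (h : After l s Q) : Runs (block l) s (blockCost l) Q := by
  induction l generalizing s with
  | nil => exact Runs.skip h
  | cons c l ih =>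
    simp only [List.all_cons, Bool.and_eq_true] at hok
    refine Runs.seq (R := fun s' => s' = c.run s) ?_ ?_
    · cases c with
      | set x e =>
        have h1 : x < 63 ∧ e.readsBelow 63 = true := by simpa [Stmt.ok] using hok.1
        exact Runs.assign h1.1 h1.2 rfl
      | put a b =>
        have h1 : a.readsBelow 63 = true ∧ b.readsBelow 63 = true := by simpa [Stmt.ok] using hok.1
        exact Runs.put h1.1 h1.2 rfl
    · rintro s' rfl
      exact ih hok.2 h

/-! ### Values of expressions -/

/-- The expression `e` has the value `v` (modulo `2 ^ w`) in the state `s`. -/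
def Ev {w : ℕ} (s : State w) (e : Expr) (v : ℕ) : Prop := e.eval s = BitVec.ofNat w v

section Ev

variable {w : ℕ} {s : State w} {a b : Expr} {x y : ℕ}

theorem Ev.var {r : ℕ} (h : s.reg r = BitVec.ofNat w x) : Ev s (.var r) x := h

theorem Ev.const (c : ℕ) : Ev s (.const c) c := rfl

theorem Ev.cast (ha : Ev s a x) (h : x = y) : Ev s a y := h ▸ ha

theorem Ev.add (ha : Ev s a x) (hb : Ev s b y) : Ev s (a + b) (x + y) := by
  change a.eval s + b.eval s = _
  rw [ha, hb, BitVec.ofNat_add]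

theorem Ev.mul (ha : Ev s a x) (hb : Ev s b y) : Ev s (a * b) (x * y) := by
  change a.eval s * b.eval s = _
  rw [ha, hb, BitVec.ofNat_mul]

theorem Ev.sub (ha : Ev s a x) (hb : Ev s b y) (h : y ≤ x) : Ev s (a - b) (x - y) := by
  change a.eval s - b.eval s = _
  rw [ha, hb, sub_eq_iff_eq_add, ← BitVec.ofNat_add, Nat.sub_add_cancel h]

theorem Ev.div (ha : Ev s a x) (hb : Ev s b y) (hx : x < 2 ^ w) (hy : y < 2 ^ w) :
    Ev s (a / b) (x / y) := by
  change a.eval s / b.eval s = _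
  rw [ha, hb]
  apply BitVec.eq_of_toNat_eq
  rw [BitVec.toNat_udiv]
  simp only [BitVec.toNat_ofNat, Nat.mod_eq_of_lt hx, Nat.mod_eq_of_lt hy,
    Nat.mod_eq_of_lt ((Nat.div_le_self x y).trans_lt hx)]

theorem Ev.mod (ha : Ev s a x) (hb : Ev s b y) (hx : x < 2 ^ w) (hy : y < 2 ^ w) :
    Ev s (a % b) (x % y) := by
  change a.eval s % b.eval s = _
  rw [ha, hb]
  apply BitVec.eq_of_toNat_eq
  rw [BitVec.toNat_umod]
  simp only [BitVec.toNat_ofNat, Nat.mod_eq_of_lt hx, Nat.mod_eq_of_lt hy,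
    Nat.mod_eq_of_lt ((Nat.mod_le x y).trans_lt hx)]

theorem Ev.shl (ha : Ev s a x) (hb : Ev s b y) (hy : y < 2 ^ w) :
    Ev s (.bin .shl a b) (x * 2 ^ y) := by
  change a.eval s <<< (b.eval s).toNat = _
  rw [ha, hb]
  apply BitVec.eq_of_toNat_eq
  simp [BitVec.toNat_shiftLeft, Nat.mod_eq_of_lt hy, Nat.shiftLeft_eq]

theorem Ev.and (ha : Ev s a x) (hb : Ev s b y) : Ev s (.bin .and a b) (x &&& y) := by
  change a.eval s &&& b.eval s = _
  rw [ha, hb]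
  apply BitVec.eq_of_toNat_eq
  simp [BitVec.toNat_and]

theorem Ev.lt (ha : Ev s a x) (hb : Ev s b y) (hx : x < 2 ^ w) (hy : y < 2 ^ w) :
    Ev s (.bin .lt a b) (if x < y then 1 else 0) := by
  change (if (a.eval s).toNat < (b.eval s).toNat then _ else _) = _
  rw [ha, hb]
  simp only [BitVec.toNat_ofNat, Nat.mod_eq_of_lt hx, Nat.mod_eq_of_lt hy]
  split_ifs <;> rfl

theorem Ev.load (ha : Ev s a x) (h : s.cell x = BitVec.ofNat w y) : Ev s (.load a) y := by
  change s.mem (a.eval s) = _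
  rw [ha]; exact h

theorem Ev.eval_ne_zero (ha : Ev s a x) (h0 : x ≠ 0) (hx : x < 2 ^ w) : a.eval s ≠ 0#w := by
  rw [ha]
  intro h
  have := congrArg BitVec.toNat h
  simp [Nat.mod_eq_of_lt hx] at this
  exact h0 this

theorem Ev.lt_ne_zero (ha : Ev s a x) (hb : Ev s b y) (hy : y < 2 ^ w) (h : x < y) :
    (Expr.bin .lt a b).eval s ≠ 0#w := by
  have h1 := Ev.lt ha hb (h.trans hy) hy
  rw [if_pos h] at h1
  exact h1.eval_ne_zero one_ne_zero (by omega)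

theorem Ev.lt_eq_zero (ha : Ev s a x) (hb : Ev s b y) (hx : x < 2 ^ w) (h : y ≤ x) :
    (Expr.bin .lt a b).eval s = 0#w := by
  have h1 := Ev.lt ha hb hx (h.trans_lt hx)
  rwa [if_neg h.not_gt] at h1

end Ev

section After

variable {w : ℕ} {s : State w} {l : List Stmt} {Q : State w → Prop}

theorem After.set {x v : ℕ} {e : Expr} (hv : Ev s e v)
    (h : After l (s.setReg x (BitVec.ofNat w v)) Q) : After (.set x e :: l) s Q := by
  change After l (s.setReg x (e.eval s)) Q
  rwa [hv]

theorem After.put {a b : Expr} {x v : ℕ} (ha : Ev s a x) (hb : Ev s b v)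
    (h : After l (s.setMem (BitVec.ofNat w x) (BitVec.ofNat w v)) Q) :
    After (.put a b :: l) s Q := by
  change After l (s.setMem (a.eval s) (b.eval s)) Q
  rwa [ha, hb]

theorem After.nil (h : Q s) : After [] s Q := h

theorem After.append {l' : List Stmt} (h : After l s fun s' => After l' s' Q) :
    After (l ++ l') s Q := by
  induction l generalizing s with
  | nil => exact h
  | cons c l ih => exact ih h

theorem After.mono {R : State w → Prop} (h : After l s R) (hQ : ∀ s', R s' → Q s') :
    After l s Q := by
  induction l generalizing s with
  | nil => exact hQ _ h
  | cons c l ih => exact ih h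

theorem cell_setReg (x : ℕ) (v : BitVec w) (a : ℕ) : (s.setReg x v).cell a = s.cell a := rfl

theorem cell_setMem {a b : ℕ} (ha : a < 2 ^ w) (hb : b < 2 ^ w) (v : BitVec w) :
    (s.setMem (BitVec.ofNat w a) v).cell b = if b = a then v else s.cell b := by
  have : BitVec.ofNat w b = BitVec.ofNat w a ↔ b = a := by
    constructor
    · intro h
      have := congrArg BitVec.toNat h
      simpa [Nat.mod_eq_of_lt ha, Nat.mod_eq_of_lt hb] using this
    · rintro rfl; rfl
  simp [State.cell, State.setMem, Function.update_apply, this]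

end After

/-! ### The auxiliary bits -/

/-- The number of `1`s among the first `p` bits. -/
def onesBefore (B : List Bool) (p : ℕ) : ℕ := (B.take p).count true

/-- The number of `1`s among the `n` lowest bits of `v`. -/
def popCount (n v : ℕ) : ℕ := ∑ t ∈ Finset.range n, (v.testBit t).toNat

/-- The binary logarithm of the block size, for a bit vector of length `m`. -/
def blockLog (m : ℕ) : ℕ := Nat.log 2 (Nat.log 2 (m + 4) / 2)

/-- The block size, a power of two of order `lg m`. A superblock consists of `blockSize m` blocks. -/
def blockSize (m : ℕ) : ℕ := 2 ^ blockLog m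

/-- The header: `c = blockLog m` zeros, a one, and `c` with `c` bits (lowest bit first). Its lowest
`1` is `blockSize m`, so both parameters can be decoded in constant time. -/
def header (m : ℕ) : ℕ := 2 ^ blockLog m + 2 ^ (blockLog m + 1) * blockLog m

/-- Position of the field with the length of the bit vector. -/
def posCount (m : ℕ) : ℕ := 2 * blockLog m + 1

/-- Position of the table with the number of ones of every word of `blockSize m` bits. -/
def posTable (m : ℕ) : ℕ := posCount m + 4 * blockSize m

/-- Position of the array with the number of ones before each superblock. -/
def posSuper (m : ℕ) : ℕ := posTable m + blockSize m * 2 ^ blockSize m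

/-- Position of the array with the number of ones before each block, within its superblock. -/
def posBlock (m : ℕ) : ℕ :=
  posSuper m + (m / blockSize m / blockSize m + 1) * (4 * blockSize m)

/-- The number of auxiliary bits. -/
def auxLen (m : ℕ) : ℕ := posBlock m + (m / blockSize m + 1) * (2 * blockLog m)

/-- The number of ones between the start of the superblock of the `j`-th block and the start of
this block. -/
def blockRank (B : List Bool) (j : ℕ) : ℕ :=
  onesBefore B (j * blockSize B.length) -
    onesBefore B (j / blockSize B.length * blockSize B.length * blockSize B.length)

/-- The `t`-th auxiliary bit of the bit vector `B`; the flag is stored as the parity of the length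
field (the lengths are even). -/
def auxBit (B : List Bool) (flag : Bool) (t : ℕ) : Bool :=
  let m := B.length
  let β := blockSize m
  if t < posCount m then (header m).testBit t
  else if t < posTable m then (m + flag.toNat).testBit (t - posCount m)
  else if t < posSuper m then
    (popCount β ((t - posTable m) / β)).testBit ((t - posTable m) % β)
  else if t < posBlock m then
    (onesBefore B ((t - posSuper m) / (4 * β) * β * β)).testBit ((t - posSuper m) % (4 * β))
  else (blockRank B ((t - posBlock m) / (2 * blockLog m))).testBit
    ((t - posBlock m) % (2 * blockLog m))

/-- The auxiliary bits: a rank directory for `B`, preceded by its parameters. -/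
def auxBits (B : List Bool) (flag : Bool) : List Bool :=
  (List.range (auxLen B.length)).map (auxBit B flag)

/-- The number `y` is stored with `n` bits, lowest bit first, from position `a` on. -/
def HasField (l : List Bool) (a n y : ℕ) : Prop :=
  y < 2 ^ n ∧ ∀ t < n, l[a + t]? = some (y.testBit t)

theorem onesBefore_succ (B : List Bool) (p : ℕ) :
    onesBefore B (p + 1) = onesBefore B p + (B[p]?.getD false).toNat := by
  rcases lt_or_ge p B.length with h | h
  · simp only [onesBefore, List.take_add_one, List.count_append]
    rw [List.getElem?_eq_getElem h]
    cases B[p] <;> simp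
  · simp [onesBefore, List.take_of_length_le h, List.take_of_length_le (h.trans (Nat.le_succ p)),
      List.getElem?_eq_none h]

theorem onesBefore_mono (B : List Bool) : Monotone (onesBefore B) :=
  monotone_nat_of_le_succ fun p => by rw [onesBefore_succ]; omega

theorem onesBefore_add (B : List Bool) (p n : ℕ) :
    onesBefore B (p + n) =
      onesBefore B p + ∑ t ∈ Finset.range n, (B[p + t]?.getD false).toNat := by
  induction n with
  | zero => simp
  | succ n ih => rw [← Nat.add_assoc, onesBefore_succ, ih, Finset.sum_range_succ]; omega

theorem onesBefore_add_le (B : List Bool) (p n : ℕ) :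
    onesBefore B (p + n) ≤ onesBefore B p + n := by
  rw [onesBefore_add]
  have : ∑ t ∈ Finset.range n, (B[p + t]?.getD false).toNat ≤ ∑ t ∈ Finset.range n, 1 :=
    Finset.sum_le_sum fun t _ => Bool.toNat_le _
  simp at this
  omega

theorem onesBefore_le (B : List Bool) (p : ℕ) : onesBefore B p ≤ B.length := by
  have := (List.take p B).count_le_length (a := true)
  have := List.length_take_le p B
  unfold onesBefore
  have := List.length_take_le' p B
  omega

theorem popCount_le (n v : ℕ) : popCount n v ≤ n := by
  have : popCount n v ≤ ∑ t ∈ Finset.range n, 1 :=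
    Finset.sum_le_sum fun t _ => Bool.toNat_le _
  simpa using this

theorem popCount_eq_of_lt {n r v : ℕ} (hr : r ≤ n) (hv : v < 2 ^ r) :
    popCount n v = popCount r v := by
  refine (Finset.sum_subset (by simpa using hr) fun t _ ht => ?_).symm
  simp only [Finset.mem_range, not_lt] at ht
  rw [Nat.testBit_lt_two_pow (hv.trans_le (Nat.pow_le_pow_right (by norm_num) ht))]
  rfl

theorem blockSize_pos (m : ℕ) : 0 < blockSize m := by simp [blockSize]

theorem blockLog_lt (m : ℕ) : blockLog m < blockSize m := Nat.lt_two_pow_self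

theorem two_le_log (m : ℕ) : 2 ≤ Nat.log 2 (m + 4) :=
  Nat.le_log_of_pow_le (by norm_num) (by omega)

theorem two_mul_blockSize_le (m : ℕ) : 2 * blockSize m ≤ Nat.log 2 (m + 4) := by
  have h := two_le_log m
  have : blockSize m ≤ Nat.log 2 (m + 4) / 2 := Nat.pow_log_le_self 2 (by omega)
  omega

/-- The table has at most about `√m` entries. -/
theorem two_pow_blockSize_le (m : ℕ) : 2 ^ (2 * blockSize m) ≤ m + 4 :=
  (Nat.pow_le_pow_right (by norm_num) (two_mul_blockSize_le m)).trans
    (Nat.pow_log_le_self 2 (by omega))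

/-- Numbers up to the length of the bit vector fit into `4 * blockSize m` bits. -/
theorem lt_two_pow_blockSize (m : ℕ) : m + 4 < 2 ^ (4 * blockSize m) := by
  have h := two_le_log m
  have h1 : Nat.log 2 (m + 4) / 2 < 2 ^ (blockLog m + 1) :=
    Nat.lt_pow_succ_log_self (by norm_num) _
  have h2 : 2 ^ (blockLog m + 1) = 2 * blockSize m := by rw [pow_succ, blockSize]; ring
  have h3 : m + 4 < 2 ^ (Nat.log 2 (m + 4) + 1) := Nat.lt_pow_succ_log_self (by norm_num) _
  exact h3.trans_le (Nat.pow_le_pow_right (by norm_num) (by omega))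

theorem header_lt (m : ℕ) : header m < 2 ^ (2 * blockLog m + 1) := by
  have h : blockLog m + 1 ≤ 2 ^ blockLog m := blockLog_lt m
  have h1 : 2 ^ (2 * blockLog m + 1) = 2 ^ (blockLog m + 1) * 2 ^ blockLog m := by
    rw [← pow_add]; congr 1; omega
  have h2 : 2 ^ (blockLog m + 1) * (blockLog m + 1) ≤ 2 ^ (blockLog m + 1) * 2 ^ blockLog m :=
    Nat.mul_le_mul_left _ h
  have h3 : 2 ^ blockLog m < 2 ^ (blockLog m + 1) := Nat.pow_lt_pow_right (by norm_num) (by omega)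
  rw [h1, header]
  linarith

@[simp] theorem length_auxBits (B : List Bool) (flag : Bool) :
    (auxBits B flag).length = auxLen B.length := by simp [auxBits]

theorem getElem?_aux {B : List Bool} {flag : Bool} {t : ℕ} (ht : t < auxLen B.length) :
    (auxBits B flag ++ B)[t]? = some (auxBit B flag t) := by
  rw [List.getElem?_append_left (by simpa using ht)]
  simp [auxBits, ht]

section Fields

variable (B : List Bool) (flag : Bool)

theorem hasField_header :
    HasField (auxBits B flag ++ B) 0 (2 * blockLog B.length + 1) (header B.length) := by
  refine ⟨header_lt _, fun t ht => ?_⟩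
  have h : t < posCount B.length := ht
  rw [Nat.zero_add, getElem?_aux, auxBit, if_pos h]
  unfold auxLen posBlock posSuper posTable; omega

theorem hasField_count :
    HasField (auxBits B flag ++ B) (posCount B.length) (4 * blockSize B.length)
      (B.length + flag.toNat) := by
  have hf : flag.toNat ≤ 1 := Bool.toNat_le _
  refine ⟨lt_of_le_of_lt (by omega) (lt_two_pow_blockSize _), fun t ht => ?_⟩
  rw [getElem?_aux, auxBit]
  · have h1 : ¬ posCount B.length + t < posCount B.length := by omega
    have h2 : posCount B.length + t < posTable B.length := by unfold posTable; omega
    simp only [h1, h2, if_true, if_false, Nat.add_sub_cancel_left]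
  · unfold auxLen posBlock posSuper posTable; omega

theorem array_index {j n c t : ℕ} (hj : j < c) (ht : t < n) :
    j * n + t < c * n ∧ (j * n + t) / n = j ∧ (j * n + t) % n = t := by
  refine ⟨?_, ?_, ?_⟩
  · have : (j + 1) * n ≤ c * n := Nat.mul_le_mul_right _ hj
    linarith
  · rw [mul_comm, Nat.mul_add_div (by omega), Nat.div_eq_of_lt ht, add_zero]
  · rw [mul_comm, Nat.mul_add_mod, Nat.mod_eq_of_lt ht]

theorem hasField_table {v : ℕ} (hv : v < 2 ^ blockSize B.length) :
    HasField (auxBits B flag ++ B) (posTable B.length + v * blockSize B.length)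
      (blockSize B.length) (popCount (blockSize B.length) v) := by
  refine ⟨(popCount_le _ _).trans_lt Nat.lt_two_pow_self, fun t ht => ?_⟩
  obtain ⟨h0, h3, h4⟩ := array_index hv ht
  rw [mul_comm (2 ^ _)] at h0
  rw [add_assoc, getElem?_aux, auxBit]
  · have h1 : ¬ posTable B.length + (v * blockSize B.length + t) < posCount B.length := by
      unfold posTable; omega
    have h2 : ¬ posTable B.length + (v * blockSize B.length + t) < posTable B.length := by omega
    have h5 : posTable B.length + (v * blockSize B.length + t) < posSuper B.length := by
      unfold posSuper; omega
    simp only [h1, h2, h5, if_true, if_false, Nat.add_sub_cancel_left, h3, h4]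
  · unfold auxLen posBlock posSuper; omega

theorem hasField_super {j : ℕ} (hj : j ≤ B.length / blockSize B.length / blockSize B.length) :
    HasField (auxBits B flag ++ B) (posSuper B.length + j * (4 * blockSize B.length))
      (4 * blockSize B.length)
      (onesBefore B (j * blockSize B.length * blockSize B.length)) := by
  have hm := lt_two_pow_blockSize B.length
  have hb := onesBefore_le B (j * blockSize B.length * blockSize B.length)
  refine ⟨by omega, fun t ht => ?_⟩
  obtain ⟨h0, h3, h4⟩ := array_index (Nat.lt_add_one_of_le hj) ht
  rw [add_assoc, getElem?_aux, auxBit]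
  · have h1 : ¬ posSuper B.length + (j * (4 * blockSize B.length) + t) < posCount B.length := by
      unfold posSuper posTable; omega
    have h2 : ¬ posSuper B.length + (j * (4 * blockSize B.length) + t) < posTable B.length := by
      unfold posSuper; omega
    have h5 : ¬ posSuper B.length + (j * (4 * blockSize B.length) + t) < posSuper B.length := by
      omega
    have h6 : posSuper B.length + (j * (4 * blockSize B.length) + t) < posBlock B.length := by
      unfold posBlock; omega
    simp only [h1, h2, h5, h6, if_true, if_false, Nat.add_sub_cancel_left, h3, h4]
  · unfold auxLen posBlock; omega

theorem blockRank_lt (j : ℕ) : blockRank B j < 2 ^ (2 * blockLog B.length) := by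
  have hβ := blockSize_pos B.length
  have h1 : 2 ^ (2 * blockLog B.length) = blockSize B.length * blockSize B.length := by
    rw [blockSize, ← pow_add]; congr 1; omega
  rw [h1]
  unfold blockRank
  generalize blockSize B.length = β at *
  obtain ⟨r, hr, hjr⟩ : ∃ r < β, j = j / β * β + r :=
    ⟨j % β, Nat.mod_lt _ hβ, (Nat.div_add_mod' j β).symm⟩
  have h2 : j * β = j / β * β * β + r * β := by
    conv_lhs => rw [hjr]
    ring
  have h3 := onesBefore_add_le B (j / β * β * β) (r * β)
  rw [h2]
  have : r * β < β * β := Nat.mul_lt_mul_of_pos_right hr hβ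
  omega

theorem hasField_block {j : ℕ} (hj : j ≤ B.length / blockSize B.length) :
    HasField (auxBits B flag ++ B) (posBlock B.length + j * (2 * blockLog B.length))
      (2 * blockLog B.length) (blockRank B j) := by
  refine ⟨blockRank_lt B j, fun t ht => ?_⟩
  obtain ⟨h0, h3, h4⟩ := array_index (Nat.lt_add_one_of_le hj) ht
  rw [add_assoc, getElem?_aux, auxBit]
  · have h1 : ¬ posBlock B.length + (j * (2 * blockLog B.length) + t) < posCount B.length := by
      unfold posBlock posSuper posTable; omega
    have h2 : ¬ posBlock B.length + (j * (2 * blockLog B.length) + t) < posTable B.length := by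
      unfold posBlock posSuper; omega
    have h5 : ¬ posBlock B.length + (j * (2 * blockLog B.length) + t) < posSuper B.length := by
      unfold posBlock; omega
    have h6 : ¬ posBlock B.length + (j * (2 * blockLog B.length) + t) < posBlock B.length := by
      omega
    simp only [h1, h2, h5, h6, if_false, Nat.add_sub_cancel_left, h3, h4]
  · unfold auxLen; omega

theorem hasField_bit {p : ℕ} (hp : p < B.length) :
    HasField (auxBits B flag ++ B) (auxLen B.length + p) 1 B[p].toNat := by
  refine ⟨by have := Bool.toNat_le B[p]; omega, fun t ht => ?_⟩
  obtain rfl : t = 0 := by omega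
  rw [List.getElem?_append_right (by simp), length_auxBits, Nat.add_zero, Nat.add_sub_cancel_left,
    List.getElem?_eq_getElem hp]
  cases B[p] <;> rfl

/-- The bits from position `a` to position `a + r` are the binary code of a number that has as many
`1`s as these bits. -/
theorem exists_hasField_bits {a r : ℕ} (h : a + r ≤ B.length) :
    ∃ v, HasField (auxBits B flag ++ B) (auxLen B.length + a) r v ∧
      onesBefore B a + popCount r v = onesBefore B (a + r) := by
  have hb : ∀ t < r, (Nat.ofBits fun t : Fin r => B[a + t]).testBit t
      = B[a + t]?.getD false := by
    intro t ht
    rw [Nat.testBit_ofBits_lt _ _ ht, List.getElem?_eq_getElem (by omega)]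
    rfl
  refine ⟨Nat.ofBits fun t : Fin r => B[a + t], ⟨Nat.ofBits_lt_two_pow _, fun t ht => ?_⟩, ?_⟩
  · rw [hb t ht, List.getElem?_append_right (by simp; omega), length_auxBits, add_assoc,
      Nat.add_sub_cancel_left, List.getElem?_eq_getElem (by omega)]
    rfl
  · rw [onesBefore_add, popCount]
    congr 1
    exact Finset.sum_congr rfl fun t ht => by rw [hb t (Finset.mem_range.1 ht)]

end Fields

/-! ### The number of auxiliary bits -/

theorem sq_le_two_pow (n : ℕ) : n * n ≤ 2 * 2 ^ n := by
  induction n with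
  | zero => simp
  | succ n ih =>
    rcases lt_or_ge n 3 with h | h
    · interval_cases n <;> norm_num
    · rw [pow_succ]; nlinarith

/-- The space of the rank directory is of order `m * lg lg m / lg m`. -/
theorem auxLen_mul_le (m : ℕ) :
    auxLen m * blockSize m ≤ 40 * (blockLog m + 1) * (m + 4) := by
  have hc := blockLog_lt m
  have hT := two_pow_blockSize_le m
  have hsq := sq_le_two_pow (blockSize m)
  have hpos := blockSize_pos m
  unfold auxLen posBlock posSuper posTable posCount
  generalize blockSize m = β at *
  generalize blockLog m = c at *
  rw [two_mul, pow_add] at hT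
  have h1 : 1 ≤ 2 ^ β := Nat.one_le_two_pow
  generalize 2 ^ β = P at *
  have hP : P ≤ m + 4 := by nlinarith
  have hββ : β * β ≤ 2 * (m + 4) := by omega
  have hsup : m / β / β * (β * β) ≤ m := by
    rw [Nat.div_div_eq_div_mul]; exact Nat.div_mul_le_self _ _
  have hblk : m / β * β ≤ m := Nat.div_mul_le_self _ _
  have e1 : β * P * β ≤ 2 * (m + 4) := by nlinarith
  have e2 : (m / β / β + 1) * (4 * β) * β = 4 * (m / β / β * (β * β)) + 4 * (β * β) := by ring
  have e3 : (m / β + 1) * (2 * c) * β = 2 * c * (m / β * β) + 2 * c * β := by ring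
  have e4 : 2 * c * (m / β * β) ≤ 2 * c * m := Nat.mul_le_mul_left _ hblk
  have e5 : c * β ≤ β * β := Nat.mul_le_mul_right _ hc.le
  have e6 : β ≤ β * β := Nat.le_mul_self β
  have e7 : (2 * c + 1 + 4 * β + β * P + (m / β / β + 1) * (4 * β) + (m / β + 1) * (2 * c)) * β =
      2 * (c * β) + β + 4 * (β * β) + β * P * β + (m / β / β + 1) * (4 * β) * β +
        (m / β + 1) * (2 * c) * β := by ring
  rw [e7, e2, e3]
  nlinarith [Nat.zero_le (c * m)]

theorem auxLen_le (m : ℕ) : auxLen m ≤ 40 * (m + 4) := by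
  have h := auxLen_mul_le m
  have hc : blockLog m + 1 ≤ blockSize m := blockLog_lt m
  have hpos := blockSize_pos m
  refine Nat.le_of_mul_le_mul_right (h.trans ?_) hpos
  calc 40 * (blockLog m + 1) * (m + 4) = 40 * (m + 4) * (blockLog m + 1) := by ring
    _ ≤ _ := Nat.mul_le_mul_left _ hc

theorem exists_auxLen_le (ε : ℝ) (hε : 0 < ε) :
    ∃ K : ℝ, ∀ m : ℕ, (auxLen m : ℝ) ≤ ε * m + K := by
  have h1 : Filter.Tendsto (fun c : ℕ => 40 * ((c : ℝ) ^ 1 / 2 ^ c) + 40 * ((c : ℝ) ^ 0 / 2 ^ c))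
      Filter.atTop (nhds (40 * 0 + 40 * 0)) :=
    ((tendsto_pow_const_div_const_pow_of_one_lt 1 (by norm_num)).const_mul 40).add
      ((tendsto_pow_const_div_const_pow_of_one_lt 0 (by norm_num)).const_mul 40)
  have h2 := h1.eventually (gt_mem_nhds (show (40 * 0 + 40 * 0 : ℝ) < ε by simpa using hε))
  obtain ⟨c₀, hc₀⟩ := Filter.eventually_atTop.1 h2
  refine ⟨4 * ε + 40 * (2 : ℝ) ^ (4 * 2 ^ c₀), fun m => ?_⟩
  rcases le_or_gt c₀ (blockLog m) with h | h
  · have h3 := hc₀ _ h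
    have h4 : ((auxLen m * blockSize m : ℕ) : ℝ) ≤ (40 * (blockLog m + 1) * (m + 4) : ℕ) := by
      exact_mod_cast auxLen_mul_le m
    have hpos : (0 : ℝ) < blockSize m := by exact_mod_cast blockSize_pos m
    have hb : (blockSize m : ℝ) = 2 ^ blockLog m := by simp [blockSize]
    push_cast at h4
    have h5 : 40 * ((blockLog m : ℝ) ^ 1 / 2 ^ blockLog m)
        + 40 * ((blockLog m : ℝ) ^ 0 / 2 ^ blockLog m)
        = 40 * (blockLog m + 1) / blockSize m := by rw [hb]; field_simp
    rw [h5, div_lt_iff₀ hpos] at h3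
    have h6 : (auxLen m : ℝ) * blockSize m ≤ (ε * (m + 4)) * blockSize m := by
      calc _ ≤ _ := h4
        _ ≤ (ε * blockSize m) * (m + 4) := by gcongr
        _ = _ := by ring
    have h7 := le_of_mul_le_mul_right h6 hpos
    have : (0 : ℝ) < 40 * (2 : ℝ) ^ (4 * 2 ^ c₀) := by positivity
    linarith
  · have h3 : m + 4 ≤ 2 ^ (4 * 2 ^ c₀) := (lt_two_pow_blockSize m).le.trans
      (Nat.pow_le_pow_right (by norm_num) (Nat.mul_le_mul_left _
        (Nat.pow_le_pow_right (by norm_num) h.le)))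
    have h4 : ((auxLen m : ℕ) : ℝ) ≤ 40 * ((2 ^ (4 * 2 ^ c₀) : ℕ) : ℝ) := by
      exact_mod_cast (auxLen_le m).trans (Nat.mul_le_mul_left _ h3)
    push_cast at h4
    have : 0 ≤ ε * m := by positivity
    linarith

/-- A bound for the number of auxiliary bits of a trie with `t` edges. -/
noncomputable def redundancy (t : ℕ) : ℝ := ((Finset.range (2 * t + 3)).sup auxLen : ℕ)

theorem auxLen_le_redundancy {m t : ℕ} (h : m ≤ 2 * t + 2) : (auxLen m : ℝ) ≤ redundancy t := by
  unfold redundancy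
  exact_mod_cast Finset.le_sup (f := auxLen) (Finset.mem_range.2 (by omega))

theorem redundancy_isLittleO : redundancy =o[Filter.atTop] (fun t : ℕ => (t : ℝ)) := by
  rw [Asymptotics.isLittleO_iff]
  intro ε hε
  obtain ⟨K, hK⟩ := exists_auxLen_le (ε / 4) (by positivity)
  obtain ⟨n, hn⟩ := exists_nat_ge ((ε / 4 * 2 + K) * 2 / ε)
  filter_upwards [Filter.eventually_ge_atTop n] with t ht
  obtain ⟨m, hm, hsup⟩ := Finset.exists_mem_eq_sup (Finset.range (2 * t + 3)) (by simp) auxLen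
  have hm' : (m : ℝ) ≤ 2 * t + 2 := by
    have := Finset.mem_range.1 hm
    exact_mod_cast (by omega : m ≤ 2 * t + 2)
  have h1 := hK m
  have h2 : (ε / 4 * 2 + K) * 2 / ε ≤ t := hn.trans (by exact_mod_cast ht)
  rw [div_le_iff₀ hε] at h2
  rw [redundancy, hsup, Real.norm_natCast, Real.norm_natCast]
  have h3 : ε / 4 * m ≤ ε / 4 * (2 * t + 2) := by gcongr
  linarith

/-! ### The number of nodes of the trie -/

theorem nodesAt_zero {ℓ : ℕ} {S : Finset ℕ} (hS : S ⊆ Finset.range (2 ^ ℓ)) (hne : S.Nonempty) :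
    nodesAt ℓ S 0 = {0} := by
  ext v
  simp only [nodesAt, Finset.mem_image, Finset.mem_singleton, Nat.sub_zero]
  constructor
  · rintro ⟨x, hx, rfl⟩
    exact Nat.div_eq_of_lt (Finset.mem_range.1 (hS hx))
  · rintro rfl
    obtain ⟨x, hx⟩ := hne
    exact ⟨x, hx, Nat.div_eq_of_lt (Finset.mem_range.1 (hS hx))⟩

theorem nodesAt_last (ℓ : ℕ) (S : Finset ℕ) : nodesAt ℓ S ℓ = S := by
  simp [nodesAt]

theorem parent_mem_nodesAt {ℓ d c : ℕ} {S : Finset ℕ} (hd : d < ℓ) (hc : c ∈ nodesAt ℓ S (d + 1)) :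
    c / 2 ∈ nodesAt ℓ S d := by
  simp only [nodesAt, Finset.mem_image] at hc ⊢
  obtain ⟨x, hx, rfl⟩ := hc
  refine ⟨x, hx, ?_⟩
  rw [Nat.div_div_eq_div_mul, ← pow_succ]
  congr 2; omega

theorem lt_two_pow_of_mem_nodesAt {ℓ d v : ℕ} {S : Finset ℕ} (hd : d ≤ ℓ)
    (hS : S ⊆ Finset.range (2 ^ ℓ)) (hv : v ∈ nodesAt ℓ S d) : v < 2 ^ d := by
  simp only [nodesAt, Finset.mem_image] at hv
  obtain ⟨x, hx, rfl⟩ := hv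
  rw [Nat.div_lt_iff_lt_mul (by positivity), ← pow_add, Nat.add_sub_cancel' hd]
  exact Finset.mem_range.1 (hS hx)

theorem card_nodesAt_le (ℓ d : ℕ) (S : Finset ℕ) : (nodesAt ℓ S d).card ≤ S.card :=
  Finset.card_image_le

theorem card_nodesAt_le_two_pow {ℓ d : ℕ} {S : Finset ℕ} (hd : d ≤ ℓ)
    (hS : S ⊆ Finset.range (2 ^ ℓ)) : (nodesAt ℓ S d).card ≤ 2 ^ d := by
  have : nodesAt ℓ S d ⊆ Finset.range (2 ^ d) := fun v hv =>
    Finset.mem_range.2 (lt_two_pow_of_mem_nodesAt hd hS hv)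
  simpa using Finset.card_le_card this

theorem le_two_pow_codeLength (u : ℕ) : u ≤ 2 ^ codeLength u := Nat.le_pow_clog (by norm_num) u

theorem two_pow_codeLength_lt {u : ℕ} (hu : 1 ≤ u) : 2 ^ codeLength u < 2 * u := by
  rcases hu.eq_or_lt with rfl | h
  · simp [codeLength]
  · have h1 : 2 ^ (codeLength u - 1) < u := Nat.pow_pred_clog_lt_self (by norm_num) h
    have h2 : 0 < codeLength u := Nat.clog_pos (by norm_num) h
    have h3 : 2 ^ codeLength u = 2 * 2 ^ (codeLength u - 1) := by
      rw [← pow_succ']; congr 1; omega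
    omega

theorem subset_range_two_pow {u : ℕ} {S : Finset ℕ} (hS : S ⊆ Finset.range u) :
    S ⊆ Finset.range (2 ^ codeLength u) :=
  hS.trans (Finset.range_mono (le_two_pow_codeLength u))

theorem length_levelBits (ℓ d : ℕ) (S : Finset ℕ) :
    (levelBits ℓ S d).length = 2 * (nodesAt ℓ S d).card := by
  simp [levelBits, List.length_flatMap, mul_comm]

theorem length_trieBits (u : ℕ) (S : Finset ℕ) :
    (trieBits u S).length =
      2 * ∑ d ∈ Finset.range (codeLength u), (nodesAt (codeLength u) S d).card := by
  simp only [trieBits, List.length_flatMap, length_levelBits, Finset.mul_sum]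
  rfl

theorem length_trieBits_le {u : ℕ} {S : Finset ℕ} (hu : 1 ≤ u) (hS : S ⊆ Finset.range u) :
    (trieBits u S).length ≤ 4 * u := by
  rw [length_trieBits]
  have h : ∑ d ∈ Finset.range (codeLength u), (nodesAt (codeLength u) S d).card
      ≤ ∑ d ∈ Finset.range (codeLength u), 2 ^ d :=
    Finset.sum_le_sum fun d hd => card_nodesAt_le_two_pow (Finset.mem_range.1 hd).le
      (subset_range_two_pow hS)
  have h2 : ∑ d ∈ Finset.range (codeLength u), 2 ^ d < 2 ^ codeLength u :=
    Nat.geomSum_lt le_rfl fun k hk => Finset.mem_range.1 hk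
  have := two_pow_codeLength_lt hu
  omega

theorem trieBits_empty (u : ℕ) : trieBits u ∅ = [] := by
  rw [← List.length_eq_zero_iff, length_trieBits]
  simp [nodesAt]

theorem exists_length_ominus : ∀ x y : List Bool, x.length = y.length →
    ∃ e, (ominus x y).length + e = x.length ∧ x.take e = y.take e
  | [], _, _ => ⟨0, by simp [ominus]⟩
  | _ :: _, [], h => by simp at h
  | a :: x, b :: y, h => by
    by_cases hab : a = b
    · obtain ⟨e, h1, h2⟩ := exists_length_ominus x y (by simpa using h)
      refine ⟨e + 1, ?_, ?_⟩
      · simp [ominus, hab]; omega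
      · simp [hab, h2]
    · exact ⟨0, by simp [ominus, hab], by simp⟩

theorem div_eq_of_take_binCode_eq {ℓ e d x y : ℕ} (hx : x < 2 ^ ℓ) (hy : y < 2 ^ ℓ) (he : e ≤ ℓ)
    (hd : d ≤ e) (h : (binCode ℓ x).take e = (binCode ℓ y).take e) :
    x / 2 ^ (ℓ - d) = y / 2 ^ (ℓ - d) := by
  apply Nat.eq_of_testBit_eq
  intro i
  rw [Nat.testBit_div_two_pow, Nat.testBit_div_two_pow]
  rcases lt_or_ge i d with hi | hi
  · have h1 := congrArg (fun l : List Bool => l[d - 1 - i]?) h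
    simp only [binCode, List.getElem?_take, List.getElem?_map] at h1
    rw [if_pos (by omega), if_pos (by omega), List.getElem?_range (by omega)] at h1
    simp only [Option.map_some, Option.some.injEq] at h1
    have h2 : ℓ - 1 - (d - 1 - i) = ℓ - d + i := by omega
    rw [h2] at h1
    rw [add_comm]; exact h1
  · have h2 : 2 ^ ℓ ≤ 2 ^ (i + (ℓ - d)) := Nat.pow_le_pow_right (by norm_num) (by omega)
    rw [Nat.testBit_lt_two_pow (hx.trans_le h2), Nat.testBit_lt_two_pow (hy.trans_le h2)]

/-- `trie(S)` is at least the number of nodes below the root: at each depth, a string leads to a new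
node only if its prefix differs from the prefix of the neighbouring string. -/
theorem sum_card_nodesAt_le_list (ℓ : ℕ) (L : List ℕ) (hL : ∀ x ∈ L, x < 2 ^ ℓ) :
    ∑ d ∈ Finset.range ℓ, (nodesAt ℓ L.toFinset (d + 1)).card ≤
      ((L.map (binCode ℓ)).headD []).length +
        ((List.zipWith ominus (L.map (binCode ℓ)).tail (L.map (binCode ℓ))).map List.length).sum := by
  induction L with
  | nil => simp [nodesAt]
  | cons x L ih =>
    cases L with
    | nil => simp [nodesAt, binCode]
    | cons y L =>
      have ih := ih fun z hz => hL z (List.mem_cons_of_mem _ hz)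
      obtain ⟨e, h1, h2⟩ := exists_length_ominus (binCode ℓ y) (binCode ℓ x) (by simp [binCode])
      have hlen : (binCode ℓ y).length = ℓ := by simp [binCode]
      have hlen' : (binCode ℓ x).length = ℓ := by simp [binCode]
      have hx := hL x (by simp)
      have hy := hL y (by simp)
      have key : ∀ d ∈ Finset.range ℓ, (nodesAt ℓ (x :: y :: L).toFinset (d + 1)).card ≤
          (nodesAt ℓ (y :: L).toFinset (d + 1)).card + if e ≤ d then 1 else 0 := by
        intro d hd
        rw [List.toFinset_cons, nodesAt, Finset.image_insert]
        split_ifs with hde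
        · exact Finset.card_insert_le _ _
        · rw [Finset.insert_eq_of_mem]
          · rfl
          · rw [← div_eq_of_take_binCode_eq hy hx (by omega : e ≤ ℓ) (by omega) h2]
            exact Finset.mem_image_of_mem _ (by simp)
      have hcount : ∑ d ∈ Finset.range ℓ, (if e ≤ d then 1 else 0) = ℓ - e := by
        rw [Finset.sum_ite, Finset.sum_const_zero, add_zero, Finset.sum_const, smul_eq_mul, mul_one]
        have : (Finset.range ℓ).filter (e ≤ ·) = Finset.Ico e ℓ := by
          ext d; simp; omega
        rw [this, Nat.card_Ico]
      have hsum := Finset.sum_le_sum key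
      rw [Finset.sum_add_distrib, hcount] at hsum
      simp only [List.map_cons, List.headD_cons, List.tail_cons, List.zipWith_cons_cons,
        List.sum_cons] at ih ⊢
      omega

theorem sum_card_nodesAt_le (u : ℕ) {S : Finset ℕ} (hS : S ⊆ Finset.range u) :
    ∑ d ∈ Finset.range (codeLength u), (nodesAt (codeLength u) S (d + 1)).card
      ≤ trieMeasure u S := by
  have h := sum_card_nodesAt_le_list (codeLength u) (S.sort (fun a b => a ≤ b)) fun x hx =>
    Finset.mem_range.1 (subset_range_two_pow hS ((Finset.mem_sort _).1 hx))
  rwa [Finset.sort_toFinset] at h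

theorem length_trieBits_add_le (u : ℕ) {S : Finset ℕ} (hS : S ⊆ Finset.range u) :
    (trieBits u S).length + 2 * S.card ≤ 2 * trieMeasure u S + 2 := by
  rcases S.eq_empty_or_nonempty with rfl | hne
  · simp [trieBits_empty]
  · have h := sum_card_nodesAt_le u hS
    have h1 := Finset.sum_range_succ' (fun d => (nodesAt (codeLength u) S d).card) (codeLength u)
    rw [Finset.sum_range_succ, nodesAt_last, nodesAt_zero (subset_range_two_pow hS) hne,
      Finset.card_singleton] at h1
    rw [length_trieBits]
    omega

/-! ### Navigation in the level-wise bit vector -/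

/-- The number of nodes before the node `v` of depth `d` in level order. -/
def nodeIndex (ℓ : ℕ) (S : Finset ℕ) (d v : ℕ) : ℕ :=
  (∑ e ∈ Finset.range d, (nodesAt ℓ S e).card) + ((nodesAt ℓ S d).filter (· < v)).card

theorem sort_eq_append {V : Finset ℕ} {v : ℕ} (hv : v ∈ V) :
    V.sort (fun a b => a ≤ b) = (V.filter (· < v)).sort (fun a b => a ≤ b) ++
      v :: (V.filter (v < ·)).sort (fun a b => a ≤ b) := by
  set l := (V.filter (· < v)).sort (fun a b => a ≤ b) ++
      v :: (V.filter (v < ·)).sort (fun a b => a ≤ b) with hl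
  have hs : l.Pairwise (· < ·) := by
    simp only [hl, List.pairwise_append, List.pairwise_cons, List.mem_cons, Finset.mem_sort,
      Finset.mem_filter]
    refine ⟨(Finset.sortedLT_sort _).pairwise, ⟨fun a ha => ha.2, (Finset.sortedLT_sort _).pairwise⟩,
      ?_⟩
    rintro a ⟨_, ha⟩ b (rfl | ⟨_, hb⟩)
    · exact ha
    · exact ha.trans hb
  have hf : l.toFinset = V := by
    ext x
    simp only [hl, List.mem_toFinset, List.mem_append, List.mem_cons, Finset.mem_sort,
      Finset.mem_filter]
    constructor
    · rintro (⟨h, _⟩ | rfl | ⟨h, _⟩) <;> assumption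
    · intro h
      rcases lt_trichotomy x v with h' | h' | h'
      · exact .inl ⟨h, h'⟩
      · exact .inr (.inl h')
      · exact .inr (.inr ⟨h, h'⟩)
  rw [← hf]
  exact (List.toFinset_sort _ (hs.imp fun h => h.ne)).2 (hs.imp fun h => h.le)

/-- The two bits of an inner node, where `V` are the nodes of the next level. -/
def childBits (V : Finset ℕ) (v : ℕ) : List Bool := [decide (2 * v ∈ V), decide (2 * v + 1 ∈ V)]

theorem count_childBits (V : Finset ℕ) (v : ℕ) :
    (childBits V v).count true = (V.filter (fun c => c / 2 = v)).card := by
  have h : V.filter (fun c => c / 2 = v) = ({2 * v, 2 * v + 1} : Finset ℕ).filter (· ∈ V) := by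
    ext c
    simp only [Finset.mem_filter, Finset.mem_insert, Finset.mem_singleton]
    constructor
    · rintro ⟨h1, h2⟩; exact ⟨by omega, h1⟩
    · rintro ⟨h1, h2⟩; exact ⟨h2, by omega⟩
  rw [h, childBits, Finset.filter_insert, Finset.filter_singleton]
  by_cases h0 : 2 * v ∈ V <;> by_cases h1 : 2 * v + 1 ∈ V <;> simp [h0, h1]

theorem count_flatMap_childBits (A V : Finset ℕ) :
    ((A.sort (fun a b => a ≤ b)).flatMap (childBits V)).count true =
      (V.filter (fun c => c / 2 ∈ A)).card := by
  rw [List.count_flatMap]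
  have h1 : ((A.sort (fun a b => a ≤ b)).map (List.count true ∘ childBits V)).sum =
      ∑ v ∈ A, (childBits V v).count true := by
    rw [Finset.sum, ← Finset.sort_eq A (fun a b => a ≤ b), Multiset.map_coe, Multiset.sum_coe]
    rfl
  have h2 : (V.filter (fun c => c / 2 ∈ A)).card =
      ∑ v ∈ A, ((V.filter (fun c => c / 2 ∈ A)).filter (fun c => c / 2 = v)).card :=
    Finset.card_eq_sum_card_fiberwise fun c hc => (Finset.mem_filter.1 hc).2
  rw [h1, h2]
  refine Finset.sum_congr rfl fun v hv => ?_
  rw [count_childBits, Finset.filter_filter]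
  congr 1
  ext c
  simp only [Finset.mem_filter, and_congr_right_iff]
  rintro _
  exact ⟨fun h => ⟨h ▸ hv, h⟩, fun h => h.2⟩

theorem count_levelBits {ℓ d : ℕ} (hd : d < ℓ) (S : Finset ℕ) :
    (levelBits ℓ S d).count true = (nodesAt ℓ S (d + 1)).card := by
  refine (count_flatMap_childBits (nodesAt ℓ S d) (nodesAt ℓ S (d + 1))).trans ?_
  rw [Finset.filter_true_of_mem fun c hc => parent_mem_nodesAt hd hc]

/-- The bit for the child `2 * v + b` of an inner node stands at position `2 * nodeIndex + b`, and
the ones before this position count the nodes before the child, except for the root. -/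
theorem trieBits_child {u d v b : ℕ} {S : Finset ℕ} (hS : S ⊆ Finset.range u)
    (hd : d < codeLength u) (hv : v ∈ nodesAt (codeLength u) S d) (hb : b < 2) :
    (trieBits u S)[2 * nodeIndex (codeLength u) S d v + b]? =
        some (decide (2 * v + b ∈ nodesAt (codeLength u) S (d + 1))) ∧
      onesBefore (trieBits u S) (2 * nodeIndex (codeLength u) S d v + b) + 1 =
        nodeIndex (codeLength u) S (d + 1) (2 * v + b) := by
  have hne : S.Nonempty := by
    rw [nodesAt, Finset.mem_image] at hv
    exact ⟨_, hv.choose_spec.1⟩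
  have h0 := nodesAt_zero (subset_range_two_pow hS) hne
  set ℓ := codeLength u with hℓ
  set A := (nodesAt ℓ S d).filter (· < v) with hA
  set pre := (List.range d).flatMap (levelBits ℓ S) ++
    (A.sort (fun a b => a ≤ b)).flatMap (childBits (nodesAt ℓ S (d + 1))) with hpre
  obtain ⟨rest, hrest⟩ : ∃ rest, trieBits u S =
      pre ++ (childBits (nodesAt ℓ S (d + 1)) v ++ rest) := by
    refine ⟨(((nodesAt ℓ S d).filter (v < ·)).sort (fun a b => a ≤ b)).flatMap
      (childBits (nodesAt ℓ S (d + 1))) ++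
        ((List.range (ℓ - (d + 1))).map (d + 1 + ·)).flatMap (levelBits ℓ S), ?_⟩
    have h1 : List.range ℓ = List.range d ++ (d :: (List.range (ℓ - (d + 1))).map (d + 1 + ·)) := by
      conv_lhs => rw [show ℓ = d + 1 + (ℓ - (d + 1)) by omega]
      rw [List.range_add, List.range_succ]
      simp
    have h2 : levelBits ℓ S d = ((nodesAt ℓ S d).sort (fun a b => a ≤ b)).flatMap
      (childBits (nodesAt ℓ S (d + 1))) := rfl
    rw [trieBits, ← hℓ, h1, List.flatMap_append, List.flatMap_cons, h2, sort_eq_append hv,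
      List.flatMap_append, List.flatMap_cons]
    simp only [hpre, List.append_assoc]
    rfl
  have hlen : pre.length = 2 * nodeIndex ℓ S d v := by
    simp only [hpre, List.length_append, List.length_flatMap, length_levelBits, nodeIndex,
      Finset.mul_sum, mul_add]
    congr 1
    simp [childBits, mul_comm, hA]
  have hcount : pre.count true + 1 = nodeIndex ℓ S (d + 1) (2 * v) := by
    have h1 : ((List.range d).flatMap (levelBits ℓ S)).count true =
        ∑ e ∈ Finset.range d, (nodesAt ℓ S (e + 1)).card := by
      rw [List.count_flatMap]
      refine (Finset.sum_congr rfl fun e he => ?_ :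
        ∑ e ∈ Finset.range d, (levelBits ℓ S e).count true = _)
      exact count_levelBits ((Finset.mem_range.1 he).trans hd) S
    have h2 : (nodesAt ℓ S (d + 1)).filter (fun c => c / 2 ∈ A) =
        (nodesAt ℓ S (d + 1)).filter (· < 2 * v) := by
      refine Finset.filter_congr fun c hc => ?_
      simp only [hA, Finset.mem_filter, parent_mem_nodesAt hd hc, true_and]
      omega
    rw [hpre, List.count_append, h1, count_flatMap_childBits, h2, nodeIndex,
      Finset.sum_range_succ' _ d, h0, Finset.card_singleton]
    omega
  rw [← hlen, hrest]
  constructor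
  · rw [List.getElem?_append_right (by omega), Nat.add_sub_cancel_left]
    interval_cases b <;> rfl
  · have h3 : onesBefore (pre ++ (childBits (nodesAt ℓ S (d + 1)) v ++ rest)) (pre.length + b) =
        pre.count true + ((childBits (nodesAt ℓ S (d + 1)) v).take b).count true := by
      rw [onesBefore, List.take_length_add_append, List.count_append,
        List.take_append_of_le_length (by simp [childBits]; omega)]
    rw [h3]
    interval_cases b
    · simp only [List.take_zero, List.count_nil, add_zero]
      exact hcount
    · have h4 : (nodesAt ℓ S (d + 1)).filter (· < 2 * v + 1) =
          (nodesAt ℓ S (d + 1)).filter (· < 2 * v) ∪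
            (nodesAt ℓ S (d + 1)).filter (· = 2 * v) := by
        ext c
        simp only [Finset.mem_filter, Finset.mem_union]
        constructor
        · rintro ⟨h, h'⟩
          rcases Nat.lt_or_eq_of_le (Nat.le_of_lt_succ h') with h'' | h''
          · exact .inl ⟨h, h''⟩
          · exact .inr ⟨h, h''⟩
        · rintro (⟨h, h'⟩ | ⟨h, h'⟩) <;> exact ⟨h, by omega⟩
      have h5 : ((nodesAt ℓ S (d + 1)).filter (· = 2 * v)).card =
          [decide (2 * v ∈ nodesAt ℓ S (d + 1))].count true := by
        rw [Finset.filter_eq']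
        by_cases h : 2 * v ∈ nodesAt ℓ S (d + 1) <;> simp [h]
      have h6 : nodeIndex ℓ S (d + 1) (2 * v + 1) = nodeIndex ℓ S (d + 1) (2 * v) +
          [decide (2 * v ∈ nodesAt ℓ S (d + 1))].count true := by
        rw [nodeIndex, nodeIndex, h4, Finset.card_union_of_disjoint, h5, add_assoc]
        rw [Finset.disjoint_filter]
        intro c _ h h'
        omega
      rw [h6, ← hcount]
      simp only [childBits, List.take_succ_cons, List.take_zero]
      omega

theorem nodeIndex_root (ℓ : ℕ) (S : Finset ℕ) : nodeIndex ℓ S 0 0 = 0 := by simp [nodeIndex]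

theorem rank_eq_nodeIndex {u x : ℕ} {S : Finset ℕ} (hx : x ∈ S) :
    rank S x + (trieBits u S).length / 2 = nodeIndex (codeLength u) S (codeLength u) x + 1 := by
  rw [length_trieBits, Nat.mul_div_cancel_left _ (by norm_num), nodeIndex, nodesAt_last, rank]
  have h : S.filter (fun y => y ≤ x) = insert x (S.filter (· < x)) := by
    ext y
    simp only [Finset.mem_filter, Finset.mem_insert]
    constructor
    · rintro ⟨h, h'⟩
      rcases h'.lt_or_eq with h'' | h''
      · exact .inr ⟨h, h''⟩
      · exact .inl h''
    · rintro (rfl | ⟨h, h'⟩)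
      · exact ⟨hx, le_rfl⟩
      · exact ⟨h, h'.le⟩
  rw [h, Finset.card_insert_of_notMem (by simp)]
  omega

/-! ### Reading bits from the packed representations -/

theorem startBit_add_length_le {N : ℕ} (E : Fin N → List Bool) (i : Fin N) :
    startBit E i + (E i).length ≤ startBit E N := by
  have h : (E i).length = ∑ j ∈ ({i} : Finset (Fin N)), (E j).length := by simp
  rw [startBit, startBit, h, ← Finset.sum_union]
  · refine Finset.sum_le_sum_of_subset fun j _ => ?_
    simp
  · simp

theorem startBit_le {N : ℕ} (E : Fin N → List Bool) (K : ℕ) (h : ∀ i, (E i).length ≤ K) :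
    startBit E N ≤ N * K := by
  refine (Finset.sum_le_sum fun i _ => h i).trans ?_
  rw [Finset.sum_const, smul_eq_mul]
  exact Nat.mul_le_mul_right _ ((Finset.card_filter_le _ _).trans (by simp))

theorem Loaded.congr {w u N : ℕ} {E : Fin N → List Bool} {args : List ℕ} {s s' : State w}
    (h : Loaded w u E args s) (hf : Fits w u E args) (hr : ∀ r < 7, s'.reg r = s.reg r)
    (hm : ∀ a < freeBase w E args, s'.cell a = s.cell a) : Loaded w u E args s' := by
  have h1 : N + 1 ≤ argBase w E := Nat.le_add_right _ _
  have h2 : argBase w E ≤ freeBase w E args := by unfold freeBase; omega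
  refine ⟨(hr 0 (by omega)).trans h.reg_wordSize, (hr 1 (by omega)).trans h.reg_universe,
    (hr 2 (by omega)).trans h.reg_family, (hr 3 (by omega)).trans h.reg_argCount,
    (hr 4 (by omega)).trans h.reg_bits, (hr 5 (by omega)).trans h.reg_args,
    (hr 6 (by omega)).trans h.reg_free, ?_, ?_, ?_⟩
  · intro i hi
    rw [hm i (by omega), h.directory i hi]
  · intro i p hp
    rw [hm _ _, h.bits i p hp]
    have h3 := startBit_add_length_le E i
    have hw : 0 < w := by
      rcases Nat.eq_zero_or_pos w with rfl | hw
      · have := hf.2.1; omega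
      · exact hw
    refine lt_of_lt_of_le ?_ h2
    unfold argBase
    have h4 : (startBit E i + p) / w + 1 ≤ (startBit E N + w - 1) / w := by
      rw [← Nat.add_div_right _ hw]
      exact Nat.div_le_div_right (by omega)
    omega
  · intro j hj
    rw [hm _ (by unfold freeBase; omega), h.arguments j hj]

theorem Loaded.setReg {w u N : ℕ} {E : Fin N → List Bool} {args : List ℕ} {s : State w}
    (h : Loaded w u E args s) {x : ℕ} (hx : 7 ≤ x) (v : BitVec w) :
    Loaded w u E args (s.setReg x v) := by
  have hr : ∀ r < 7, (s.setReg x v).reg r = s.reg r := fun r hr => by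
    simp [State.setReg, Function.update_of_ne (show r ≠ x by omega)]
  exact ⟨(hr 0 (by omega)).trans h.reg_wordSize, (hr 1 (by omega)).trans h.reg_universe,
    (hr 2 (by omega)).trans h.reg_family, (hr 3 (by omega)).trans h.reg_argCount,
    (hr 4 (by omega)).trans h.reg_bits, (hr 5 (by omega)).trans h.reg_args,
    (hr 6 (by omega)).trans h.reg_free, h.directory, h.bits, h.arguments⟩

/-- A register as an expression. -/
abbrev reg (r : ℕ) : Expr := .var r

/-- The `w` bits from position `pos` on, gathered from two adjacent words. If `pos` is a multiple
of `w`, the second word is shifted out completely. -/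
def wordAt (pos : Expr) : Expr :=
  .bin .or (.bin .shr (.load (reg 4 + pos / reg 0)) (pos % reg 0))
    (.bin .shl (.load (reg 4 + pos / reg 0 + 1)) (reg 0 - pos % reg 0))

/-- The field of `len` bits from position `pos` on. -/
def fieldAt (pos len : Expr) : Expr :=
  .bin .and (wordAt pos) (.bin .shl 1 len - 1)

section Read

variable {w u N : ℕ} {E : Fin N → List Bool} {args : List ℕ} {s : State w}

theorem Loaded.ev_wordAt (h : Loaded w u E args s) (hw : 0 < w) (i : Fin N) {pos : Expr} {a : ℕ}
    (hpos : Ev s pos (startBit E i + a)) (hlt : startBit E i + a < 2 ^ w) :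
    ∃ X < 2 ^ w, Ev s (wordAt pos) X ∧
      ∀ t < w, ∀ b, (E i)[a + t]? = some b → X.testBit t = b := by
  refine ⟨((wordAt pos).eval s).toNat, BitVec.isLt _, by simp [Ev], ?_⟩
  intro t ht b hb
  obtain ⟨hlen, rfl⟩ := List.getElem?_eq_some_iff.1 hb
  have hbit := h.bits i (a + t) hlen
  set P := startBit E i + a with hP
  have hww : w < 2 ^ w := Nat.lt_two_pow_self
  have hr : P % w < w := Nat.mod_lt _ hw
  have e0 : Ev s (reg 0) w := h.reg_wordSize
  have e1 : Ev s (reg 4 + pos / reg 0) (N + 1 + P / w) :=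
    Ev.add (Ev.var h.reg_bits) (hpos.div e0 hlt hww)
  have e2 : Ev s (reg 4 + pos / reg 0 + 1) (N + 1 + P / w + 1) := e1.add (Ev.const 1)
  have e3 : Ev s (pos % reg 0) (P % w) := hpos.mod e0 hlt hww
  have e4 : Ev s (reg 0 - pos % reg 0) (w - P % w) := e0.sub e3 hr.le
  have hval : (wordAt pos).eval s =
      (s.cell (N + 1 + P / w) >>> (P % w)) ||| (s.cell (N + 1 + P / w + 1) <<< (w - P % w)) := by
    change (s.mem _ >>> BitVec.toNat _) ||| (s.mem _ <<< BitVec.toNat _) = _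
    rw [e1, e2, e3, e4, BitVec.toNat_ofNat, BitVec.toNat_ofNat,
      Nat.mod_eq_of_lt (show P % w < 2 ^ w by omega),
      Nat.mod_eq_of_lt (show w - P % w < 2 ^ w by omega)]
    rfl
  change ((wordAt pos).eval s).getLsbD t = _
  rw [hval, ← hbit, BitVec.getLsbD_or, BitVec.getLsbD_ushiftRight, BitVec.getLsbD_shiftLeft]
  have hdm := Nat.div_add_mod P w
  rw [show startBit E i + (a + t) = P % w + t + w * (P / w) by omega,
    Nat.add_mul_div_left _ _ hw, Nat.add_mul_mod_self_left]
  rcases lt_or_ge (P % w + t) w with hlt' | hge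
  · rw [Nat.div_eq_of_lt hlt', Nat.mod_eq_of_lt hlt']
    have : decide (t < w - P % w) = true := by simp; omega
    simp [this]
  · have h1 : (P % w + t) / w = 1 := Nat.div_eq_of_lt_le (by omega) (by omega)
    have h2 : (P % w + t) % w = t - (w - P % w) := by
      rw [Nat.mod_eq_sub_mod hge, Nat.mod_eq_of_lt (by omega)]; omega
    have h3 : decide (t < w - P % w) = false := by simp; omega
    rw [h1, h2, BitVec.getLsbD_of_ge _ _ hge, h3]
    simp only [ht, decide_true, Bool.not_false, Bool.true_and, Bool.false_or]
    congr 2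
    omega

theorem Loaded.ev_fieldAt (h : Loaded w u E args s) (hw : 0 < w) (i : Fin N) {pos len : Expr}
    {a n y : ℕ} (hpos : Ev s pos (startBit E i + a)) (hlt : startBit E i + a < 2 ^ w)
    (hlen : Ev s len n) (hn : n < 2 ^ w) (hf : HasField (E i) a n y) (hy : y < 2 ^ w) :
    Ev s (fieldAt pos len) y := by
  obtain ⟨X, hX, hev, hbits⟩ := h.ev_wordAt hw i hpos hlt
  have h1 : Ev s (fieldAt pos len) (X &&& (1 * 2 ^ n - 1)) :=
    hev.and ((Ev.shl (Ev.const 1) hlen hn).sub (Ev.const 1) (by simpa using Nat.one_le_two_pow))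
  rw [one_mul, Nat.and_two_pow_sub_one_eq_mod] at h1
  have h2 : X % 2 ^ n = y := by
    apply Nat.eq_of_testBit_eq
    intro t
    rw [Nat.testBit_mod_two_pow]
    rcases lt_or_ge t n with htn | htn
    · rcases lt_or_ge t w with htw | htw
      · simp [htn, hbits t htw _ (hf.2 t htn)]
      · have := Nat.pow_le_pow_right (n := 2) (by norm_num) htw
        simp [htn, Nat.testBit_lt_two_pow (hX.trans_le this),
          Nat.testBit_lt_two_pow (hy.trans_le this)]
    · have := Nat.pow_le_pow_right (n := 2) (by norm_num) htn
      simp [htn.not_gt, Nat.testBit_lt_two_pow (hf.1.trans_le this)]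
  rwa [h2] at h1

end Read

/-! ### The rank query -/

/-- `X &&& (X - 1)` clears the lowest `1` of `X`; this finds the parameters in the header. -/
theorem decode_header {X c : ℕ} (h : X % 2 ^ (2 * c + 1) = 2 ^ c + 2 ^ (c + 1) * c) :
    1 ≤ X ∧ (X &&& (X - 1)) ≤ X ∧ X - (X &&& (X - 1)) = 2 ^ c ∧
      X / (2 ^ c + 2 ^ c) % 2 ^ c = c := by
  have hc : c < 2 ^ c := Nat.lt_two_pow_self
  have h2 : 2 ^ (c + 1) = 2 ^ c + 2 ^ c := by rw [pow_succ]; ring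
  have h3 : 2 ^ (2 * c + 1) = 2 ^ (c + 1) * 2 ^ c := by rw [← pow_add]; congr 1; omega
  have hpos : 0 < 2 ^ c := by positivity
  obtain ⟨k, hk, hkc⟩ : ∃ k, X = 2 ^ (c + 1) * k + 2 ^ c ∧ k % 2 ^ c = c := by
    refine ⟨2 ^ c * (X / 2 ^ (2 * c + 1)) + c, ?_, ?_⟩
    · conv_lhs => rw [← Nat.div_add_mod X (2 ^ (2 * c + 1)), h]
      rw [h3]; ring
    · rw [Nat.mul_add_mod, Nat.mod_eq_of_lt hc]
  have hand : X &&& (X - 1) = 2 ^ (c + 1) * k := by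
    have hX1 : X - 1 = 2 ^ (c + 1) * k + (2 ^ c - 1) := by omega
    have h0 : 2 ^ c &&& (2 ^ c - 1) = 0 := by
      rw [Nat.and_two_pow_sub_one_eq_mod, Nat.mod_self]
    apply Nat.eq_of_testBit_eq
    intro t
    rw [Nat.testBit_and, hX1]
    conv_lhs => rw [hk]
    rw [Nat.testBit_two_pow_mul_add _ (by omega), Nat.testBit_two_pow_mul_add _ (by omega),
      Nat.testBit_two_pow_mul]
    have h4 := congrArg (fun n => n.testBit t) h0
    simp only [Nat.testBit_and, Nat.zero_testBit] at h4
    split_ifs with h5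
    · rw [h4]; simp; omega
    · rw [Bool.and_self]; simp; omega
  refine ⟨by omega, by omega, by omega, ?_⟩
  rw [← h2, hk, Nat.mul_add_div (by positivity), Nat.div_eq_of_lt (by omega), add_zero, hkc]

/-- Straight-line code for a query at position `R[21]` of the representation `R[20]`: it decodes
the block size `R[24]` and its logarithm `R[25]`, the length field `R[27]` and the length `R[28]`,
and the positions `R[26]`, `R[29]`, `R[30]`, `R[31]` of the table, the two directories and the bit
vector itself; `R[33]` is the number of `1`s before the position and `R[34]` the bit there. -/
def queryCode : List Stmt :=
  [.set 22 (.load (reg 20)),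
   .set 23 (wordAt (reg 22)),
   .set 24 (reg 23 - .bin .and (reg 23) (reg 23 - 1)),
   .set 25 (reg 23 / (reg 24 + reg 24) % reg 24),
   .set 26 (reg 22 + (2 * reg 25 + 1)),
   .set 27 (fieldAt (reg 26) (4 * reg 24)),
   .set 28 (reg 27 - reg 27 % 2),
   .set 26 (reg 26 + 4 * reg 24),
   .set 29 (reg 26 + reg 24 * .bin .shl 1 (reg 24)),
   .set 30 (reg 29 + (reg 28 / reg 24 / reg 24 + 1) * (4 * reg 24)),
   .set 31 (reg 30 + (reg 28 / reg 24 + 1) * (2 * reg 25)),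
   .set 32 (fieldAt (reg 31 + reg 21 / reg 24 * reg 24) (reg 21 % reg 24)),
   .set 33 (fieldAt (reg 29 + reg 21 / reg 24 / reg 24 * (4 * reg 24)) (4 * reg 24) +
     fieldAt (reg 30 + reg 21 / reg 24 * (2 * reg 25)) (2 * reg 25) +
     fieldAt (reg 26 + reg 32 * reg 24) (reg 24)),
   .set 34 (fieldAt (reg 31 + reg 21) 1)]

theorem setReg_reg_of_ne {w : ℕ} {s : State w} {x r : ℕ} (h : r ≠ x) (v : BitVec w) :
    (s.setReg x v).reg r = s.reg r := Function.update_of_ne h _ _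

/-- The result of a query for the position `p` of the bit vector `B` with the given flag; the
registers below `n` are unchanged. -/
structure QueryResult {w : ℕ} (n : ℕ) (B : List Bool) (flag : Bool) (p : ℕ) (s s' : State w) :
    Prop where
  reg_eq : ∀ r < n, s'.reg r = s.reg r
  mem_eq : s'.mem = s.mem
  rank : s'.reg 33 = BitVec.ofNat w (onesBefore B p)
  bit : ∀ b, B[p]? = some b → s'.reg 34 = BitVec.ofNat w b.toNat
  count : s'.reg 27 = BitVec.ofNat w (B.length + flag.toNat)
  length : s'.reg 28 = BitVec.ofNat w B.length

theorem after_queryCode {w u N : ℕ} {E : Fin N → List Bool} {args : List ℕ} {s : State w}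
    (h : Loaded w u E args s) (hw : 2 ≤ w) (hN : startBit E N < 2 ^ w) (i : Fin N)
    (B : List Bool) (flag : Bool) (hE : E i = auxBits B flag ++ B) (heven : B.length % 2 = 0)
    {p : ℕ} (hp : p ≤ B.length) (h20 : s.reg 20 = BitVec.ofNat w i)
    (h21 : s.reg 21 = BitVec.ofNat w p) :
    After queryCode s (QueryResult 22 B flag p s) := by
  have hw0 : 0 < w := by omega
  have hmax : startBit E i + (auxLen B.length + B.length) < 2 ^ w := by
    have := startBit_add_length_le E i
    rw [hE, List.length_append, length_auxBits] at this
    omega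
  have hheader := hasField_header B flag
  have hcount := hasField_count B flag
  rw [← hE] at hheader hcount
  have hsuper := hasField_super B flag
    (j := p / blockSize B.length / blockSize B.length)
    (Nat.div_le_div_right (Nat.div_le_div_right hp))
  have hblock := hasField_block B flag (j := p / blockSize B.length) (Nat.div_le_div_right hp)
  have hpm : p / blockSize B.length * blockSize B.length + p % blockSize B.length = p :=
    Nat.div_add_mod' _ _
  obtain ⟨v, hv, hvcount⟩ := exists_hasField_bits B flag
    (a := p / blockSize B.length * blockSize B.length) (r := p % blockSize B.length)
    (by rw [hpm]; exact hp)
  have hmodlt : p % blockSize B.length < blockSize B.length := Nat.mod_lt _ (blockSize_pos _)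
  have hvlt : v < 2 ^ blockSize B.length :=
    hv.1.trans_le (Nat.pow_le_pow_right (by norm_num) hmodlt.le)
  have htable := hasField_table B flag hvlt
  rw [popCount_eq_of_lt hmodlt.le hv.1] at htable
  rw [hpm] at hvcount
  rw [← hE] at hsuper hblock hv htable
  have hbit : ∀ b, B[p]? = some b → HasField (E i) (auxLen B.length + p) 1 b.toNat := by
    intro b hb
    obtain ⟨hlt, rfl⟩ := List.getElem?_eq_some_iff.1 hb
    rw [hE]; exact hasField_bit B flag hlt
  have hlog : 2 * blockLog B.length + 1 ≤ w := by
    have h1 := two_mul_blockSize_le B.length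
    have h2 := blockLog_lt B.length
    have h3 : Nat.log 2 (B.length + 4) < w + 1 := by
      refine Nat.log_lt_of_lt_pow (by omega) ?_
      have : 2 ^ 2 ≤ 2 ^ w := Nat.pow_le_pow_right (by norm_num) hw
      rw [pow_succ]; omega
    omega
  have hβ : blockSize B.length = 2 ^ blockLog B.length := rfl
  have hβpos := blockSize_pos B.length
  have hcβ := blockLog_lt B.length
  have hsum : onesBefore B (p / blockSize B.length / blockSize B.length * blockSize B.length *
      blockSize B.length) + blockRank B (p / blockSize B.length) +
      popCount (p % blockSize B.length) v = onesBefore B p := by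
    have := onesBefore_mono B (Nat.mul_le_mul_right (blockSize B.length)
      (Nat.div_mul_le_self (p / blockSize B.length) (blockSize B.length)))
    unfold blockRank
    omega
  have hple := onesBefore_le B p
  have e_count : posCount B.length = 2 * blockLog B.length + 1 := rfl
  have e_table : posTable B.length = posCount B.length + 4 * blockSize B.length := rfl
  have e_super : posSuper B.length =
    posTable B.length + blockSize B.length * (1 * 2 ^ blockSize B.length) := by
      rw [one_mul]; rfl
  have e_block : posBlock B.length = posSuper B.length +
    (B.length / blockSize B.length / blockSize B.length + 1) * (4 * blockSize B.length) := rfl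
  have e_aux : auxLen B.length = posBlock B.length +
    (B.length / blockSize B.length + 1) * (2 * blockLog B.length) := rfl
  have hflag : flag.toNat ≤ 1 := Bool.toNat_le _
  -- the offsets of the entries stay within their arrays, hence below `2 ^ w`
  have b_super : p / blockSize B.length / blockSize B.length * (4 * blockSize B.length) ≤
      (B.length / blockSize B.length / blockSize B.length + 1) * (4 * blockSize B.length) :=
    Nat.mul_le_mul_right _ ((Nat.div_le_div_right (Nat.div_le_div_right hp)).trans (Nat.le_succ _))
  have b_block : p / blockSize B.length * (2 * blockLog B.length) ≤
      (B.length / blockSize B.length + 1) * (2 * blockLog B.length) :=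
    Nat.mul_le_mul_right _ ((Nat.div_le_div_right hp).trans (Nat.le_succ _))
  have b_table : v * blockSize B.length ≤ blockSize B.length * (1 * 2 ^ blockSize B.length) := by
    rw [one_mul, mul_comm]; exact Nat.mul_le_mul_left _ hvlt.le
  have hmlt : B.length + 1 < 2 ^ w := by omega
  have hplt : p < 2 ^ w := by omega
  generalize hgβ : blockSize B.length = β at *
  generalize hgc : blockLog B.length = c at *
  have hdβ : p / β ≤ p := Nat.div_le_self _ _
  have hdβ' : B.length / β ≤ B.length := Nat.div_le_self _ _
  unfold queryCode
  refine After.set (v := startBit E i) (Ev.load (Ev.var h20) (h.directory i i.2.le)) ?_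
  replace h := h.setReg (x := 22) (by norm_num) (BitVec.ofNat w (startBit E i))
  -- the whole header lies within the first `w` bits, whose lowest one is that of the header
  obtain ⟨X, hX, hXev, hXbits⟩ := h.ev_wordAt hw0 i (pos := reg 22) (a := 0) (Ev.var rfl) (by omega)
  have hXmod : X % 2 ^ (2 * c + 1) = 2 ^ c + 2 ^ (c + 1) * c := by
    have h1 : header B.length = 2 ^ c + 2 ^ (c + 1) * c := by rw [← hgc]; rfl
    rw [← h1]
    apply Nat.eq_of_testBit_eq
    intro t
    rw [Nat.testBit_mod_two_pow]
    rcases lt_or_ge t (2 * c + 1) with ht | ht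
    · simp [ht, hXbits t (by omega) _ (hheader.2 t ht)]
    · have := Nat.pow_le_pow_right (n := 2) (by norm_num) ht
      simp [ht.not_gt, Nat.testBit_lt_two_pow (hheader.1.trans_le this)]
  obtain ⟨hX1, hXle, hXβ, hXc⟩ := decode_header hXmod
  rw [← hβ] at hXβ hXc
  refine After.set hXev ?_
  replace h := h.setReg (x := 23) (by norm_num) (BitVec.ofNat w X)
  refine After.set (v := β) ?_ ?_
  · rw [← hXβ]
    exact Ev.sub (Ev.var rfl) (Ev.and (Ev.var rfl) (Ev.sub (Ev.var rfl) (Ev.const 1) hX1)) hXle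
  replace h := h.setReg (x := 24) (by norm_num) (BitVec.ofNat w β)
  refine After.set (v := c) ?_ ?_
  · rw [← hXc]
    exact Ev.mod (Ev.div (Ev.var rfl) (Ev.add (Ev.var rfl) (Ev.var rfl)) hX (by omega)) (Ev.var rfl)
      ((Nat.div_le_self _ _).trans_lt hX) (by omega)
  replace h := h.setReg (x := 25) (by norm_num) (BitVec.ofNat w c)
  refine After.set (v := startBit E i + posCount B.length) ?_ ?_
  · rw [e_count]
    exact Ev.add (Ev.var rfl) (Ev.add (Ev.mul (Ev.const 2) (Ev.var rfl)) (Ev.const 1))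
  replace h := h.setReg (x := 26) (by norm_num) (BitVec.ofNat w (startBit E i + posCount B.length))
  refine After.set (h.ev_fieldAt hw0 i (Ev.var rfl) (by omega)
    (Ev.mul (Ev.const 4) (Ev.var rfl)) (by omega) hcount (by omega)) ?_
  replace h := h.setReg (x := 27) (by norm_num) (BitVec.ofNat w (B.length + flag.toNat))
  refine After.set (v := B.length) ?_ ?_
  · exact (Ev.sub (Ev.var rfl) (Ev.mod (Ev.var rfl) (Ev.const 2) (by omega) (by omega))
      (Nat.mod_le _ _)).cast (by omega)
  replace h := h.setReg (x := 28) (by norm_num) (BitVec.ofNat w B.length)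
  refine After.set (v := startBit E i + posTable B.length) ?_ ?_
  · rw [e_table, ← add_assoc]
    exact Ev.add (Ev.var rfl) (Ev.mul (Ev.const 4) (Ev.var rfl))
  replace h := h.setReg (x := 26) (by norm_num) (BitVec.ofNat w (startBit E i + posTable B.length))
  refine After.set (v := startBit E i + posSuper B.length) ?_ ?_
  · rw [e_super, ← add_assoc]
    exact Ev.add (Ev.var rfl) (Ev.mul (Ev.var rfl) (Ev.shl (Ev.const 1) (Ev.var rfl) (by omega)))
  replace h := h.setReg (x := 29) (by norm_num) (BitVec.ofNat w (startBit E i + posSuper B.length))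
  refine After.set (v := startBit E i + posBlock B.length) ?_ ?_
  · rw [e_block, ← add_assoc]
    exact Ev.add (Ev.var rfl) (Ev.mul (Ev.add (Ev.div (Ev.div (Ev.var rfl) (Ev.var rfl)
      (by omega) (by omega)) (Ev.var rfl) (by omega) (by omega)) (Ev.const 1))
      (Ev.mul (Ev.const 4) (Ev.var rfl)))
  replace h := h.setReg (x := 30) (by norm_num) (BitVec.ofNat w (startBit E i + posBlock B.length))
  refine After.set (v := startBit E i + auxLen B.length) ?_ ?_
  · rw [e_aux, ← add_assoc]
    exact Ev.add (Ev.var rfl) (Ev.mul (Ev.add (Ev.div (Ev.var rfl) (Ev.var rfl)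
      (by omega) (by omega)) (Ev.const 1)) (Ev.mul (Ev.const 2) (Ev.var rfl)))
  replace h := h.setReg (x := 31) (by norm_num) (BitVec.ofNat w (startBit E i + auxLen B.length))
  -- the bits of the last, partial block, as an index of the table; the entry for the empty range
  -- is read if the block boundary is hit
  have hvlt' : v < 2 ^ w := by
    have : 2 ^ β ≤ β * (1 * 2 ^ β) := by rw [one_mul]; exact Nat.le_mul_of_pos_left _ hβpos
    omega
  refine After.set (h.ev_fieldAt hw0 i (a := auxLen B.length + p / β * β) ?_ ?_
    (Ev.mod (Ev.var h21) (Ev.var rfl) (by omega) (by omega)) (by omega) hv hvlt') ?_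
  · rw [← add_assoc]
    exact Ev.add (Ev.var rfl) (Ev.mul (Ev.div (Ev.var h21) (Ev.var rfl) (by omega) (by omega))
      (Ev.var rfl))
  · omega
  replace h := h.setReg (x := 32) (by norm_num) (BitVec.ofNat w v)
  refine After.set (v := onesBefore B p) ?_ ?_
  · rw [← hsum]
    refine Ev.add (Ev.add (h.ev_fieldAt hw0 i ?_ ?_ (Ev.mul (Ev.const 4) (Ev.var rfl)) (by omega)
      hsuper (by omega)) (h.ev_fieldAt hw0 i ?_ ?_ (Ev.mul (Ev.const 2) (Ev.var rfl)) (by omega)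
      hblock (by omega))) (h.ev_fieldAt hw0 i ?_ ?_ (Ev.var rfl) (by omega) htable (by omega))
    · rw [← add_assoc]
      exact Ev.add (Ev.var rfl) (Ev.mul (Ev.div (Ev.div (Ev.var h21) (Ev.var rfl) (by omega)
        (by omega)) (Ev.var rfl) (by omega) (by omega)) (Ev.mul (Ev.const 4) (Ev.var rfl)))
    · omega
    · rw [← add_assoc]
      exact Ev.add (Ev.var rfl) (Ev.mul (Ev.div (Ev.var h21) (Ev.var rfl) (by omega) (by omega))
        (Ev.mul (Ev.const 2) (Ev.var rfl)))
    · omega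
    · rw [← add_assoc]
      exact Ev.add (Ev.var rfl) (Ev.mul (Ev.var rfl) (Ev.var rfl))
    · omega
  replace h := h.setReg (x := 33) (by norm_num) (BitVec.ofNat w (onesBefore B p))
  -- beyond the end of the bit vector, the value of the last expression does not matter
  set s₁ := State.setReg _ 33 _
  refine After.set (v := ((fieldAt (reg 31 + reg 21) 1).eval s₁).toNat) (by simp [Ev]) ?_
  refine After.nil ⟨fun r hr => ?_, rfl, rfl, fun b hb => ?_, rfl, rfl⟩
  · simp only [s₁]
    repeat rw [setReg_reg_of_ne (by omega)]
  · have hb' := Bool.toNat_le b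
    have h1 : Ev s₁ (fieldAt (reg 31 + reg 21) 1) b.toNat := by
      refine h.ev_fieldAt hw0 i ?_ ?_ (Ev.const 1) (by omega) (hbit b hb) (by omega)
      · rw [← add_assoc]
        exact Ev.add (Ev.var rfl) (Ev.var h21)
      · omega
    change BitVec.ofNat w _ = _
    rw [h1, BitVec.ofNat_toNat, BitVec.setWidth_eq]

/-- Rank in constant time: the arguments are loaded, then `queryCode` runs. -/
def rankCode : List Stmt :=
  [.set 20 (.load (reg 5)), .set 21 (.load (reg 5 + 1))] ++ (queryCode ++ [.set 0 (reg 33)])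

theorem runs_rankCode {w u N : ℕ} {E : Fin N → List Bool} {s : State w} {i : Fin N} {p : ℕ}
    (h : Loaded w u E [(i : ℕ), p] s) (hw : 2 ≤ w) (hN : startBit E N < 2 ^ w)
    (B : List Bool) (flag : Bool) (hE : E i = auxBits B flag ++ B) (heven : B.length % 2 = 0)
    (hp : p ≤ B.length) :
    Runs (block rankCode) s (blockCost rankCode)
      (fun s' => s'.reg 0 = BitVec.ofNat w (onesBefore B p) ∧ s'.mem = s.mem) := by
  refine Runs.block (by decide) (After.append ?_)
  refine After.set (v := i) (Ev.load (Ev.var h.reg_args) (h.arguments 0 (by simp))) ?_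
  replace h := h.setReg (x := 20) (by norm_num) (BitVec.ofNat w i)
  refine After.set (v := p) (Ev.load (Ev.add (Ev.var h.reg_args) (Ev.const 1))
    (h.arguments 1 (by simp))) ?_
  replace h := h.setReg (x := 21) (by norm_num) (BitVec.ofNat w p)
  refine After.nil (After.append ?_)
  refine (after_queryCode h hw hN i B flag hE heven hp rfl rfl).mono fun s' hs' => ?_
  exact After.set hs'.rank (After.nil ⟨rfl, hs'.mem_eq⟩)

/-! ### The common nodes of the tries and the alternation measure -/

/-- The nodes at depth `d` that all tries share. -/
def commonNodes (ℓ : ℕ) {k : ℕ} (T : Fin k → Finset ℕ) (d : ℕ) : Finset ℕ :=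
  (Finset.range (2 ^ d)).filter (fun v => ∀ j, v ∈ nodesAt ℓ (T j) d)

section Common

variable {u k : ℕ} {T : Fin k → Finset ℕ}

theorem mem_commonNodes {d v : ℕ} (hk : 1 ≤ k) (hT : ∀ j, T j ⊆ Finset.range u)
    (hd : d ≤ codeLength u) :
    v ∈ commonNodes (codeLength u) T d ↔ ∀ j, v ∈ nodesAt (codeLength u) (T j) d := by
  rw [commonNodes, Finset.mem_filter, Finset.mem_range]
  exact ⟨fun h => h.2, fun h =>
    ⟨lt_two_pow_of_mem_nodesAt hd (subset_range_two_pow (hT ⟨0, hk⟩)) (h _), h⟩⟩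

theorem commonNodes_last (hk : 1 ≤ k) (hT : ∀ j, T j ⊆ Finset.range u) :
    commonNodes (codeLength u) T (codeLength u) = interSet u T := by
  ext x
  rw [mem_commonNodes hk hT le_rfl, interSet, Finset.mem_filter]
  simp only [nodesAt_last]
  exact ⟨fun h => ⟨hT ⟨0, hk⟩ (h _), h⟩, fun h => h.2⟩

theorem card_commonNodes_le (hk : 1 ≤ k) (hT : ∀ j, T j ⊆ Finset.range u) (d : ℕ) :
    (commonNodes (codeLength u) T d).card ≤ u := by
  have h : commonNodes (codeLength u) T d ⊆ nodesAt (codeLength u) (T ⟨0, hk⟩) d :=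
    fun v hv => (Finset.mem_filter.1 hv).2 _
  refine (Finset.card_le_card h).trans ((card_nodesAt_le _ _ _).trans ?_)
  simpa using Finset.card_le_card (hT ⟨0, hk⟩)

theorem exists_isPartitionCertificate (u : ℕ) (T : Fin k → Finset ℕ) :
    ∃ P : Finpartition (Finset.range u), IsPartitionCertificate u T P ∧
      P.parts.card = alternation u T := by
  refine Nat.sInf_mem (s := {m | ∃ P : Finpartition (Finset.range u),
    IsPartitionCertificate u T P ∧ P.parts.card = m}) ⟨_, ⊥, ⟨?_, ?_, ?_⟩, rfl⟩
  · intro I hI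
    obtain ⟨x, _, rfl⟩ := Finpartition.mem_bot_iff.1 hI
    exact ⟨x, x, by simp⟩
  · intro x hx
    exact Finpartition.mem_bot_iff.2 ⟨x, (Finset.mem_filter.1 hx).1, rfl⟩
  · intro x hx hx'
    refine ⟨{x}, Finpartition.mem_bot_iff.2 ⟨x, hx, rfl⟩, by simp, ?_⟩
    simp only [interSet, Finset.mem_filter, hx, true_and, not_forall] at hx'
    obtain ⟨j, hj⟩ := hx'
    exact ⟨j, by simpa using hj⟩

theorem one_le_alternation (hu : 1 ≤ u) (T : Fin k → Finset ℕ) : 1 ≤ alternation u T := by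
  obtain ⟨P, _, hc⟩ := exists_isPartitionCertificate u T
  rw [← hc, Nat.one_le_iff_ne_zero, Finset.card_ne_zero]
  obtain ⟨I, hI, _⟩ := P.exists_mem (Finset.mem_range.2 hu)
  exact ⟨I, hI⟩

theorem alternation_le (u : ℕ) (T : Fin k → Finset ℕ) : alternation u T ≤ u := by
  obtain ⟨P, _, hc⟩ := exists_isPartitionCertificate u T
  simpa [hc] using P.card_parts_le_card

/-- Distinct common nodes of the same depth have the left ends of their intervals in distinct
parts of a certificate: otherwise the whole interval of the left one of the nodes would lie in a
part that is disjoint from one of the sets, which then has no element below this node. -/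
theorem card_commonNodes_le_alternation (hk : 1 ≤ k) (hT : ∀ j, T j ⊆ Finset.range u) (d : ℕ) :
    (commonNodes (codeLength u) T d).card ≤ alternation u T := by
  obtain ⟨P, ⟨hP1, hP2, hP3⟩, hc⟩ := exists_isPartitionCertificate u T
  rw [← hc]
  set h := 2 ^ (codeLength u - d) with hh
  have hpos : 0 < h := by positivity
  have hleft : ∀ v ∈ commonNodes (codeLength u) T d, v * h ∈ Finset.range u := by
    intro v hv
    have h1 := (Finset.mem_filter.1 hv).2 ⟨0, hk⟩
    simp only [nodesAt, Finset.mem_image] at h1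
    obtain ⟨x, hx, rfl⟩ := h1
    exact Finset.mem_range.2 ((Nat.div_mul_le_self _ _).trans_lt
      (Finset.mem_range.1 (hT _ hx)))
  have key : ∀ v ∈ commonNodes (codeLength u) T d, ∀ v' ∈ commonNodes (codeLength u) T d,
      v < v' → P.part (v * h) ≠ P.part (v' * h) := by
    intro v hv v' hv' hlt heq
    have hm := P.mem_part (hleft v hv)
    have hm' := P.mem_part (hleft v' hv')
    have hI := P.part_mem.2 (hleft v hv)
    rw [← heq] at hm'
    obtain ⟨a, b, hab⟩ := hP1 _ hI
    have hlt' : (v + 1) * h ≤ v' * h := Nat.mul_le_mul_right _ hlt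
    have hnot : v * h ∉ interSet u T := by
      intro hin
      have h1 := P.eq_of_mem_parts hI (hP2 _ hin) hm (by simp)
      rw [h1, Finset.mem_singleton] at hm'
      rw [Nat.add_mul] at hlt'
      omega
    obtain ⟨I', hI', hmem, j, hdis⟩ := hP3 _ (hleft v hv) hnot
    obtain rfl := P.eq_of_mem_parts hI hI' hm hmem
    have h2 := (Finset.mem_filter.1 hv).2 j
    simp only [nodesAt, Finset.mem_image] at h2
    obtain ⟨x, hx, hxv⟩ := h2
    refine Finset.disjoint_left.1 hdis hx ?_
    rw [hab, Finset.mem_Icc] at hm hm' ⊢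
    have h3 : v * h ≤ x := by rw [← hxv]; exact Nat.div_mul_le_self _ _
    have h4 : x < (v + 1) * h := by
      rw [← hxv, mul_comm]; exact Nat.lt_mul_div_succ _ hpos
    omega
  refine Finset.card_le_card_of_injOn (fun v => P.part (v * h))
    (fun v hv => P.part_mem.2 (hleft v hv)) ?_
  intro v hv v' hv' heq
  rcases lt_trichotomy v v' with h1 | h1 | h1
  · exact absurd heq (key v hv v' hv' h1)
  · exact h1
  · exact absurd heq.symm (key v' hv' v hv h1)

/-- A bound for the number of common nodes. -/
noncomputable def nodeBound (u : ℕ) (T : Fin k → Finset ℕ) : ℕ :=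
  ∑ d ∈ Finset.range (codeLength u + 1), min (2 ^ d) (alternation u T)

theorem sum_card_commonNodes_le (hk : 1 ≤ k) (hT : ∀ j, T j ⊆ Finset.range u) :
    ∑ d ∈ Finset.range (codeLength u + 1), (commonNodes (codeLength u) T d).card ≤
      nodeBound u T := by
  refine Finset.sum_le_sum fun d _ => le_min ?_ (card_commonNodes_le_alternation hk hT d)
  exact (Finset.card_filter_le _ _).trans (by simp)

theorem codeLength_lt_nodeBound (hu : 1 ≤ u) (T : Fin k → Finset ℕ) :
    codeLength u + 1 ≤ nodeBound u T := by
  have : ∑ d ∈ Finset.range (codeLength u + 1), 1 ≤ nodeBound u T :=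
    Finset.sum_le_sum fun d _ => le_min Nat.one_le_two_pow (one_le_alternation hu T)
  simpa using this

/-- The upper levels have at most `2 ^ d` nodes each, the `ℓ - lg δ` lower ones at most `δ`. -/
theorem nodeBound_le (hu : 1 ≤ u) (T : Fin k → Finset ℕ) :
    (nodeBound u T : ℝ) ≤ 4 * ((alternation u T : ℕ) *
      (1 + Real.logb 2 (u / (alternation u T : ℕ)))) := by
  have h1 := one_le_alternation hu T
  have h2 := alternation_le u T
  unfold nodeBound
  generalize alternation u T = δ at *
  set ℓ := codeLength u with hℓ
  have hℓu := two_pow_codeLength_lt hu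
  have huℓ := le_two_pow_codeLength u
  have ha1 : 2 ^ Nat.log 2 δ ≤ δ := Nat.pow_log_le_self 2 (by omega)
  have ha2 : δ < 2 ^ (Nat.log 2 δ + 1) := Nat.lt_pow_succ_log_self (by norm_num) δ
  set a := Nat.log 2 δ with ha
  have haℓ : a ≤ ℓ := (Nat.pow_le_pow_iff_right (by norm_num)).1 ((ha1.trans h2).trans huℓ)
  have hnat : ∑ d ∈ Finset.range (ℓ + 1), min (2 ^ d) δ ≤ δ * (2 + (ℓ - a)) := by
    rw [show ℓ + 1 = (a + 1) + (ℓ - a) by omega, Finset.sum_range_add]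
    have h3 : ∑ d ∈ Finset.range (a + 1), min (2 ^ d) δ ≤ ∑ d ∈ Finset.range (a + 1), 2 ^ d :=
      Finset.sum_le_sum fun d _ => min_le_left _ _
    have h4 : ∑ d ∈ Finset.range (a + 1), 2 ^ d < 2 ^ (a + 1) :=
      Nat.geomSum_lt le_rfl fun k hk => Finset.mem_range.1 hk
    have h5 : ∑ d ∈ Finset.range (ℓ - a), min (2 ^ (a + 1 + d)) δ ≤
        ∑ d ∈ Finset.range (ℓ - a), δ := Finset.sum_le_sum fun d _ => min_le_right _ _
    rw [Finset.sum_const, Finset.card_range, smul_eq_mul] at h5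
    rw [pow_succ] at h4
    have h6 : δ * (2 + (ℓ - a)) = δ * 2 + (ℓ - a) * δ := by ring
    omega
  have hδ : (0 : ℝ) < δ := by exact_mod_cast h1
  have hu' : (0 : ℝ) < u := by exact_mod_cast hu
  have hlogu : (ℓ : ℝ) ≤ Real.logb 2 u + 1 := by
    have h3 : ((2 : ℝ) ^ ℓ) ≤ 2 * u := by exact_mod_cast hℓu.le
    have h4 := Real.logb_le_logb_of_le (b := 2) (by norm_num) (by positivity) h3
    rw [Real.logb_pow, Real.logb_self_eq_one (by norm_num), mul_one,
      Real.logb_mul (by norm_num) hu'.ne', Real.logb_self_eq_one (by norm_num)] at h4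
    linarith
  have hlogδ : Real.logb 2 δ ≤ a + 1 := by
    have h3 : (δ : ℝ) ≤ (2 : ℝ) ^ (a + 1) := by exact_mod_cast ha2.le
    have h4 := Real.logb_le_logb_of_le (b := 2) (by norm_num) hδ h3
    rw [Real.logb_pow, Real.logb_self_eq_one (by norm_num), mul_one] at h4
    exact_mod_cast h4
  have hlog0 : 0 ≤ Real.logb 2 (u / δ) := by
    refine Real.logb_nonneg (by norm_num) ?_
    rw [le_div_iff₀ hδ, one_mul]
    exact_mod_cast h2
  have hdiv : Real.logb 2 (u / δ) = Real.logb 2 u - Real.logb 2 δ :=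
    Real.logb_div hu'.ne' hδ.ne'
  calc ((∑ d ∈ Finset.range (ℓ + 1), min (2 ^ d) δ : ℕ) : ℝ) ≤ (δ * (2 + (ℓ - a)) : ℕ) := by
        exact_mod_cast hnat
    _ = δ * (2 + ((ℓ : ℝ) - a)) := by push_cast [Nat.cast_sub haℓ]; ring
    _ ≤ δ * (4 * (1 + Real.logb 2 (u / δ))) := by
        gcongr
        linarith
    _ = _ := by ring

/-! ### From one level of common nodes to the next -/

/-- The common nodes at depth `d` in increasing order. -/
def levelList (ℓ : ℕ) {k : ℕ} (T : Fin k → Finset ℕ) (d : ℕ) : List ℕ :=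
  (commonNodes ℓ T d).sort (fun a b => a ≤ b)

/-- The `e`-th child of the nodes in `L`, where each node has two children. -/
def candidate (L : List ℕ) (e : ℕ) : ℕ := 2 * L.getD (e / 2) 0 + e % 2

theorem levelList_zero (hT : ∀ j, T j ⊆ Finset.range u) :
    levelList (codeLength u) T 0 = if ∀ j, (T j).Nonempty then [0] else [] := by
  have h : commonNodes (codeLength u) T 0 = if ∀ j, (T j).Nonempty then {0} else ∅ := by
    ext v
    rw [commonNodes, Finset.mem_filter, pow_zero, Finset.range_one, Finset.mem_singleton]
    split_ifs with h
    · rw [Finset.mem_singleton, and_iff_left_iff_imp]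
      rintro rfl j
      rw [nodesAt_zero (subset_range_two_pow (hT j)) (h j)]
      simp
    · simp only [Finset.notMem_empty, iff_false, not_and]
      intro _ h'
      refine h fun j => ?_
      have := h' j
      rw [nodesAt, Finset.mem_image] at this
      exact ⟨_, this.choose_spec.1⟩
  rw [levelList, h]
  split_ifs <;> simp

theorem levelList_succ (hk : 1 ≤ k) (hT : ∀ j, T j ⊆ Finset.range u) {d : ℕ}
    (hd : d < codeLength u) :
    levelList (codeLength u) T (d + 1) =
      ((List.range (2 * (levelList (codeLength u) T d).length)).map
        (candidate (levelList (codeLength u) T d))).filter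
          (· ∈ commonNodes (codeLength u) T (d + 1)) := by
  set L := levelList (codeLength u) T d with hL
  have hLs : L.Pairwise (· < ·) := (Finset.sortedLT_sort _).pairwise
  set l := ((List.range (2 * L.length)).map (candidate L)).filter
    (· ∈ commonNodes (codeLength u) T (d + 1)) with hl
  have hs : l.Pairwise (· < ·) := by
    refine List.Pairwise.filter _ (List.pairwise_map.2 ?_)
    refine (List.pairwise_lt_range (n := 2 * L.length)).imp_of_mem ?_
    intro e e' he he' hlt
    rw [List.mem_range] at he he'
    unfold candidate
    rcases eq_or_lt_of_le (Nat.div_le_div_right (c := 2) hlt.le) with h | h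
    · rw [h]; omega
    · have h1 : e / 2 < L.length := by omega
      have h2 : e' / 2 < L.length := by omega
      have h3 := List.pairwise_iff_getElem.1 hLs _ _ h1 h2 h
      rw [List.getD_eq_getElem _ _ h1, List.getD_eq_getElem _ _ h2]
      omega
  have hf : l.toFinset = commonNodes (codeLength u) T (d + 1) := by
    ext c
    rw [List.mem_toFinset, hl, List.mem_filter, List.mem_map]
    simp only [decide_eq_true_eq, and_iff_right_iff_imp]
    intro hc
    rw [mem_commonNodes hk hT hd] at hc
    have hp : c / 2 ∈ L := by
      rw [hL, levelList, Finset.mem_sort, mem_commonNodes hk hT hd.le]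
      exact fun j => parent_mem_nodesAt hd (hc j)
    obtain ⟨a, ha, hac⟩ := List.getElem_of_mem hp
    refine ⟨2 * a + c % 2, by rw [List.mem_range]; omega, ?_⟩
    have h1 : (2 * a + c % 2) / 2 = a := by omega
    rw [candidate, h1, List.getD_eq_getElem _ _ ha, hac]
    omega
  rw [levelList, ← hf]
  exact (List.toFinset_sort _ (hs.imp fun h => h.ne)).2 (hs.imp fun h => h.le)

end Common

/-! ### The intersection program: extending one node -/

/-- The arguments of an intersection query. -/
def queryArgs {N k : ℕ} (q : Fin k ↪ Fin N) : List ℕ := List.ofFn fun j => (q j : ℕ)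

/-- The data of an intersection query: the representations, and enough free memory for two levels
of the common trie. -/
structure Setting (w u : ℕ) {N k : ℕ} (S : Fin N → Finset ℕ) (E : Fin N → List Bool)
    (q : Fin k ↪ Fin N) : Prop where
  two_le_w : 2 ≤ w
  one_le_u : 1 ≤ u
  one_le_k : 1 ≤ k
  subset : ∀ i, S i ⊆ Finset.range u
  encoding : ∀ i, E i = auxBits (trieBits u (S i)) (decide (S i).Nonempty) ++ trieBits u (S i)
  fits : Fits w u E (queryArgs q)
  room : freeBase w E (queryArgs q) + 2 * (u + 1) + 2 * ((u + 1) * k) ≤ 2 ^ w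

/-- Query the representation of the `idx`-th argument at position `pos`. -/
def fetch (idx pos : Expr) : List Stmt :=
  .set 20 (.load (reg 5 + idx)) :: .set 21 pos :: queryCode

section Fetch

variable {w u N k : ℕ} {S : Fin N → Finset ℕ} {E : Fin N → List Bool} {q : Fin k ↪ Fin N}

theorem Setting.lt_two_pow (st : Setting w u S E q) : 2 * (u + 1) + k + k * u < 2 ^ w := by
  have h1 := st.room
  have h2 : N + 1 ≤ freeBase w E (queryArgs q) :=
    (Nat.le_add_right _ _).trans (Nat.le_add_right _ _)
  have h3 : (u + 1) * k = k * u + k := by ring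
  omega

theorem Setting.after_fetch (st : Setting w u S E q) {s : State w}
    (h : Loaded w u E (queryArgs q) s) (j : Fin k) {idx pos : Expr} {p : ℕ} (hidx : Ev s idx j)
    (hpos : ∀ v, Ev (s.setReg 20 v) pos p) (hp : p ≤ (trieBits u (S (q j))).length) :
    After (fetch idx pos) s
      (QueryResult 20 (trieBits u (S (q j))) (decide (S (q j)).Nonempty) p s) := by
  have harg := h.arguments j (by simp [queryArgs])
  refine After.set (v := q j) (Ev.load (Ev.add (Ev.var h.reg_args) hidx) ?_) ?_
  · rw [harg]
    simp [queryArgs]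
  replace h := h.setReg (x := 20) (by norm_num) (BitVec.ofNat w (q j))
  refine After.set (hpos _) ?_
  replace h := h.setReg (x := 21) (by norm_num) (BitVec.ofNat w p)
  have heven : (trieBits u (S (q j))).length % 2 = 0 := by rw [length_trieBits]; omega
  refine (after_queryCode h st.two_le_w st.fits.2.1 (q j) _ _ (st.encoding _) heven hp rfl
    rfl).mono fun s' hs' => ⟨fun r hr => ?_, hs'.mem_eq, hs'.rank, hs'.bit, hs'.count, hs'.length⟩
  rw [hs'.reg_eq r (by omega), setReg_reg_of_ne (by omega), setReg_reg_of_ne (by omega)]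

theorem Loaded.reg_three {s : State w} (h : Loaded w u E (queryArgs q) s) :
    s.reg 3 = BitVec.ofNat w k := by
  rw [h.reg_argCount]
  simp [queryArgs]

end Fetch

/-- The test `R[11] < k` of a loop over the arguments. -/
def argTest : Expr := .bin .lt (reg 11) (reg 3)

/-- Look up the child `R[10] % 2` of the node `R[10] / 2` in the trie `R[11]`: its index goes to
the free slot `R[9]` of the next level, and `R[12]` is cleared if it does not exist. -/
def childBody : List Stmt :=
  fetch (reg 11) (2 * .load (reg 15 + reg 10 / 2 * reg 3 + reg 11) + reg 10 % 2) ++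
    [.put (reg 16 + reg 9 * reg 3 + reg 11) (reg 33 + 1),
     .set 12 (reg 12 * reg 34),
     .set 11 (reg 11 + 1)]

/-- Look up the child in all tries. -/
def childLoop : Prog := whileLoop argTest (block childBody)

/-- A bound for the time of any of the straight-line pieces of the intersection program. -/
def stepCost : ℕ := 2000

/-- A level of common nodes in memory: their numbers from address `X` on, and `k` indices per node
from address `G` on. -/
structure StoredLevel {w : ℕ} (ℓ : ℕ) {k : ℕ} (T : Fin k → Finset ℕ) (X G d : ℕ) (L : List ℕ)
    (s : State w) : Prop where
  node : ∀ a (h : a < L.length), s.cell (X + a) = BitVec.ofNat w L[a]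
  index : ∀ a (h : a < L.length) (j : Fin k),
    s.cell (G + (a * k + j)) = BitVec.ofNat w (nodeIndex ℓ (T j) d L[a])

section Child

variable {w u N k : ℕ} {S : Fin N → Finset ℕ} {E : Fin N → List Bool} {q : Fin k ↪ Fin N}

/-- The state after `i` iterations of `childLoop`, started in `s₁`, for the child `c` at depth `d`;
the slot for its indices starts at address `D`. -/
structure ChildInv {w : ℕ} (ℓ : ℕ) {k : ℕ} (T : Fin k → Finset ℕ) (d c D : ℕ) (s₁ : State w)
    (i : ℕ) (s : State w) : Prop where
  reg_eq : ∀ r < 20, r ≠ 11 → r ≠ 12 → s.reg r = s₁.reg r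
  counter : s.reg 11 = BitVec.ofNat w i
  exists_all : s.reg 12 =
    BitVec.ofNat w (if ∀ j : Fin k, j < i → c ∈ nodesAt ℓ (T j) d then 1 else 0)
  cell_eq : ∀ b < 2 ^ w, (b < D ∨ D + k ≤ b) → s.cell b = s₁.cell b
  index : ∀ j : Fin k, j < i → s.cell (D + j) = BitVec.ofNat w (nodeIndex ℓ (T j) d c)

theorem forall_lt_succ_iff {i : ℕ} (hi : i < k) (P : Fin k → Prop) :
    (∀ j : Fin k, j < i + 1 → P j) ↔ (∀ j : Fin k, j < i → P j) ∧ P ⟨i, hi⟩ := by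
  constructor
  · exact fun h => ⟨fun j hj => h j (by omega), h ⟨i, hi⟩ (Nat.lt_succ_self i)⟩
  · rintro ⟨h1, h2⟩ j hj
    rcases Nat.lt_or_eq_of_le (Nat.le_of_lt_succ hj) with h | h
    · exact h1 j h
    · obtain rfl : j = ⟨i, hi⟩ := Fin.ext h
      exact h2

theorem Setting.runs_childLoop (st : Setting w u S E q) {s₁ : State w}
    (h : Loaded w u E (queryArgs q) s₁) {d e n X G G' : ℕ} {L : List ℕ}
    (hd : d < codeLength u) (hL : ∀ v ∈ L, ∀ j, v ∈ nodesAt (codeLength u) (S (q j)) d)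
    (he : e < 2 * L.length)
    (hstored : StoredLevel (codeLength u) (fun j => S (q j)) X G d L s₁)
    (h9 : s₁.reg 9 = BitVec.ofNat w n) (h10 : s₁.reg 10 = BitVec.ofNat w e)
    (h15 : s₁.reg 15 = BitVec.ofNat w G) (h16 : s₁.reg 16 = BitVec.ofNat w G')
    (h11 : s₁.reg 11 = BitVec.ofNat w 0) (h12 : s₁.reg 12 = BitVec.ofNat w 1)
    (hL_len : L.length ≤ u)
    (hfree : freeBase w E (queryArgs q) ≤ G') (hend : G' + (n * k + k) ≤ 2 ^ w)
    (hGend : G + L.length * k ≤ 2 ^ w)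
    (hdisj : G + L.length * k ≤ G' + n * k ∨ G' + n * k + k ≤ G) :
    Runs childLoop s₁ (3 * stepCost * k)
      (ChildInv (codeLength u) (fun j => S (q j)) (d + 1) (candidate L e) (G' + n * k) s₁ k) := by
  set ℓ := codeLength u with hℓ
  set c := candidate L e with hc
  set D := G' + n * k with hD
  have hk := st.one_le_k
  have hroom := st.lt_two_pow
  have ha : e / 2 < L.length := by omega
  have hcand : c = 2 * L[e / 2] + e % 2 := by
    rw [hc, candidate, List.getD_eq_getElem _ _ ha]
  have hloop := Runs.whileLoop (p := block childBody) (e := argTest) (s := s₁) (by decide) k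
    (ChildInv ℓ (fun j => S (q j)) (d + 1) c D s₁) (fun _ => blockCost childBody) ?_ ?_ ?_
  · refine hloop.mono ?_ fun s' hs' => hs'
    have h1 : blockCost childBody ≤ 1000 := by decide
    have h2 : argTest.cost = 3 := rfl
    rw [Finset.sum_const, Finset.card_range, smul_eq_mul, h2]
    unfold stepCost
    nlinarith
  · intro i hi s hs
    have hs3 : s.reg 3 = BitVec.ofNat w k := (hs.reg_eq 3 (by omega) (by omega) (by omega)).trans
      h.reg_three
    have hload : Loaded w u E (queryArgs q) s :=
      h.congr st.fits (fun r hr => hs.reg_eq r (by omega) (by omega) (by omega))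
        fun a ha => hs.cell_eq a (by have := st.fits.2.2.1; omega) (by omega)
    refine ⟨Ev.lt_ne_zero (Ev.var hs.counter) (Ev.var hs3) (by omega) hi, Runs.block (by decide) ?_⟩
    set j : Fin k := ⟨i, hi⟩ with hj
    have hv := hL _ (List.getElem_mem ha) j
    obtain ⟨hbit, hrank⟩ := trieBits_child (st.subset (q j)) hd hv (Nat.mod_lt e (by norm_num))
    rw [← hℓ] at hbit hrank
    set g := nodeIndex ℓ (S (q j)) d L[e / 2] with hg
    have hplt : 2 * g + e % 2 < (trieBits u (S (q j))).length :=
      (List.getElem?_eq_some_iff.1 hbit).1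
    have hak : e / 2 * k + k ≤ L.length * k := by
      have := Nat.mul_le_mul_right k ha
      rw [Nat.succ_mul] at this; exact this
    have hgcell : s.cell (G + (e / 2 * k + i)) = BitVec.ofNat w g := by
      rw [hs.cell_eq _ (by omega) (by omega)]
      exact hstored.index (e / 2) ha j
    have hpos : ∀ v, Ev (s.setReg 20 v)
        (2 * .load (reg 15 + reg 10 / 2 * reg 3 + reg 11) + reg 10 % 2) (2 * g + e % 2) := by
      intro v
      have r10 : Ev (s.setReg 20 v) (reg 10) e :=
        (hs.reg_eq 10 (by omega) (by omega) (by omega)).trans h10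
      have r15 : Ev (s.setReg 20 v) (reg 15) G :=
        (hs.reg_eq 15 (by omega) (by omega) (by omega)).trans h15
      have r3 : Ev (s.setReg 20 v) (reg 3) k := hs3
      have r11 : Ev (s.setReg 20 v) (reg 11) i := hs.counter
      refine Ev.add (Ev.mul (Ev.const 2) (Ev.load (x := G + (e / 2 * k + i)) ?_ hgcell))
        (Ev.mod r10 (Ev.const 2) (by omega) (by omega))
      exact (Ev.add (Ev.add r15 (Ev.mul (Ev.div r10 (Ev.const 2) (by omega) (by omega))
        r3)) r11).cast (by omega)
    refine After.append ((st.after_fetch hload j (Ev.var hs.counter) hpos hplt.le).mono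
      fun s' hs' => ?_)
    have hr' : ∀ r < 20, r ≠ 11 → r ≠ 12 → s'.reg r = s₁.reg r := fun r hr h1 h2 =>
      (hs'.reg_eq r hr).trans (hs.reg_eq r hr h1 h2)
    have hcell' : ∀ b, s'.cell b = s.cell b := fun b => by rw [State.cell, hs'.mem_eq, State.cell]
    have hD' : D + i < 2 ^ w := by omega
    refine After.put (x := D + i) (v := nodeIndex ℓ (S (q j)) (d + 1) c) ?_ ?_ ?_
    · exact (Ev.add (Ev.add (Ev.var ((hr' 16 (by omega) (by omega) (by omega)).trans h16))
        (Ev.mul (Ev.var ((hr' 9 (by omega) (by omega) (by omega)).trans h9))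
          (Ev.var ((hs'.reg_eq 3 (by omega)).trans hs3))))
        (Ev.var ((hs'.reg_eq 11 (by omega)).trans hs.counter)))
    · rw [hcand, ← hrank]
      exact Ev.add (Ev.var hs'.rank) (Ev.const 1)
    refine After.set (Ev.mul (Ev.var ((hs'.reg_eq 12 (by omega)).trans hs.exists_all))
      (Ev.var (hs'.bit _ hbit))) ?_
    refine After.set (Ev.add (Ev.var ((hs'.reg_eq 11 (by omega)).trans hs.counter))
      (Ev.const 1)) ?_
    refine After.nil ⟨fun r hr h1 h2 => ?_, rfl, ?_, fun b hb hbD => ?_, fun j' hj' => ?_⟩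
    · rw [setReg_reg_of_ne h1, setReg_reg_of_ne h2]
      exact hr' r hr h1 h2
    · rw [setReg_reg_of_ne (by omega)]
      change BitVec.ofNat w _ = _
      congr 1
      simp only [forall_lt_succ_iff hi, ← hcand, ← hj]
      by_cases h1 : ∀ j : Fin k, ↑j < i → c ∈ nodesAt ℓ (S (q j)) (d + 1) <;>
        by_cases h2 : c ∈ nodesAt ℓ (S (q j)) (d + 1) <;> simp [h1, h2]
    · rw [cell_setReg, cell_setReg, cell_setMem hD' hb, if_neg (by omega), hcell']
      exact hs.cell_eq b hb hbD
    · rw [cell_setReg, cell_setReg, cell_setMem hD' (by omega)]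
      split_ifs with h1
      · obtain rfl : j' = j := Fin.ext (by simp [hj]; omega)
        rfl
      · rw [hcell']
        exact hs.index j' (by omega)
  · intro s hs
    have hs3 : s.reg 3 = BitVec.ofNat w k := (hs.reg_eq 3 (by omega) (by omega) (by omega)).trans
      h.reg_three
    exact Ev.lt_eq_zero (Ev.var hs.counter) (Ev.var hs3) (by omega) le_rfl
  · exact ⟨fun _ _ _ _ => rfl, h11, by simpa using h12, fun _ _ _ => rfl,
      fun j hj => absurd hj (Nat.not_lt_zero _)⟩

end Child

/-! ### The intersection program: one level -/

/-- Add the child `R[10]` to the next level if it exists in all tries: the free slot `R[9]`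
receives it in any case, but is kept only then. -/
def candidateBody : Prog :=
  .seq (block [.set 12 1, .set 11 0]) (.seq childLoop (block
    [.put (reg 14 + reg 9) (2 * .load (reg 13 + reg 10 / 2) + reg 10 % 2),
     .set 9 (reg 9 + reg 12),
     .set 10 (reg 10 + 1)]))

/-- Run through all children of the nodes of a level. -/
def candidateLoop : Prog := whileLoop (.bin .lt (reg 10) (2 * reg 8)) candidateBody

/-- The common nodes among the first `e` children of the nodes in `L`. -/
def accepted (ℓ : ℕ) {k : ℕ} (T : Fin k → Finset ℕ) (d : ℕ) (L : List ℕ) (e : ℕ) : List ℕ :=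
  ((List.range e).map (candidate L)).filter (· ∈ commonNodes ℓ T (d + 1))

/-- Four arrays in free memory: two for at most `U` nodes and two for at most `K` indices. -/
structure Layout (F U K M X X' G G' : ℕ) : Prop where
  ge_X : F ≤ X
  ge_X' : F ≤ X'
  ge_G : F ≤ G
  ge_G' : F ≤ G'
  le_X : X + U ≤ M
  le_X' : X' + U ≤ M
  le_G : G + K ≤ M
  le_G' : G' + K ≤ M
  X_X' : X + U ≤ X' ∨ X' + U ≤ X
  G_G' : G + K ≤ G' ∨ G' + K ≤ G
  X_G : X + U ≤ G ∨ G + K ≤ X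
  X_G' : X + U ≤ G' ∨ G' + K ≤ X
  X'_G : X' + U ≤ G ∨ G + K ≤ X'
  X'_G' : X' + U ≤ G' ∨ G' + K ≤ X'

theorem Layout.swap {F U K M X X' G G' : ℕ} (h : Layout F U K M X X' G G') :
    Layout F U K M X' X G' G :=
  ⟨h.ge_X', h.ge_X, h.ge_G', h.ge_G, h.le_X', h.le_X, h.le_G', h.le_G, h.X_X'.symm, h.G_G'.symm,
    h.X'_G', h.X'_G, h.X_G', h.X_G⟩

section StoredLevel

variable {w ℓ k X G d : ℕ} {T : Fin k → Finset ℕ} {L : List ℕ} {s s' : State w}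

theorem mul_add_lt_mul {a n k j : ℕ} (ha : a < n) (hj : j < k) : a * k + j < n * k := by
  have := Nat.mul_le_mul_right k ha
  rw [Nat.succ_mul] at this
  omega

theorem StoredLevel.nil : StoredLevel ℓ T X G d [] s :=
  ⟨fun _ h => absurd h (Nat.not_lt_zero _), fun _ h => absurd h (Nat.not_lt_zero _)⟩

theorem StoredLevel.congr (h : StoredLevel ℓ T X G d L s)
    (hX : ∀ b, X ≤ b → b < X + L.length → s'.cell b = s.cell b)
    (hG : ∀ b, G ≤ b → b < G + L.length * k → s'.cell b = s.cell b) :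
    StoredLevel ℓ T X G d L s' := by
  refine ⟨fun a ha => ?_, fun a ha j => ?_⟩
  · rw [hX _ (by omega) (by omega), h.node a ha]
  · have := mul_add_lt_mul ha j.2
    rw [hG _ (by omega) (by omega), h.index a ha j]

theorem StoredLevel.snoc {c : ℕ} (h : StoredLevel ℓ T X G d L s)
    (hX : s.cell (X + L.length) = BitVec.ofNat w c)
    (hG : ∀ j : Fin k, s.cell (G + (L.length * k + j)) = BitVec.ofNat w (nodeIndex ℓ (T j) d c)) :
    StoredLevel ℓ T X G d (L ++ [c]) s := by
  refine ⟨fun a ha => ?_, fun a ha j => ?_⟩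
  · rw [List.getElem_append]
    split_ifs with h1
    · exact h.node a h1
    · obtain rfl : a = L.length := by simp at ha; omega
      simpa using hX
  · rw [List.getElem_append]
    split_ifs with h1
    · exact h.index a h1 j
    · obtain rfl : a = L.length := by simp at ha; omega
      simpa using hG j

end StoredLevel

section Level

variable {w u N k : ℕ} {S : Fin N → Finset ℕ} {E : Fin N → List Bool} {q : Fin k ↪ Fin N}

theorem accepted_succ (ℓ : ℕ) (T : Fin k → Finset ℕ) (d : ℕ) (L : List ℕ) (e : ℕ) :
    accepted ℓ T d L (e + 1) = accepted ℓ T d L e ++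
      if candidate L e ∈ commonNodes ℓ T (d + 1) then [candidate L e] else [] := by
  simp only [accepted, List.range_succ, List.map_append, List.filter_append, List.map_cons,
    List.map_nil, List.filter_cons, List.filter_nil, decide_eq_true_eq]

theorem length_levelList_le (hk : 1 ≤ k) {T : Fin k → Finset ℕ} (hT : ∀ j, T j ⊆ Finset.range u)
    (d : ℕ) : (levelList (codeLength u) T d).length ≤ u := by
  rw [levelList, Finset.length_sort]
  exact card_commonNodes_le hk hT d

theorem length_accepted_le (hk : 1 ≤ k) {T : Fin k → Finset ℕ} (hT : ∀ j, T j ⊆ Finset.range u)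
    {d : ℕ} (hd : d < codeLength u) {e : ℕ} (he : e ≤ 2 * (levelList (codeLength u) T d).length) :
    (accepted (codeLength u) T d (levelList (codeLength u) T d) e).length ≤ u := by
  refine le_trans ?_ (length_levelList_le hk hT (d + 1))
  rw [levelList_succ hk hT hd]
  exact (((List.range_sublist.2 he).map _).filter _).length_le

/-- The state after `e` iterations of `candidateLoop`, started in `s₁`. -/
structure CandidateInv {w : ℕ} (ℓ : ℕ) {k : ℕ} (T : Fin k → Finset ℕ) (U K d X' G' : ℕ)
    (L : List ℕ) (s₁ : State w) (e : ℕ) (s : State w) : Prop where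
  reg_eq : ∀ r < 20, r ∉ [9, 10, 11, 12] → s.reg r = s₁.reg r
  slot : s.reg 9 = BitVec.ofNat w (accepted ℓ T d L e).length
  counter : s.reg 10 = BitVec.ofNat w e
  cell_eq : ∀ b < 2 ^ w, (b < X' ∨ X' + U ≤ b) → (b < G' ∨ G' + K ≤ b) → s.cell b = s₁.cell b
  next : StoredLevel ℓ T X' G' (d + 1) (accepted ℓ T d L e) s

theorem Setting.runs_candidateBody (st : Setting w u S E q) {s₁ s : State w}
    (h : Loaded w u E (queryArgs q) s₁) {d e X X' G G' : ℕ} {L : List ℕ}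
    (hd : d < codeLength u) (hL : L = levelList (codeLength u) (fun j => S (q j)) d)
    (hlay : Layout (freeBase w E (queryArgs q)) (u + 1) ((u + 1) * k) (2 ^ w) X X' G G')
    (hstored : StoredLevel (codeLength u) (fun j => S (q j)) X G d L s₁)
    (h13 : s₁.reg 13 = BitVec.ofNat w X) (h14 : s₁.reg 14 = BitVec.ofNat w X')
    (h15 : s₁.reg 15 = BitVec.ofNat w G) (h16 : s₁.reg 16 = BitVec.ofNat w G')
    (he : e < 2 * L.length)
    (hs : CandidateInv (codeLength u) (fun j => S (q j)) (u + 1) ((u + 1) * k) d X' G' L s₁ e s) :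
    Runs candidateBody s (5 * stepCost * k)
      (CandidateInv (codeLength u) (fun j => S (q j)) (u + 1) ((u + 1) * k) d X' G' L s₁
        (e + 1)) := by
  set ℓ := codeLength u with hℓ
  set T : Fin k → Finset ℕ := fun j => S (q j) with hT
  have hk := st.one_le_k
  have hsub : ∀ j, T j ⊆ Finset.range u := fun j => st.subset (q j)
  have hroom := st.lt_two_pow
  have hLlen : L.length ≤ u := hL ▸ length_levelList_le hk hsub d
  have hacc : (accepted ℓ T d L e).length ≤ u := by
    rw [hL] at he ⊢
    exact length_accepted_le hk hsub hd he.le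
  set n := (accepted ℓ T d L e).length with hn
  set c := candidate L e with hc
  have hKn : n * k + k ≤ (u + 1) * k := by
    rw [← Nat.succ_mul]; exact Nat.mul_le_mul_right k (by omega)
  have hKL : L.length * k ≤ (u + 1) * k := Nat.mul_le_mul_right k (by omega)
  have ha : e / 2 < L.length := by omega
  have hcand : c = 2 * L[e / 2] + e % 2 := by
    rw [hc, candidate, List.getD_eq_getElem _ _ ha]
  have hload : Loaded w u E (queryArgs q) s := by
    refine h.congr st.fits (fun r hr => hs.reg_eq r (by omega) (by simp; omega)) fun a ha => ?_
    have := hlay.ge_X'; have := hlay.ge_G'; have := hlay.le_X'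
    exact hs.cell_eq a (by omega) (by omega) (by omega)
  -- only the arrays of the next level have been written to
  have hcur : StoredLevel ℓ T X G d L s := by
    have := hlay.X_X'; have := hlay.X_G'; have := hlay.X'_G; have := hlay.G_G'
    have := hlay.le_X; have := hlay.le_G
    exact hstored.congr (fun b h1 h2 => hs.cell_eq b (by omega) (by omega) (by omega))
      (fun b h1 h2 => hs.cell_eq b (by omega) (by omega) (by omega))
  set s₂ := (s.setReg 12 (BitVec.ofNat w 1)).setReg 11 (BitVec.ofNat w 0) with hs₂
  have hload₂ : Loaded w u E (queryArgs q) s₂ :=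
    (hload.setReg (by norm_num) _).setReg (by norm_num) _
  have hreg₂ : ∀ r < 20, r ∉ [9, 10, 11, 12] → s₂.reg r = s₁.reg r := by
    intro r hr hr'
    simp only [List.mem_cons, List.not_mem_nil, or_false, not_or] at hr'
    rw [hs₂, setReg_reg_of_ne hr'.2.2.1, setReg_reg_of_ne hr'.2.2.2]
    exact hs.reg_eq r hr (by simp [hr'])
  have hchild : Runs childLoop s₂ (3 * stepCost * k)
      (ChildInv ℓ T (d + 1) c (G' + n * k) s₂ k) := by
    refine st.runs_childLoop hload₂ hd (fun v hv => ?_) he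
      (hcur.congr (fun _ _ _ => rfl) fun _ _ _ => rfl) hs.slot
      hs.counter ((hreg₂ 15 (by omega) (by simp)).trans h15)
      ((hreg₂ 16 (by omega) (by simp)).trans h16) rfl rfl hLlen hlay.ge_G' ?_ ?_ ?_
    · rw [hL, levelList, Finset.mem_sort] at hv
      exact (mem_commonNodes hk hsub hd.le).1 hv
    · have := hlay.le_G'; omega
    · have := hlay.le_G; omega
    · have := hlay.G_G'; omega
  have hinit : Runs (block [.set 12 1, .set 11 0]) s
      (blockCost [.set 12 1, .set 11 0]) (fun s' => s' = s₂) :=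
    Runs.block (by decide) (After.set (Ev.const 1) (After.set (Ev.const 0) (After.nil rfl)))
  refine Runs.mono (Runs.seq hinit fun s' hs' => ?_) (T := 4 + (3 * stepCost * k + 30)) ?_
    fun _ => id
  swap
  · unfold stepCost; omega
  subst hs'
  refine Runs.seq hchild fun s₃ hs₃ => Runs.mono (Runs.block (by decide) ?_)
    (show _ ≤ 30 by decide) fun _ => id
  have hreg₃ : ∀ r < 20, r ∉ [9, 10, 11, 12] → s₃.reg r = s₁.reg r := by
    intro r hr hr'
    have h1 := hr'
    simp only [List.mem_cons, List.not_mem_nil, or_false, not_or] at h1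
    exact (hs₃.reg_eq r hr h1.2.2.1 h1.2.2.2).trans (hreg₂ r hr hr')
  have h9 : s₃.reg 9 = BitVec.ofNat w n :=
    (hs₃.reg_eq 9 (by omega) (by omega) (by omega)).trans hs.slot
  have h10 : s₃.reg 10 = BitVec.ofNat w e :=
    (hs₃.reg_eq 10 (by omega) (by omega) (by omega)).trans hs.counter
  have hcell₃ : ∀ b < 2 ^ w, (b < G' + n * k ∨ G' + n * k + k ≤ b) → s₃.cell b = s.cell b :=
    fun b hb hb' => hs₃.cell_eq b hb hb'
  have hXn : X' + n < 2 ^ w := by have := hlay.le_X'; omega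
  refine After.put (x := X' + n) (v := c) ?_ ?_ ?_
  · exact Ev.add (Ev.var ((hreg₃ 14 (by omega) (by simp)).trans h14)) (Ev.var h9)
  · rw [hcand]
    refine Ev.add (Ev.mul (Ev.const 2) (Ev.load (x := X + e / 2) ?_ ?_))
      (Ev.mod (Ev.var h10) (Ev.const 2) (by omega) (by omega))
    · exact Ev.add (Ev.var ((hreg₃ 13 (by omega) (by simp)).trans h13))
        (Ev.div (Ev.var h10) (Ev.const 2) (by omega) (by omega))
    · have := hlay.X_G'; have := hlay.le_X
      rw [hcell₃ _ (by omega) (by omega)]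
      exact hcur.node _ ha
  refine After.set (Ev.add (Ev.var h9) (Ev.var hs₃.exists_all)) ?_
  refine After.set (Ev.add (Ev.var h10) (Ev.const 1)) ?_
  set s₄ := s₃.setMem (BitVec.ofNat w (X' + n)) (BitVec.ofNat w c) with hs₄
  have hcell₄ : ∀ b < 2 ^ w, s₄.cell b = if b = X' + n then BitVec.ofNat w c else s₃.cell b :=
    fun b hb => cell_setMem hXn hb _
  have hmem : c ∈ commonNodes ℓ T (d + 1) ↔ ∀ j : Fin k, ↑j < k → c ∈ nodesAt ℓ (T j) (d + 1) := by
    rw [hℓ, mem_commonNodes hk hsub hd]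
    exact ⟨fun h j _ => h j, fun h j => h j j.2⟩
  have hX'G' := hlay.X'_G'
  have hleG' := hlay.le_G'
  have hleX' := hlay.le_X'
  have hold : StoredLevel ℓ T X' G' (d + 1) (accepted ℓ T d L e) s₄ := by
    refine hs.next.congr (fun b h1 h2 => ?_) fun b h1 h2 => ?_
    · rw [hcell₄ b (by omega), if_neg (by omega), hcell₃ b (by omega) (by omega)]
    · rw [← hn] at h2
      rw [hcell₄ b (by omega), if_neg (by omega), hcell₃ b (by omega) (by omega)]
  refine After.nil ⟨fun r hr hr' => ?_, ?_, rfl, fun b hb h1 h2 => ?_, ?_⟩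
  · have h1 := hr'
    simp only [List.mem_cons, List.not_mem_nil, or_false, not_or] at h1
    rw [setReg_reg_of_ne h1.2.1, setReg_reg_of_ne h1.1]
    exact hreg₃ r hr hr'
  · rw [setReg_reg_of_ne (by omega)]
    change BitVec.ofNat w _ = _
    congr 1
    rw [accepted_succ, List.length_append, ← hn]
    simp only [← hmem]
    split_ifs <;> rfl
  · rw [cell_setReg, cell_setReg, hcell₄ b hb, if_neg (by omega), hcell₃ b hb (by omega)]
    exact hs.cell_eq b hb h1 h2
  · rw [accepted_succ]
    have hfinal : StoredLevel ℓ T X' G' (d + 1) (accepted ℓ T d L e ++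
        if c ∈ commonNodes ℓ T (d + 1) then [c] else []) s₄ := by
      split_ifs with h1
      · refine hold.snoc ?_ fun j => ?_
        · rw [← hn, hcell₄ _ hXn, if_pos rfl]
        · have hj := j.2
          rw [← hn, hcell₄ _ (by omega), if_neg (by omega), ← add_assoc]
          exact hs₃.index j j.2
      · rwa [List.append_nil]
    exact hfinal.congr (fun _ _ _ => rfl) fun _ _ _ => rfl

theorem Setting.runs_candidateLoop (st : Setting w u S E q) {s₁ : State w}
    (h : Loaded w u E (queryArgs q) s₁) {d X X' G G' : ℕ} {L : List ℕ}
    (hd : d < codeLength u) (hL : L = levelList (codeLength u) (fun j => S (q j)) d)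
    (hlay : Layout (freeBase w E (queryArgs q)) (u + 1) ((u + 1) * k) (2 ^ w) X X' G G')
    (hstored : StoredLevel (codeLength u) (fun j => S (q j)) X G d L s₁)
    (h8 : s₁.reg 8 = BitVec.ofNat w L.length)
    (h9 : s₁.reg 9 = BitVec.ofNat w 0) (h10 : s₁.reg 10 = BitVec.ofNat w 0)
    (h13 : s₁.reg 13 = BitVec.ofNat w X) (h14 : s₁.reg 14 = BitVec.ofNat w X')
    (h15 : s₁.reg 15 = BitVec.ofNat w G) (h16 : s₁.reg 16 = BitVec.ofNat w G') :
    Runs candidateLoop s₁ (12 * stepCost * k * L.length + stepCost)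
      (CandidateInv (codeLength u) (fun j => S (q j)) (u + 1) ((u + 1) * k) d X' G' L s₁
        (2 * L.length)) := by
  have hk := st.one_le_k
  have hroom := st.lt_two_pow
  have hLlen : L.length ≤ u := hL ▸ length_levelList_le hk (fun j => st.subset (q j)) d
  have hloop := Runs.whileLoop (p := candidateBody) (e := .bin .lt (reg 10) (2 * reg 8))
    (s := s₁) (by decide) (2 * L.length)
    (CandidateInv (codeLength u) (fun j => S (q j)) (u + 1) ((u + 1) * k) d X' G' L s₁)
    (fun _ => 5 * stepCost * k) ?_ ?_ ?_
  · refine hloop.mono ?_ fun s' hs' => hs'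
    have h2 : (Expr.bin .lt (reg 10) (2 * reg 8)).cost = 5 := rfl
    rw [Finset.sum_const, Finset.card_range, smul_eq_mul, h2]
    have h3 : L.length ≤ k * L.length := Nat.le_mul_of_pos_left _ hk
    have h4 : 2 * L.length * (5 * stepCost * k + (5 + 1)) =
      10 * stepCost * (k * L.length) + 12 * L.length := by ring
    have h5 : 12 * stepCost * k * L.length = 12 * stepCost * (k * L.length) := by ring
    rw [h4, h5]
    unfold stepCost
    omega
  · intro e he s hs
    exact ⟨Ev.lt_ne_zero (Ev.var hs.counter) (Ev.mul (Ev.const 2)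
      (Ev.var ((hs.reg_eq 8 (by omega) (by simp)).trans h8))) (by omega) he,
      st.runs_candidateBody h hd hL hlay hstored h13 h14 h15 h16 he hs⟩
  · intro s hs
    exact Ev.lt_eq_zero (Ev.var hs.counter) (Ev.mul (Ev.const 2)
      (Ev.var ((hs.reg_eq 8 (by omega) (by simp)).trans h8))) (by omega) le_rfl
  · exact ⟨fun _ _ _ => rfl, by simpa [accepted] using h9, h10, fun _ _ _ _ => rfl,
      by simpa [accepted] using StoredLevel.nil⟩

/-! ### The intersection program: all levels -/

/-- Replace the current level by the next one. -/
def levelBody : Prog :=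
  .seq (block [.set 9 0, .set 10 0]) (.seq candidateLoop (block
    [.set 7 (2 * reg 7), .set 8 (reg 9),
     .set 17 (reg 13), .set 13 (reg 14), .set 14 (reg 17),
     .set 17 (reg 15), .set 15 (reg 16), .set 16 (reg 17)]))

/-- Descend to the leaves; `R[7] = 2 ^ d` at depth `d`. -/
def levelLoop : Prog := whileLoop (.bin .lt (reg 7) (reg 1)) levelBody

/-- The state when the common nodes at depth `d` have been computed, starting from `s₀`. -/
structure LevelInv {w : ℕ} (F u : ℕ) {k : ℕ} (T : Fin k → Finset ℕ) (s₀ : State w)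
    (d X X' G G' : ℕ) (s : State w) : Prop where
  reg_eq : ∀ r < 7, s.reg r = s₀.reg r
  cell_eq : ∀ a < F, s.cell a = s₀.cell a
  width : s.reg 7 = BitVec.ofNat w (2 ^ d)
  count : s.reg 8 = BitVec.ofNat w (levelList (codeLength u) T d).length
  layout : Layout F (u + 1) ((u + 1) * k) (2 ^ w) X X' G G'
  reg_X : s.reg 13 = BitVec.ofNat w X
  reg_X' : s.reg 14 = BitVec.ofNat w X'
  reg_G : s.reg 15 = BitVec.ofNat w G
  reg_G' : s.reg 16 = BitVec.ofNat w G'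
  stored : StoredLevel (codeLength u) T X G d (levelList (codeLength u) T d) s

theorem Setting.runs_levelBody (st : Setting w u S E q) {s₀ s : State w}
    (h : Loaded w u E (queryArgs q) s₀) {d X X' G G' : ℕ} (hd : d < codeLength u)
    (hs : LevelInv (freeBase w E (queryArgs q)) u (fun j => S (q j)) s₀ d X X' G G' s) :
    Runs levelBody s
      (12 * stepCost * k * (levelList (codeLength u) (fun j => S (q j)) d).length + 2 * stepCost)
      (LevelInv (freeBase w E (queryArgs q)) u (fun j => S (q j)) s₀ (d + 1) X' X G' G) := by
  set T : Fin k → Finset ℕ := fun j => S (q j) with hT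
  set L := levelList (codeLength u) T d with hL
  have hk := st.one_le_k
  have hsub : ∀ j, T j ⊆ Finset.range u := fun j => st.subset (q j)
  have hroom := st.lt_two_pow
  have hload : Loaded w u E (queryArgs q) s := h.congr st.fits hs.reg_eq hs.cell_eq
  set s₁ := (s.setReg 9 (BitVec.ofNat w 0)).setReg 10 (BitVec.ofNat w 0) with hs₁
  have hload₁ : Loaded w u E (queryArgs q) s₁ :=
    (hload.setReg (by norm_num) _).setReg (by norm_num) _
  have hinit : Runs (block [.set 9 0, .set 10 0]) s
      (blockCost [.set 9 0, .set 10 0]) (fun s' => s' = s₁) :=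
    Runs.block (by decide) (After.set (Ev.const 0) (After.set (Ev.const 0) (After.nil rfl)))
  have hloop := st.runs_candidateLoop hload₁ hd hL hs.layout
    (hs.stored.congr (fun _ _ _ => rfl) fun _ _ _ => rfl) hs.count rfl rfl hs.reg_X hs.reg_X'
    hs.reg_G hs.reg_G'
  refine Runs.mono (Runs.seq hinit fun s' hs' => ?_)
    (T := 4 + (12 * stepCost * k * L.length + stepCost + 30)) ?_ fun _ => id
  swap
  · unfold stepCost; omega
  subst hs'
  refine Runs.seq hloop fun s₂ hs₂ => Runs.mono (Runs.block (by decide) ?_)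
    (show _ ≤ 30 by decide) fun _ => id
  have hnext : accepted (codeLength u) T d L (2 * L.length) = levelList (codeLength u) T (d + 1) :=
    (levelList_succ hk hsub hd).symm
  have hreg₂ : ∀ r < 20, r ∉ [9, 10, 11, 12] → s₂.reg r = s.reg r := by
    intro r hr hr'
    have h1 := hr'
    simp only [List.mem_cons, List.not_mem_nil, or_false, not_or] at h1
    rw [hs₂.reg_eq r hr hr', hs₁, setReg_reg_of_ne h1.2.1, setReg_reg_of_ne h1.1]
  refine After.set (Ev.mul (Ev.const 2) (Ev.var ((hreg₂ 7 (by omega) (by simp)).trans hs.width))) ?_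
  refine After.set (Ev.var hs₂.slot) ?_
  refine After.set (Ev.var ((hreg₂ 13 (by omega) (by simp)).trans hs.reg_X)) ?_
  refine After.set (Ev.var ((hreg₂ 14 (by omega) (by simp)).trans hs.reg_X')) ?_
  refine After.set (Ev.var rfl) ?_
  refine After.set (Ev.var ((hreg₂ 15 (by omega) (by simp)).trans hs.reg_G)) ?_
  refine After.set (Ev.var ((hreg₂ 16 (by omega) (by simp)).trans hs.reg_G')) ?_
  refine After.set (Ev.var rfl) ?_
  refine After.nil ⟨fun r hr => ?_, fun a ha => ?_, ?_, ?_, hs.layout.swap, rfl, rfl, rfl, rfl, ?_⟩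
  · repeat rw [setReg_reg_of_ne (by omega)]
    exact (hreg₂ r (by omega) (by simp; omega)).trans (hs.reg_eq r hr)
  · have := hs.layout.ge_X'; have := hs.layout.ge_G'; have := st.fits.2.2.1
    exact (hs₂.cell_eq a (by omega) (by omega) (by omega)).trans (hs.cell_eq a ha)
  · rw [pow_succ']; rfl
  · rw [← hnext]; rfl
  · rw [← hnext]
    exact hs₂.next.congr (fun _ _ _ => rfl) fun _ _ _ => rfl

theorem Setting.runs_levelLoop (st : Setting w u S E q) {s₀ s : State w}
    (h : Loaded w u E (queryArgs q) s₀) {X X' G G' : ℕ}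
    (hs : LevelInv (freeBase w E (queryArgs q)) u (fun j => S (q j)) s₀ 0 X X' G G' s) :
    Runs levelLoop s (15 * stepCost * k * nodeBound u (fun j => S (q j)) + stepCost)
      (fun s' => ∃ X X' G G', LevelInv (freeBase w E (queryArgs q)) u (fun j => S (q j)) s₀
        (codeLength u) X X' G G' s') := by
  set T : Fin k → Finset ℕ := fun j => S (q j) with hT
  have hk := st.one_le_k
  have hsub : ∀ j, T j ⊆ Finset.range u := fun j => st.subset (q j)
  have hroom := st.lt_two_pow
  have hpow := two_pow_codeLength_lt st.one_le_u
  have hloop := Runs.whileLoop (p := levelBody) (e := .bin .lt (reg 7) (reg 1))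
    (s := s) (by decide) (codeLength u)
    (fun d s' => ∃ X X' G G', LevelInv (freeBase w E (queryArgs q)) u T s₀ d X X' G G' s')
    (fun d => 12 * stepCost * k * (levelList (codeLength u) T d).length + 2 * stepCost) ?_ ?_ ?_
  · refine hloop.mono ?_ fun s' hs' => hs'
    have h2 : (Expr.bin .lt (reg 7) (reg 1)).cost = 3 := rfl
    have h3 := codeLength_lt_nodeBound st.one_le_u T
    have h4 : ∑ d ∈ Finset.range (codeLength u), (levelList (codeLength u) T d).length ≤
        nodeBound u T := by
      refine le_trans ?_ (sum_card_commonNodes_le hk hsub)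
      simp only [levelList, Finset.length_sort]
      exact Finset.sum_le_sum_of_subset (Finset.range_mono (Nat.le_succ _))
    simp only [Finset.sum_add_distrib, ← Finset.mul_sum, Finset.sum_const, Finset.card_range,
      smul_eq_mul, h2]
    generalize ∑ d ∈ Finset.range (codeLength u), (levelList (codeLength u) T d).length = z at *
    generalize nodeBound u T = M at *
    have h5 : 12 * stepCost * k * z ≤ 12 * stepCost * k * M := Nat.mul_le_mul_left _ h4
    have h6 : M ≤ k * M := Nat.le_mul_of_pos_left _ hk
    have h7 : 15 * stepCost * k * M = 12 * stepCost * k * M + 3 * stepCost * (k * M) := by ring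
    unfold stepCost at *
    omega
  · rintro d hd s' ⟨X, X', G, G', hs'⟩
    have h1 : 2 ^ d < u := (Nat.lt_clog_iff_pow_lt (by norm_num)).1 hd
    have hload : Loaded w u E (queryArgs q) s' := h.congr st.fits hs'.reg_eq hs'.cell_eq
    refine ⟨Ev.lt_ne_zero (Ev.var hs'.width) (Ev.var hload.reg_universe) (by omega) h1, ?_⟩
    exact (st.runs_levelBody h hd hs').mono le_rfl fun s'' hs'' => ⟨_, _, _, _, hs''⟩
  · rintro s' ⟨X, X', G, G', hs'⟩
    have hload : Loaded w u E (queryArgs q) s' := h.congr st.fits hs'.reg_eq hs'.cell_eq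
    exact Ev.lt_eq_zero (Ev.var hs'.width) (Ev.var hload.reg_universe) (by omega)
      (le_two_pow_codeLength u)
  · exact ⟨_, _, _, _, hs⟩

end Level

/-! ### The intersection program: the root and the ranks -/

/-- Clear `R[12]` if the set number `R[11]` is empty, and store the index `0` of its root. -/
def rootBody : List Stmt :=
  fetch (reg 11) 0 ++
    [.set 12 (reg 12 * (reg 27 % 2)), .put (reg 15 + reg 11) 0, .set 11 (reg 11 + 1)]

/-- Lay out the arrays in free memory, and compute the level of the root. -/
def rootProgram : Prog :=
  .seq (block
    [.set 7 1, .set 13 (reg 6), .set 14 (reg 13 + (reg 1 + 1)), .set 15 (reg 14 + (reg 1 + 1)),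
     .set 16 (reg 15 + (reg 1 + 1) * reg 3), .put (reg 13) 0, .set 12 1, .set 11 0])
    (.seq (whileLoop argTest (block rootBody)) (block [.set 8 (reg 12)]))

/-- Replace the index of a leaf by the rank of its element: the leaves follow the inner nodes in
level order, and two bits are stored per inner node. -/
def rankBody : List Stmt :=
  fetch (reg 10 % reg 3) 0 ++
    [.put (reg 15 + reg 10) (.load (reg 15 + reg 10) + 1 - reg 28 / 2), .set 10 (reg 10 + 1)]

/-- Compute all ranks, and announce the result. -/
def rankAllProgram : Prog :=
  .seq (block [.set 10 0])
    (.seq (whileLoop (.bin .lt (reg 10) (reg 8 * reg 3)) (block rankBody))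
      (block [.set 0 (reg 8), .set 1 (reg 13), .set 2 (reg 15)]))

/-- The intersection program. -/
def interProgram : Prog := .seq rootProgram (.seq levelLoop rankAllProgram)

section Program

variable {w u N k : ℕ} {S : Fin N → Finset ℕ} {E : Fin N → List Bool} {q : Fin k ↪ Fin N}

theorem Setting.length_trieBits_lt (st : Setting w u S E q) (i : Fin N) :
    (trieBits u (S i)).length + 1 < 2 ^ w := by
  have h1 := startBit_add_length_le E i
  rw [st.encoding i, List.length_append, length_auxBits] at h1
  have h2 : 0 < auxLen (trieBits u (S i)).length := by
    unfold auxLen posBlock posSuper posTable posCount; omega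
  have := st.fits.2.1
  omega

theorem Setting.runs_rootProgram (st : Setting w u S E q) {s₀ : State w}
    (h : Loaded w u E (queryArgs q) s₀) :
    Runs rootProgram s₀ (5 * stepCost * k)
      (fun s' => ∃ X X' G G', LevelInv (freeBase w E (queryArgs q)) u (fun j => S (q j)) s₀
        0 X X' G G' s') := by
  set ℓ := codeLength u with hℓ
  set T : Fin k → Finset ℕ := fun j => S (q j) with hT
  set F := freeBase w E (queryArgs q) with hF
  have hk := st.one_le_k
  have hsub : ∀ j, T j ⊆ Finset.range u := fun j => st.subset (q j)
  have hroom := st.lt_two_pow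
  have hroom' := st.room
  have hK : (u + 1) * k = u * k + k := by ring
  set X := F with hX
  set X' := X + (u + 1) with hX'
  set G := X' + (u + 1) with hG
  set G' := G + (u + 1) * k with hG'
  have hlay : Layout F (u + 1) ((u + 1) * k) (2 ^ w) X X' G G' := by
    constructor <;> omega
  let R : State w → Prop := fun s => (∀ r < 7, s.reg r = s₀.reg r) ∧
    (∀ b < 2 ^ w, s.cell b = if b = X then BitVec.ofNat w 0 else s₀.cell b) ∧
    s.reg 7 = BitVec.ofNat w 1 ∧ s.reg 11 = BitVec.ofNat w 0 ∧ s.reg 12 = BitVec.ofNat w 1 ∧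
    s.reg 13 = BitVec.ofNat w X ∧ s.reg 14 = BitVec.ofNat w X' ∧ s.reg 15 = BitVec.ofNat w G ∧
    s.reg 16 = BitVec.ofNat w G'
  have hhead : Runs (block
    [.set 7 1, .set 13 (reg 6), .set 14 (reg 13 + (reg 1 + 1)), .set 15 (reg 14 + (reg 1 + 1)),
     .set 16 (reg 15 + (reg 1 + 1) * reg 3), .put (reg 13) 0, .set 12 1, .set 11 0]) s₀ 100 R := by
    refine Runs.mono (Runs.block (by decide) ?_) (show _ ≤ 100 by decide) fun _ => id
    refine After.set (Ev.const 1) ?_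
    refine After.set (Ev.var h.reg_free) ?_
    refine After.set (Ev.add (Ev.var rfl) (Ev.add (Ev.var h.reg_universe) (Ev.const 1))) ?_
    refine After.set (Ev.add (Ev.var rfl) (Ev.add (Ev.var h.reg_universe) (Ev.const 1))) ?_
    refine After.set (Ev.add (Ev.var rfl) (Ev.mul (Ev.add (Ev.var h.reg_universe) (Ev.const 1))
      (Ev.var h.reg_three))) ?_
    refine After.put (Ev.var rfl) (Ev.const 0) ?_
    refine After.set (Ev.const 1) (After.set (Ev.const 0) ?_)
    refine After.nil ⟨fun r hr => ?_, fun b hb => ?_, rfl, rfl, rfl, rfl, rfl, rfl, rfl⟩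
    · repeat rw [setReg_reg_of_ne (by omega)]
      change State.reg (State.setReg _ 16 _) r = _
      repeat rw [setReg_reg_of_ne (by omega)]
    · exact cell_setMem (by omega) hb _
  refine Runs.mono (Runs.seq hhead fun s₁ hs₁ => ?_) (T := 100 + (3 * stepCost * k + 10)) ?_
    fun _ => id
  swap
  · unfold stepCost; omega
  obtain ⟨hreg₁, hcell₁, h7, h11, h12, h13, h14, h15, h16⟩ := hs₁
  have hload₁ : Loaded w u E (queryArgs q) s₁ :=
    h.congr st.fits hreg₁ fun a ha => by rw [hcell₁ a (by omega), if_neg (by omega)]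
  have hroot : ∀ j, 0 ∈ nodesAt ℓ (T j) 0 ↔ (T j).Nonempty := by
    intro j
    constructor
    · intro h0
      rw [nodesAt, Finset.mem_image] at h0
      exact ⟨_, h0.choose_spec.1⟩
    · intro hne
      rw [nodesAt_zero (subset_range_two_pow (hsub j)) hne]; simp
  have hloop := Runs.whileLoop (p := block rootBody) (e := argTest) (s := s₁) (by decide) k
    (ChildInv ℓ T 0 0 G s₁) (fun _ => blockCost rootBody) ?_ ?_ ?_
  rotate_left
  · intro i hi s hs
    have hs3 : s.reg 3 = BitVec.ofNat w k := (hs.reg_eq 3 (by omega) (by omega) (by omega)).trans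
      hload₁.reg_three
    have hload : Loaded w u E (queryArgs q) s :=
      hload₁.congr st.fits (fun r hr => hs.reg_eq r (by omega) (by omega) (by omega))
        fun a ha => hs.cell_eq a (by omega) (by omega)
    refine ⟨Ev.lt_ne_zero (Ev.var hs.counter) (Ev.var hs3) (by omega) hi, Runs.block (by decide) ?_⟩
    set j : Fin k := ⟨i, hi⟩ with hj
    refine After.append ((st.after_fetch hload j (Ev.var hs.counter) (fun _ => Ev.const 0)
      (Nat.zero_le _)).mono fun s' hs' => ?_)
    have hm := st.length_trieBits_lt (q j)
    have hflag : (decide (S (q j)).Nonempty).toNat ≤ 1 := Bool.toNat_le _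
    refine After.set (Ev.mul (Ev.var ((hs'.reg_eq 12 (by omega)).trans hs.exists_all))
      (Ev.mod (Ev.var hs'.count) (Ev.const 2) (by omega) (by omega))) ?_
    refine After.put (x := G + i) (v := 0) ?_ (Ev.const 0) ?_
    · exact Ev.add (Ev.var ((hs'.reg_eq 15 (by omega)).trans
        ((hs.reg_eq 15 (by omega) (by omega) (by omega)).trans h15)))
        (Ev.var ((hs'.reg_eq 11 (by omega)).trans hs.counter))
    refine After.set (Ev.add (Ev.var ((hs'.reg_eq 11 (by omega)).trans hs.counter))
      (Ev.const 1)) ?_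
    have hcell' : ∀ b < 2 ^ w, b ≠ G + i → State.cell (State.setReg (State.setMem (s'.setReg 12
        (BitVec.ofNat w ((if ∀ j : Fin k, ↑j < i → 0 ∈ nodesAt ℓ (T j) 0 then 1 else 0) *
          (((trieBits u (S (q j))).length + (decide (S (q j)).Nonempty).toNat) % 2))))
        (BitVec.ofNat w (G + i)) (BitVec.ofNat w 0)) 11 (BitVec.ofNat w (i + 1))) b = s.cell b := by
      intro b hb hne
      rw [cell_setReg, cell_setMem (by omega) hb, if_neg hne, cell_setReg, State.cell, hs'.mem_eq,
        State.cell]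
    refine After.nil ⟨fun r hr h1 h2 => ?_, rfl, ?_, fun b hb hbD => ?_, fun j' hj' => ?_⟩
    · rw [setReg_reg_of_ne h1]
      change State.reg (State.setReg _ 12 _) r = _
      rw [setReg_reg_of_ne h2, hs'.reg_eq r hr, hs.reg_eq r hr h1 h2]
    · change BitVec.ofNat w _ = _
      congr 1
      simp only [forall_lt_succ_iff hi, hroot, ← hj]
      have heven : (trieBits u (S (q j))).length % 2 = 0 := by rw [length_trieBits]; omega
      have h3 : ((trieBits u (S (q j))).length + (decide (S (q j)).Nonempty).toNat) % 2 =
          if (T j).Nonempty then 1 else 0 := by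
        by_cases hne : (S (q j)).Nonempty
        · simp only [hT, hne, decide_true, Bool.toNat_true, if_true]; omega
        · simp only [hT, hne, decide_false, Bool.toNat_false, if_false]; omega
      rw [h3]
      by_cases h4 : ∀ j : Fin k, ↑j < i → (T j).Nonempty <;>
        by_cases h5 : (T j).Nonempty <;> simp [h4, h5]
    · rw [hcell' b hb (by omega), hs.cell_eq b hb hbD]
    · rcases eq_or_ne (j' : ℕ) i with h1 | h1
      · rw [h1, cell_setReg, cell_setMem (by omega) (by omega), if_pos rfl, nodeIndex_root]
      · rw [hcell' _ (by omega) (by omega), hs.index j' (by omega)]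
  · intro s hs
    exact Ev.lt_eq_zero (Ev.var hs.counter) (Ev.var ((hs.reg_eq 3 (by omega) (by omega)
      (by omega)).trans hload₁.reg_three)) (by omega) le_rfl
  · exact ⟨fun _ _ _ _ => rfl, h11, by simpa using h12, fun _ _ _ => rfl,
      fun j hj => absurd hj (Nat.not_lt_zero _)⟩
  have hloop' := hloop.mono (T₁ := 3 * stepCost * k) (by
    have h1 : blockCost rootBody ≤ 1000 := by decide
    have h2 : argTest.cost = 3 := rfl
    rw [Finset.sum_const, Finset.card_range, smul_eq_mul, h2]
    unfold stepCost
    nlinarith) (fun _ => id)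
  refine Runs.seq hloop' fun s₂ hs₂ => Runs.mono (Runs.block (by decide) ?_)
    (show _ ≤ 10 by decide) fun _ => id
  refine After.set (Ev.var hs₂.exists_all) (After.nil ⟨X, X', G, G', ?_⟩)
  have hcell₂ : ∀ b < G, s₂.cell b = s₁.cell b := fun b hb =>
    hs₂.cell_eq b (by omega) (by omega)
  have hlist : levelList ℓ T 0 = if ∀ j : Fin k, ↑j < k → 0 ∈ nodesAt ℓ (T j) 0 then [0] else [] := by
    rw [hℓ, levelList_zero hsub]
    refine if_congr ⟨fun h' j _ => (hroot j).2 (h' j), fun h' j => (hroot j).1 (h' j j.2)⟩ rfl rfl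
  refine ⟨fun r hr => ?_, fun a ha => ?_, ?_, ?_, hlay, ?_, ?_, ?_, ?_, ?_⟩
  · rw [setReg_reg_of_ne (by omega), hs₂.reg_eq r (by omega) (by omega) (by omega), hreg₁ r hr]
  · rw [cell_setReg, hcell₂ a (by omega), hcell₁ a (by omega), if_neg (by omega)]
  · exact (hs₂.reg_eq 7 (by omega) (by omega) (by omega)).trans h7
  · rw [← hℓ, hlist]
    change BitVec.ofNat w _ = _
    congr 1
    split_ifs <;> rfl
  · exact (hs₂.reg_eq 13 (by omega) (by omega) (by omega)).trans h13
  · exact (hs₂.reg_eq 14 (by omega) (by omega) (by omega)).trans h14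
  · exact (hs₂.reg_eq 15 (by omega) (by omega) (by omega)).trans h15
  · exact (hs₂.reg_eq 16 (by omega) (by omega) (by omega)).trans h16
  · rw [← hℓ, hlist]
    split_ifs
    · refine ⟨fun a ha => ?_, fun a ha j => ?_⟩
      · obtain rfl : a = 0 := by simpa using ha
        rw [cell_setReg, hcell₂ _ (by omega), hcell₁ _ (by omega), if_pos (Nat.add_zero X)]
        rfl
      · obtain rfl : a = 0 := by simpa using ha
        rw [cell_setReg, Nat.zero_mul, Nat.zero_add]
        exact hs₂.index j j.2
    · exact StoredLevel.nil

/-- The state after the ranks of the first `i` indices have been computed, started in `s₁`. -/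
structure RankInv {w : ℕ} {k : ℕ} (T : Fin k → Finset ℕ) (G : ℕ) (L : List ℕ) (s₁ : State w)
    (i : ℕ) (s : State w) : Prop where
  reg_eq : ∀ r < 20, r ≠ 10 → s.reg r = s₁.reg r
  counter : s.reg 10 = BitVec.ofNat w i
  cell_eq : ∀ b < 2 ^ w, (b < G ∨ G + i ≤ b) → s.cell b = s₁.cell b
  rank : ∀ a (h : a < L.length) (j : Fin k), a * k + j < i →
    s.cell (G + (a * k + j)) = BitVec.ofNat w (rank (T j) L[a])

theorem Setting.runs_rankAllProgram (st : Setting w u S E q) {s₀ s : State w}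
    (h : Loaded w u E (queryArgs q) s₀) {X X' G G' : ℕ}
    (hs : LevelInv (freeBase w E (queryArgs q)) u (fun j => S (q j)) s₀ (codeLength u)
      X X' G G' s) :
    Runs rankAllProgram s (2 * stepCost * k * nodeBound u (fun j => S (q j)))
      (fun s' => IntersectionOutput u (fun j => S (q j)) s' ∧
        ∀ a < freeBase w E (queryArgs q), s'.cell a = s₀.cell a) := by
  set ℓ := codeLength u with hℓ
  set T : Fin k → Finset ℕ := fun j => S (q j) with hT
  set L := levelList ℓ T ℓ with hL
  have hk := st.one_le_k
  have hsub : ∀ j, T j ⊆ Finset.range u := fun j => st.subset (q j)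
  have hroom := st.lt_two_pow
  have hLlen : L.length ≤ u := length_levelList_le hk hsub ℓ
  have hLk : L.length * k ≤ k * u := by rw [mul_comm k]; exact Nat.mul_le_mul_right k hLlen
  have hK : (u + 1) * k = k * u + k := by ring
  have hsort : L = (interSet u T).sort (fun a b => a ≤ b) := by
    rw [hL, levelList, hℓ, commonNodes_last hk hsub]
  have hmem : ∀ x ∈ L, ∀ j, x ∈ T j := by
    intro x hx
    rw [hsort, Finset.mem_sort] at hx
    exact (Finset.mem_filter.1 hx).2
  set s₁ := s.setReg 10 (BitVec.ofNat w 0) with hs₁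
  have hload₁ : Loaded w u E (queryArgs q) s₁ :=
    (h.congr st.fits hs.reg_eq hs.cell_eq).setReg (by norm_num) _
  have hinit : Runs (block [.set 10 0]) s 10 (fun s' => s' = s₁) :=
    Runs.mono (R := fun s' => s' = s₁)
      (Runs.block (by decide) (After.set (Ev.const 0) (After.nil rfl)))
      (show _ ≤ 10 by decide) fun _ => id
  have hleG := hs.layout.le_G
  have hgeG := hs.layout.ge_G
  have hloop := Runs.whileLoop (p := block rankBody) (e := .bin .lt (reg 10) (reg 8 * reg 3))
    (s := s₁) (by decide) (L.length * k) (RankInv T G L s₁) (fun _ => blockCost rankBody) ?_ ?_ ?_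
  rotate_left
  · intro i hi s' hs'
    have hs3 : s'.reg 3 = BitVec.ofNat w k := (hs'.reg_eq 3 (by omega) (by omega)).trans
      hload₁.reg_three
    have hs8 : s'.reg 8 = BitVec.ofNat w L.length :=
      (hs'.reg_eq 8 (by omega) (by omega)).trans hs.count
    have hs15 : s'.reg 15 = BitVec.ofNat w G :=
      (hs'.reg_eq 15 (by omega) (by omega)).trans hs.reg_G
    have hload : Loaded w u E (queryArgs q) s' :=
      hload₁.congr st.fits (fun r hr => hs'.reg_eq r (by omega) (by omega))
        fun a ha => hs'.cell_eq a (by omega) (by omega)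
    refine ⟨Ev.lt_ne_zero (Ev.var hs'.counter) (Ev.mul (Ev.var hs8) (Ev.var hs3)) (by omega) hi,
      Runs.block (by decide) ?_⟩
    set j : Fin k := ⟨i % k, Nat.mod_lt _ hk⟩ with hj
    have ha : i / k < L.length := Nat.div_lt_of_lt_mul (by rwa [mul_comm])
    have hij : i / k * k + i % k = i := Nat.div_add_mod' i k
    refine After.append ((st.after_fetch hload j
      (Ev.mod (Ev.var hs'.counter) (Ev.var hs3) (by omega) (by omega)) (fun _ => Ev.const 0)
      (Nat.zero_le _)).mono fun s'' hs'' => ?_)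
    have hm := st.length_trieBits_lt (q j)
    have hrank := rank_eq_nodeIndex (u := u) (hmem _ (List.getElem_mem ha) j)
    have hcell : s''.cell (G + i) = BitVec.ofNat w (nodeIndex ℓ (T j) ℓ L[i / k]) := by
      rw [State.cell, hs''.mem_eq]
      change s'.cell (G + i) = _
      rw [hs'.cell_eq _ (by omega) (by omega), hs₁, cell_setReg]
      conv_lhs => rw [← hij]
      exact hs.stored.index _ ha j
    have hr15 := (hs''.reg_eq 15 (by omega)).trans hs15
    have hr10 := (hs''.reg_eq 10 (by omega)).trans hs'.counter
    refine After.put (x := G + i) (v := TrieIntersection.rank (T j) L[i / k])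
      (Ev.add (Ev.var hr15) (Ev.var hr10)) ?_ ?_
    · refine (Ev.sub (Ev.add (Ev.load (Ev.add (Ev.var hr15) (Ev.var hr10)) hcell) (Ev.const 1))
        (Ev.div (Ev.var hs''.length) (Ev.const 2) (by omega) (by omega)) ?_).cast ?_
      · rw [← hrank]; exact Nat.le_add_left _ _
      · rw [← hrank]; exact Nat.add_sub_cancel _ _
    refine After.set (Ev.add (Ev.var hr10) (Ev.const 1)) ?_
    have hcell' : ∀ b < 2 ^ w, (((s''.setMem (BitVec.ofNat w (G + i)) (BitVec.ofNat w
        (TrieIntersection.rank (T j) L[i / k]))).setReg 10 (BitVec.ofNat w (i + 1))).cell b) =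
        if b = G + i then BitVec.ofNat w (TrieIntersection.rank (T j) L[i / k])
        else s'.cell b := by
      intro b hb
      rw [cell_setReg, cell_setMem (by omega) hb]
      congr 1
      rw [State.cell, hs''.mem_eq, State.cell]
    refine After.nil ⟨fun r hr h1 => ?_, rfl, fun b hb hbG => ?_, fun a ha' j' haj => ?_⟩
    · rw [setReg_reg_of_ne h1]
      exact (hs''.reg_eq r hr).trans (hs'.reg_eq r hr h1)
    · rw [hcell' b hb, if_neg (by omega), hs'.cell_eq b hb (by omega)]
    · have hlt := mul_add_lt_mul ha' j'.2
      rw [hcell' _ (by omega)]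
      split_ifs with h1
      · have h2 : a * k + j' = i := by omega
        have h3 : i / k = a := by
          rw [← h2, mul_comm, Nat.mul_add_div hk, Nat.div_eq_of_lt j'.2, add_zero]
        have h4 : j = j' := by
          apply Fin.ext
          change i % k = j'
          rw [← h2, mul_comm, Nat.mul_add_mod, Nat.mod_eq_of_lt j'.2]
        subst h4
        simp only [h3]
      · exact hs'.rank a ha' j' (by omega)
  · intro s' hs'
    exact Ev.lt_eq_zero (Ev.var hs'.counter) (Ev.mul
      (Ev.var ((hs'.reg_eq 8 (by omega) (by omega)).trans hs.count))
      (Ev.var ((hs'.reg_eq 3 (by omega) (by omega)).trans hload₁.reg_three))) (by omega) le_rfl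
  · exact ⟨fun _ _ _ => rfl, rfl, fun _ _ _ => rfl, fun _ _ _ hlt => absurd hlt (Nat.not_lt_zero _)⟩
  have hbound : L.length + 1 ≤ nodeBound u T + 1 ∧ 1 ≤ nodeBound u T := by
    have h1 := codeLength_lt_nodeBound st.one_le_u T
    have h2 := sum_card_commonNodes_le hk hsub
    rw [Finset.sum_range_succ] at h2
    have h3 : L.length = (commonNodes (codeLength u) T (codeLength u)).card := by
      rw [hL, levelList, Finset.length_sort]
    omega
  refine Runs.mono (Runs.seq hinit fun s' hs' => ?_)
    (T := 10 + (1010 * (k * nodeBound u T) + 10 + 10)) ?_ fun _ => id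
  swap
  · have h1 : k * 1 ≤ k * nodeBound u T := Nat.mul_le_mul_left _ hbound.2
    have h2 : 2 * stepCost * k * nodeBound u T = 2 * stepCost * (k * nodeBound u T) := by ring
    rw [h2]
    unfold stepCost
    omega
  subst hs'
  have hloop' := hloop.mono (T₁ := 1010 * (k * nodeBound u T) + 10) (by
    have h1 : blockCost rankBody ≤ 1000 := by decide
    have h2 : (Expr.bin .lt (reg 10) (reg 8 * reg 3)).cost = 5 := rfl
    rw [Finset.sum_const, Finset.card_range, smul_eq_mul, h2]
    have h3 : L.length * k ≤ k * nodeBound u T := by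
      rw [mul_comm]; exact Nat.mul_le_mul_left _ (by omega)
    calc _ ≤ k * nodeBound u T * 1006 + 6 :=
          Nat.add_le_add (Nat.mul_le_mul h3 (by omega)) le_rfl
      _ ≤ _ := by omega) (fun _ => id)
  refine Runs.seq hloop' fun s₂ hs₂ => Runs.mono (Runs.block (by decide) ?_)
    (show _ ≤ 10 by decide) fun _ => id
  refine After.set (Ev.var ((hs₂.reg_eq 8 (by omega) (by omega)).trans hs.count)) ?_
  refine After.set (Ev.var ((hs₂.reg_eq 13 (by omega) (by omega)).trans hs.reg_X)) ?_
  refine After.set (Ev.var ((hs₂.reg_eq 15 (by omega) (by omega)).trans hs.reg_G)) ?_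
  have hXG := hs.layout.X_G
  have hleX := hs.layout.le_X
  refine After.nil ⟨⟨?_, fun a ha => ?_, fun a ha j => ?_⟩, fun a ha => ?_⟩
  · change (BitVec.ofNat w L.length).toNat = _
    rw [BitVec.toNat_ofNat, Nat.mod_eq_of_lt (by omega), hsort, Finset.length_sort]
  · simp only [← hsort] at ha ⊢
    change (s₂.mem (BitVec.ofNat w X + BitVec.ofNat w a)).toNat = _
    rw [← BitVec.ofNat_add]
    change (s₂.cell (X + a)).toNat = _
    rw [hs₂.cell_eq _ (by omega) (by omega), hs₁, cell_setReg, hs.stored.node a ha,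
      BitVec.toNat_ofNat]
    refine Nat.mod_eq_of_lt ?_
    have h1 := Finset.mem_range.1 (hsub ⟨0, hk⟩ (hmem _ (List.getElem_mem ha) ⟨0, hk⟩))
    exact lt_trans h1 (by omega)
  · simp only [← hsort] at ha ⊢
    change (s₂.mem (BitVec.ofNat w G + BitVec.ofNat w (a * k + j))).toNat = _
    rw [← BitVec.ofNat_add]
    change (s₂.cell (G + (a * k + j))).toNat = _
    rw [hs₂.rank a ha j (mul_add_lt_mul ha j.2), BitVec.toNat_ofNat]
    refine Nat.mod_eq_of_lt ?_
    have h1 : TrieIntersection.rank (T j) L[a] ≤ u :=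
      (Finset.card_filter_le _ _).trans (by simpa using Finset.card_le_card (hsub j))
    omega
  · change s₂.cell a = _
    have := st.fits.2.2.1
    rw [hs₂.cell_eq a (by omega) (by omega)]
    exact hs.cell_eq a ha

theorem Setting.runs_interProgram (st : Setting w u S E q) {s : State w}
    (h : Loaded w u E (queryArgs q) s) :
    Runs interProgram s (23 * stepCost * k * nodeBound u (fun j => S (q j)))
      (fun s' => IntersectionOutput u (fun j => S (q j)) s' ∧
        ∀ a < freeBase w E (queryArgs q), s'.cell a = s.cell a) := by
  refine Runs.mono (Runs.seq (st.runs_rootProgram h) fun s₁ hs₁ => ?_)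
    (T := 5 * stepCost * k + (15 * stepCost * k * nodeBound u (fun j => S (q j)) + stepCost +
      2 * stepCost * k * nodeBound u (fun j => S (q j)))) ?_ fun _ => id
  · obtain ⟨X, X', G, G', hs₁⟩ := hs₁
    refine Runs.seq (st.runs_levelLoop h hs₁) fun s₂ hs₂ => ?_
    obtain ⟨X, X', G, G', hs₂⟩ := hs₂
    exact st.runs_rankAllProgram h hs₂
  · have h1 := codeLength_lt_nodeBound st.one_le_u (fun j => S (q j))
    have hk := st.one_le_k
    generalize nodeBound u (fun j => S (q j)) = M at *
    have h2 : k * 1 ≤ k * M := Nat.mul_le_mul_left _ (by omega)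
    have h3 : ∀ c, c * stepCost * k * M = c * stepCost * (k * M) := fun c => by ring
    have h4 : 5 * stepCost * k ≤ 5 * stepCost * (k * M) := Nat.mul_le_mul_left _ (by omega)
    rw [h3, h3, h3]
    unfold stepCost at *
    omega

end Program

/-! ### The bounds of the theorem -/

theorem length_encoding_le {u : ℕ} {S : Finset ℕ} (hu : 1 ≤ u) (hS : S ⊆ Finset.range u)
    (flag : Bool) : (auxBits (trieBits u S) flag ++ trieBits u S).length ≤ 324 * (u + 1) := by
  rw [List.length_append, length_auxBits]
  have h1 := auxLen_le (trieBits u S).length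
  have h2 := length_trieBits_le hu hS
  omega

theorem length_encoding_le_redundancy (u : ℕ) {S : Finset ℕ} (hS : S ⊆ Finset.range u)
    (flag : Bool) : ((auxBits (trieBits u S) flag ++ trieBits u S).length : ℝ) ≤
      2 * ((trieMeasure u S : ℝ) - (S.card : ℝ) + 1) + redundancy (trieMeasure u S) := by
  have h1 := length_trieBits_add_le u hS
  have h2 := auxLen_le_redundancy (m := (trieBits u S).length) (t := trieMeasure u S) (by omega)
  have h3 : ((trieBits u S).length : ℝ) + 2 * S.card ≤ 2 * trieMeasure u S + 2 := by
    exact_mod_cast h1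
  rw [List.length_append, length_auxBits]
  push_cast
  linarith

/-- The data occupy `O((N + 1) * (u + 1))` cells. -/
theorem freeBase_le {w u N : ℕ} {E : Fin N → List Bool} {args : List ℕ} (hw : 0 < w)
    (hE : ∀ i, (E i).length ≤ 324 * (u + 1)) :
    startBit E N ≤ 324 * ((N + 1) * (u + 1)) ∧
      freeBase w E args ≤ N + 2 + 324 * ((N + 1) * (u + 1)) + args.length := by
  have h1 := startBit_le E _ hE
  have h2 : N * (324 * (u + 1)) ≤ 324 * ((N + 1) * (u + 1)) := by nlinarith
  have h3 : (startBit E N + w - 1) / w ≤ startBit E N + 1 := by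
    refine Nat.div_le_of_le_mul ?_
    have : startBit E N ≤ w * startBit E N := Nat.le_mul_of_pos_left _ hw
    rw [Nat.mul_add]
    omega
  refine ⟨h1.trans h2, ?_⟩
  unfold freeBase argBase
  omega

theorem Runs.exists_exec {w : ℕ} {p : Prog} {s : State w} {T : ℕ} {Q : State w → Prop}
    (h : Runs p s T Q) : ∃ t s₁, Exec p s t s₁ ∧ t ≤ T ∧ ∃ s₂, Sim s₂ s₁ ∧ Q s₂ := h s (Sim.refl s)

theorem IntersectionOutput.of_sim {w u k : ℕ} {T : Fin k → Finset ℕ} {s s' : State w}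
    (h : IntersectionOutput u T s) (hs : Sim s s') : IntersectionOutput u T s' := by
  refine ⟨?_, fun j hj => ?_, fun j hj c => ?_⟩
  · rw [hs.1 0 (by omega)]; exact h.count
  · rw [hs.1 1 (by omega), hs.2]; exact h.elements j hj
  · rw [hs.1 2 (by omega), hs.2]; exact h.ranks j hj c

end TrieIntersection

theorem theorem2 :
    ∃ (aux : ℕ → Finset ℕ → List Bool) (f : ℕ → ℝ) (rankProg interProg : Prog) (A C : ℕ),
      -- space: the level-wise trie bits together with `o(trie(S))` auxiliary bits
      f =o[Filter.atTop] (fun t : ℕ => (t : ℝ)) ∧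
      (∀ (u : ℕ) (S : Finset ℕ), 1 ≤ u → S ⊆ Finset.range u →
        ((aux u S ++ trieBits u S).length : ℝ) ≤
          2 * ((trieMeasure u S : ℝ) - (S.card : ℝ) + 1) + f (trieMeasure u S)) ∧
      -- a stored family, on a word RAM whose words can hold addresses
      ∀ (u N w : ℕ) (S : Fin N → Finset ℕ) (E : Fin N → List Bool),
        1 ≤ u → (∀ i, S i ⊆ Finset.range u) →
        (∀ i, E i = aux u (S i) ++ trieBits u (S i)) →
        A * (N + 1) * (u + 1) ≤ 2 ^ w →
        -- rank on the trie bits in constant time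
        (∀ (i : Fin N) (p : ℕ), p ≤ (trieBits u (S i)).length →
          Fits w u E [(i : ℕ), p] ∧
          ∀ s : State w, Loaded w u E [(i : ℕ), p] s →
            ∃ (t : ℕ) (s' : State w), Exec rankProg s t s' ∧ t ≤ C ∧
              (s'.reg 0).toNat = ((trieBits u (S i)).take p).count true ∧
              ∀ a < freeBase w E [(i : ℕ), p], s'.cell a = s.cell a) ∧
        -- intersection queries, with all ranks
        (∀ (k : ℕ) (q : Fin k ↪ Fin N), 1 ≤ k →
          Fits w u E (List.ofFn fun j => (q j : ℕ)) ∧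
          ∀ s : State w, Loaded w u E (List.ofFn fun j => (q j : ℕ)) s →
            ∃ (t : ℕ) (s' : State w), Exec interProg s t s' ∧
              (t : ℝ) ≤ C * k * (alternation u fun j => S (q j)) *
                (1 + Real.logb 2 (u / (alternation u fun j => S (q j)))) ∧
              IntersectionOutput u (fun j => S (q j)) s' ∧
              ∀ a < freeBase w E (List.ofFn fun j => (q j : ℕ)), s'.cell a = s.cell a) := by
  refine ⟨fun u S => auxBits (trieBits u S) (decide S.Nonempty), redundancy, block rankCode,
    interProgram, 400, 4 * (23 * stepCost), redundancy_isLittleO,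
    fun u S _ hS => length_encoding_le_redundancy u hS _, ?_⟩
  intro u N w S E hu hS hE hA
  have hlen : ∀ i, (E i).length ≤ 324 * (u + 1) := fun i => by
    rw [hE i]; exact length_encoding_le hu (hS i) _
  rw [mul_assoc] at hA
  have hP1 : N + 1 ≤ (N + 1) * (u + 1) := Nat.le_mul_of_pos_right _ (by omega)
  have hP2 : u + 1 ≤ (N + 1) * (u + 1) := Nat.le_mul_of_pos_left _ (by omega)
  have hw : 2 ≤ w := by
    by_contra h
    have : 2 ^ w ≤ 2 ^ 1 := Nat.pow_le_pow_right (by norm_num) (by omega)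
    omega
  constructor
  · intro i p hp
    have hm := length_trieBits_le hu (hS i)
    obtain ⟨h1, h2⟩ := freeBase_le (args := [(i : ℕ), p]) (by omega : 0 < w) hlen
    have hi := i.2
    refine ⟨⟨by omega, by omega, ?_, ?_⟩, fun s hs => ?_⟩
    · simp only [List.length_cons, List.length_nil] at h2
      omega
    · intro x hx
      simp only [List.mem_cons, List.not_mem_nil, or_false] at hx
      rcases hx with rfl | rfl <;> omega
    · have heven : (trieBits u (S i)).length % 2 = 0 := by rw [length_trieBits]; omega
      obtain ⟨t, s₁, hex, ht, s₂, hsim, hreg, hmem⟩ :=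
        (runs_rankCode hs hw (by omega) _ _ (hE i) heven hp).exists_exec
      refine ⟨t, s₁, hex, ht.trans (show blockCost rankCode ≤ 4 * (23 * stepCost) by decide), ?_,
        fun a _ => ?_⟩
      · rw [hsim.1 0 (by omega), hreg, BitVec.toNat_ofNat, Nat.mod_eq_of_lt]
        · rfl
        · exact (onesBefore_le _ _).trans_lt (by omega)
      · rw [State.cell, hsim.2, hmem, State.cell]
  · intro k q hk
    have hkN : k ≤ N := by simpa using Fintype.card_le_of_embedding q
    obtain ⟨h1, h2⟩ := freeBase_le (args := queryArgs q) (by omega : 0 < w) hlen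
    have hargs : (queryArgs q).length = k := by simp [queryArgs]
    have hK : (u + 1) * k ≤ (N + 1) * (u + 1) := by
      rw [mul_comm]; exact Nat.mul_le_mul_right _ (by omega)
    have hfits : Fits w u E (queryArgs q) := by
      refine ⟨by omega, by omega, by omega, fun x hx => ?_⟩
      obtain ⟨j, rfl⟩ := (List.mem_ofFn' _ _).1 hx
      have := (q j).2
      change (q j : ℕ) < 2 ^ w
      omega
    have st : Setting w u S E q := ⟨hw, hu, hk, hS, hE, hfits, by omega⟩
    refine ⟨hfits, fun s hs => ?_⟩
    obtain ⟨t, s₁, hex, ht, s₂, hsim, hout, hcell⟩ := (st.runs_interProgram hs).exists_exec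
    refine ⟨t, s₁, hex, ?_, hout.of_sim hsim, fun a ha => ?_⟩
    · have h3 := nodeBound_le hu fun j => S (q j)
      have h4 : (t : ℝ) ≤ 23 * stepCost * k * nodeBound u fun j => S (q j) := by exact_mod_cast ht
      refine h4.trans ((mul_le_mul_of_nonneg_left h3 (by positivity)).trans (le_of_eq ?_))
      push_cast
      ring
    · rw [State.cell, hsim.2]
      exact hcell a ha
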